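/- **Setting.** Let $Y_j=(X^{(1)}_j,X^{(2)}_j)$, $j\ge 1$, be i.i.d. couples of positive incomes at two periods $i=1,2$, with continuous marginal distribution functions $F_1,F_2$ and copula $C$ (so $\mathbb P(X^{(1)}\le x,X^{(2)}\le y)=C(F_1(x),F_2(y))$); let $(U^{(1)},U^{(2)})$ have law $C$, and put $\mathbb P_C(f)=\int f\,dC$, $\ell_i=F_i^{-1}$, $\mu(i)=\mathbb E X^{(i)}$, $A(i)=\mathbb E[X^{(i)}F_i(X^{(i)})]$. Let $X^{(i)}_{1,n}\le\dots\le X^{(i)}_{n,n}$ be the order statistics and $\mu_n(i)$ the empirical mean. *Gini index:* $GI_n(i)=\frac1{\mu_n(i)}\frac1n\sum_{j=1}^n\big(\frac{2j-1}n-1\big)X^{(i)}_{j,n}$ and $GI(i)=\frac{2A(i)}{\mu(i)}-1$. *General Poverty Index:* for poverty lines $Z(i)>0$, with $Q_n(i)=\#\{j\le n: X_j^{(i)}\le Z(i)\}$ and $B(q)=\sum_{j=1}^{q}w(j)$, $$J_n(i)=\frac{A(Q_n(i),n,Z(i))}{nB(Q_n(i))}\sum_{j=1}^{Q_n(i)}w\big(\mu_1n+\mu_2Q_n(i)-\mu_3j+\mu_4\big)\,d\Big(\frac{Z(i)-X^{(i)}_{j,n}}{Z(i)}\Big),$$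 where $A,w,d$ are functions ($d$ measurable) and $\mu_1,\dots,\mu_4$ constants. Put $p_i=F_i(Z(i))$ and $q_i(x)=d\big(\frac{Z(i)-x}{Z(i)}\big)1_{x\le Z(i)}$. It is assumed that there are weights $c_i(p,s)$, of class $C^1$ in a neighbourhood of $\{p_i\}\times[0,p_i]$, such that $$\max_{1\le j\le Q_n(i)}\Big|\frac{A(Q_n(i),n,Z(i))\,w(\mu_1n+\mu_2Q_n(i)-\mu_3j+\mu_4)}{B(Q_n(i))}-c_i\Big(\frac{Q_n(i)}n,\frac jn\Big)\Big|=o_{\mathbb P}(n^{-1/2}),$$ and the exact index is $J(i)=\int_0^{Z(i)}c_i(p_i,F_i(x))\,d\big(\frac{Z(i)-x}{Z(i)}\big)\,dF_i(x)$. Let $$g_i(x)=c_i(p_i,F_i(x))q_i(x)+K_i1_{x\le Z(i)},\quad K_i=\int_0^1\partial_pc_i(p_i,s)\,q_i(\ell_i(s))\,ds,\quad \nu_i(s)=\partial_sc_i(p_i,s)\,q_i(\ell_i(s))$$ (if $c_i$ depends on $s$ only, then $K_i=0$). *Functions and covariances.* Let $L_i=\frac2{\mu(i)}\ell_i$, $F^*(u,v)=\frac{2}{\mu(2)}v\,\ell_2(v)-\frac{2}{\mu(1)}u\,\ell_1(u)$,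 $\tilde F^*(u,v)=2\big(\frac{A(2)}{\mu(2)^2}\ell_2(v)-\frac{A(1)}{\mu(1)^2}\ell_1(u)\big)$, $F^*_J(u,v)=g_2(\ell_2(v))-g_1(\ell_1(u))$. Let $\Gamma^*(f,g)$ be the covariance of $f(U^{(1)},U^{(2)})$ and $g(U^{(1)},U^{(2)})$, and for functions $\varphi,\psi$ on $(0,1)$ let $\gamma_1(\varphi,\psi)=\int_0^1\!\int_0^1 \varphi(s)\psi(t)(\min(s,t)-st)\,ds\,dt$ and $\gamma_2(\varphi,\psi)=\int_0^1\!\int_0^1\varphi(s)\psi(t)(C(s,t)-st)\,ds\,dt$. For pairs $\varphi=(\varphi_1,\varphi_2)$ and $\psi=(\psi_1,\psi_2)$ of such functions put $$\Gamma^*(f,\beta^*_\varphi)=\int_0^1\!\varphi_2(s)\!\int_{[0,1]\times(0,s)}\!f\,dC\,ds-\int_0^1\!\varphi_1(s)\!\int_{(0,s)\times[0,1]}\!f\,dC\,ds-\mathbb P_C(f)\int_0^1 s(\varphi_2(s)-\varphi_1(s))\,ds,$$ $$\Gamma^*(\beta^*_\varphi,\beta^*_\psi)=\gamma_1(\varphi_1,\psi_1)+\gamma_1(\varphi_2,\psi_2)-\gamma_2(\varphi_1,\psi_2)-\gamma_2(\psi_1,\varphi_2).$$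 Let $\mathbb T$ denote a centered Gaussian process indexed by $L^2(C)$ with covariance $\Gamma^*$, taken measurable along the indicators below; put $f_{1,s}(u,v)=1_{(0,s)}(u)$, $f_{2,s}(u,v)=1_{(0,s)}(v)$, $\beta^*(\varphi)=\int_0^1(\mathbb T(f_{2,s})\varphi_2(s)-\mathbb T(f_{1,s})\varphi_1(s))\,ds$, and $$\mathcal G_{\Delta GPI}=\mathbb T(F_J^*)+\beta^*(\nu),\qquad \mathcal G_{\Delta GI}=\mathbb T(F^*)+\beta^*(L)-\mathbb T(\tilde F^*).$$ **Theorem.** Assume moreover that for $i=1,2$ the mean $\mu(i)$ is finite and nonzero, $L_i$ is bounded on $(0,1)$, $\mathbb E|q_i(X^{(i)})|<\infty$, and $F^*_J\in L^2(C)$. Write $\Delta I=I(2)-I(1)$ for an index $I$. Then, as $n\to\infty$, $$\big(\sqrt n(\Delta J_n-\Delta J),\ \sqrt n(\Delta GI_n-\Delta GI)\big)\to_d\mathcal N_2(0,\Sigma),\qquad \Sigma=\begin{pmatrix}\sigma^2_{\Delta GPI}&\sigma_{\Delta GPI,\Delta GI}\\ \sigma_{\Delta GPI,\Delta GI}&\sigma^2_{\Delta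 GI}\end{pmatrix},$$ $\mathcal N_2(0,\Sigma)$ is the law of $(\mathcal G_{\Delta GPI},\mathcal G_{\Delta GI})$, $\Sigma$ is positive semidefinite, and $$\sigma^2_{\Delta GPI}=\Gamma^*(F^*_J,F^*_J)+\Gamma^*(\beta^*_\nu,\beta^*_\nu)+2\Gamma^*(F^*_J,\beta^*_\nu),$$ $$\sigma^2_{\Delta GI}=\Gamma^*(F^*,F^*)+\Gamma^*(\tilde F^*,\tilde F^*)+\Gamma^*(\beta^*_L,\beta^*_L)-2\big(\Gamma^*(F^*,\tilde F^*)+\Gamma^*(\tilde F^*,\beta^*_L)-\Gamma^*(F^*,\beta^*_L)\big),$$ $$\sigma_{\Delta GPI,\Delta GI}=\Gamma^*(F^*_J,F^*)+\Gamma^*(F^*_J,\beta^*_L)-\Gamma^*(F^*_J,\tilde F^*)+\Gamma^*(F^*,\beta^*_\nu)+\Gamma^*(\beta^*_L,\beta^*_\nu)-\Gamma^*(\tilde F^*,\beta^*_\nu).$$ If in addition $\Delta GI\ne0$, then with $R_n=\Delta J_n/\Delta GI_n$, $R=\Delta J/\Delta GI$, $a=1/\Delta GI$, $b=\Delta J/(\Delta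 GI)^2$, $$\sqrt n(R_n-R)\to_d a\,\mathcal G_{\Delta GPI}-b\,\mathcal G_{\Delta GI}\sim\mathcal N(0,\sigma_R^2),\qquad \sigma_R^2=a^2\sigma^2_{\Delta GPI}+b^2\sigma^2_{\Delta GI}-2ab\,\sigma_{\Delta GPI,\Delta GI}.$$ -/

import Mathlib

open MeasureTheory ProbabilityTheory Filter Topology Set

/-!
Incomes of a population at two periods form a couple `(X 0, X 1) : Fin 2 → ℝ` with law `ρ`
(index `0` is the first period, index `1` the second one).
-/

namespace GiniPoverty

noncomputable section

/-! ### Margins, quantile functions, copula -/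

/-- Law of the income at period `i`. -/
def margin (ρ : Measure (Fin 2 → ℝ)) (i : Fin 2) : Measure ℝ := ρ.map (fun y => y i)

/-- Marginal cumulative distribution function `F_i`. -/
def F (ρ : Measure (Fin 2 → ℝ)) (i : Fin 2) (x : ℝ) : ℝ := cdf (margin ρ i) x

/-- Generalized inverse `ℓ_i = F_i⁻¹`, used for `s ∈ (0,1)`. -/
def ell (ρ : Measure (Fin 2 → ℝ)) (i : Fin 2) (s : ℝ) : ℝ := sInf {x : ℝ | s ≤ F ρ i x}

/-- `C` is (the probability measure of) a copula of `ρ`: uniform margins on `[0,1]` and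
Sklar's identity `F_ρ(x, y) = C(F_0(x), F_1(y))`. -/
structure IsCopulaOf (C : Measure (Fin 2 → ℝ)) (ρ : Measure (Fin 2 → ℝ)) : Prop where
  uniform_margin : ∀ i, C.map (fun u => u i) = (volume : Measure ℝ).restrict (Icc 0 1)
  sklar : ∀ x : Fin 2 → ℝ, C {u | ∀ i, u i ≤ F ρ i (x i)} = ρ {y | ∀ i, y i ≤ x i}

/-- Distribution function `C(s,t)` of the copula. -/
def copulaFun (C : Measure (Fin 2 → ℝ)) (s t : ℝ) : ℝ := C.real {u | u 0 ≤ s ∧ u 1 ≤ t}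

/-! ### Empirical indices

`y` is a realization of the sequence of income couples; the sample of size `n` consists of
`y 0, …, y (n - 1)`. -/

/-- Order statistic: `orderStat y i n k` is `X^{(i)}_{k+1,n}`. -/
def orderStat (y : ℕ → Fin 2 → ℝ) (i : Fin 2) (n : ℕ) (k : Fin n) : ℝ :=
  ((fun j : Fin n => y j i) ∘ Tuple.sort (fun j : Fin n => y j i)) k

/-- Empirical mean `μ_n(i)`. -/
def empMean (y : ℕ → Fin 2 → ℝ) (i : Fin 2) (n : ℕ) : ℝ :=
  (1 / (n : ℝ)) * ∑ j : Fin n, y j i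

/-- Empirical Gini index `GI_n(i)`. -/
def giniN (y : ℕ → Fin 2 → ℝ) (i : Fin 2) (n : ℕ) : ℝ :=
  (1 / empMean y i n) * ((1 / (n : ℝ)) *
    ∑ k : Fin n, ((2 * ((k : ℕ) + 1 : ℝ) - 1) / n - 1) * orderStat y i n k)

/-- The ingredients `A, w, d, μ₁, μ₂, μ₃, μ₄` of a General Poverty Index. -/
structure PovertySpec where
  A : ℕ → ℕ → ℝ → ℝ
  w : ℝ → ℝ
  d : ℝ → ℝ
  mu₁ : ℝ
  mu₂ : ℝ
  mu₃ : ℝ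
  mu₄ : ℝ

/-- `B(q) = ∑_{j=1}^{q} w(j)`. -/
def PovertySpec.B (S : PovertySpec) (q : ℕ) : ℝ := ∑ j ∈ Finset.Icc 1 q, S.w j

/-- Number of poor `Q_n(i)` with respect to the poverty line `z`. -/
def poorN (z : ℝ) (y : ℕ → Fin 2 → ℝ) (i : Fin 2) (n : ℕ) : ℕ :=
  ((Finset.range n).filter (fun j => y j i ≤ z)).card

/-- The General Poverty Index `J_n(i)` with poverty line `z`:
`A(Q,n,z)/(n B(Q)) ∑_{j=1}^{Q} w(μ₁ n + μ₂ Q - μ₃ j + μ₄) d((z - X_{j,n})/z)`. -/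
def gpiN (S : PovertySpec) (z : ℝ) (y : ℕ → Fin 2 → ℝ) (i : Fin 2) (n : ℕ) : ℝ :=
  S.A (poorN z y i n) n z / (n * S.B (poorN z y i n)) *
    ∑ k ∈ Finset.univ.filter (fun k : Fin n => (k : ℕ) < poorN z y i n),
      S.w (S.mu₁ * n + S.mu₂ * (poorN z y i n) - S.mu₃ * ((k : ℕ) + 1) + S.mu₄) *
        S.d ((z - orderStat y i n k) / z)

/-- Largest deviation, over the ranks `1 ≤ j ≤ q`, between the weight
`A(q,n,z) w(μ₁ n + μ₂ q - μ₃ j + μ₄) / B(q)` and the continuous weight `c(q/n, j/n)`. -/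
def weightGap (S : PovertySpec) (c : ℝ → ℝ → ℝ) (z : ℝ) (n q : ℕ) : ℝ :=
  ⨆ k : Fin q,
    |S.A q n z * S.w (S.mu₁ * n + S.mu₂ * q - S.mu₃ * ((k : ℕ) + 1) + S.mu₄) / S.B q
      - c ((q : ℝ) / n) ((((k : ℕ) + 1 : ℕ) : ℝ) / n)|

/-- `c` is of class `C¹` around the segment `{p} × [0,p]`. -/
def SmoothWeight (c : ℝ → ℝ → ℝ) (p : ℝ) : Prop :=
  ∃ U : Set (ℝ × ℝ), IsOpen U ∧ (∀ s ∈ Icc 0 p, (p, s) ∈ U) ∧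
    ContDiffOn ℝ 1 (fun a : ℝ × ℝ => c a.1 a.2) U

/-! ### Theoretical indices -/

/-- Mean income `μ(i)`. -/
def mean (ρ : Measure (Fin 2 → ℝ)) (i : Fin 2) : ℝ := ∫ x, x ∂(margin ρ i)

/-- `A(i) = E[X^{(i)} F_i(X^{(i)})]`. -/
def giniA (ρ : Measure (Fin 2 → ℝ)) (i : Fin 2) : ℝ := ∫ x, x * F ρ i x ∂(margin ρ i)

/-- Gini index `GI(i) = 2 A(i) / μ(i) - 1`. -/
def gini (ρ : Measure (Fin 2 → ℝ)) (i : Fin 2) : ℝ := 2 * giniA ρ i / mean ρ i - 1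

/-- Poverty index
`J(i) = ∫_0^{Z(i)} c_i(F_i(Z(i)), F_i(x)) d((Z(i) - x)/Z(i)) dF_i(x)`. -/
def gpi (S : PovertySpec) (c : Fin 2 → ℝ → ℝ → ℝ) (Z : Fin 2 → ℝ) (ρ : Measure (Fin 2 → ℝ))
    (i : Fin 2) : ℝ :=
  ∫ x in Ioc 0 (Z i), c i (F ρ i (Z i)) (F ρ i x) * S.d ((Z i - x) / Z i) ∂(margin ρ i)

/-! ### Covariance functionals -/

/-- `Γ*(f,g)`: covariance of `f` and `g` under the copula. -/
def Gam (C : Measure (Fin 2 → ℝ)) (f g : (Fin 2 → ℝ) → ℝ) : ℝ :=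
  ∫ u, (f u - ∫ v, f v ∂C) * (g u - ∫ v, g v ∂C) ∂C

/-- `γ₁(f,g) = ∫∫ f(s) g(t) (min(s,t) - s t) ds dt`. -/
def gam₁ (f g : ℝ → ℝ) : ℝ :=
  ∫ s in (0 : ℝ)..1, ∫ t in (0 : ℝ)..1, f s * g t * (min s t - s * t)

/-- `γ₂(f,g) = ∫∫ f(s) g(t) (C(s,t) - s t) ds dt`. -/
def gam₂ (C : Measure (Fin 2 → ℝ)) (f g : ℝ → ℝ) : ℝ :=
  ∫ s in (0 : ℝ)..1, ∫ t in (0 : ℝ)..1, f s * g t * (copulaFun C s t - s * t)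

/-- `Γ*(f, β*_φ)`. -/
def GamBeta (C : Measure (Fin 2 → ℝ)) (f : (Fin 2 → ℝ) → ℝ) (φ : Fin 2 → ℝ → ℝ) : ℝ :=
  (∫ s in (0 : ℝ)..1, φ 1 s * ∫ u in {u : Fin 2 → ℝ | u 1 ∈ Ioo 0 s}, f u ∂C)
    - (∫ s in (0 : ℝ)..1, φ 0 s * ∫ u in {u : Fin 2 → ℝ | u 0 ∈ Ioo 0 s}, f u ∂C)
    - (∫ u, f u ∂C) * ∫ s in (0 : ℝ)..1, s * (φ 1 s - φ 0 s)

/-- `Γ*(β*_φ, β*_ψ)`; in `γ₂` the first argument belongs to the first period. -/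
def BetaBeta (C : Measure (Fin 2 → ℝ)) (φ ψ : Fin 2 → ℝ → ℝ) : ℝ :=
  gam₁ (φ 0) (ψ 0) + gam₁ (φ 1) (ψ 1) - gam₂ C (φ 0) (ψ 1) - gam₂ C (ψ 0) (φ 1)

/-! ### The functions attached to the Gini index -/

/-- `L_i = (2/μ(i)) ℓ_i`. -/
def L (ρ : Measure (Fin 2 → ℝ)) (i : Fin 2) (s : ℝ) : ℝ := 2 / mean ρ i * ell ρ i s

/-- `F*_{i,h}(u) = (2/μ(i)) u_i ℓ_i(u_i)`. -/
def FstarH (ρ : Measure (Fin 2 → ℝ)) (i : Fin 2) (u : Fin 2 → ℝ) : ℝ :=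
  2 / mean ρ i * (u i * ell ρ i (u i))

/-- `F* = F*_{2,h} - F*_{1,h}`. -/
def Fstar (ρ : Measure (Fin 2 → ℝ)) (u : Fin 2 → ℝ) : ℝ := FstarH ρ 1 u - FstarH ρ 0 u

/-- `F̃* = 2 (A(2)/μ(2)² f̃_2 - A(1)/μ(1)² f̃_1)` with `f̃_i(u) = ℓ_i(u_i)`. -/
def Ftilde (ρ : Measure (Fin 2 → ℝ)) (u : Fin 2 → ℝ) : ℝ :=
  2 * (giniA ρ 1 / mean ρ 1 ^ 2 * ell ρ 1 (u 1) - giniA ρ 0 / mean ρ 0 ^ 2 * ell ρ 0 (u 0))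

/-! ### The functions attached to the poverty index -/

/-- `q_i(x) = d((Z(i) - x)/Z(i)) 1_{x ≤ Z(i)}`. -/
def q (S : PovertySpec) (Z : Fin 2 → ℝ) (i : Fin 2) (x : ℝ) : ℝ :=
  (Iic (Z i)).indicator (fun x => S.d ((Z i - x) / Z i)) x

/-- Effect on the index of replacing `F_i(Z(i))` by the empirical proportion of the poor:
`K_i = ∫_0^1 (∂c_i/∂p)(F_i(Z(i)), s) q_i(ℓ_i(s)) ds`.
It vanishes when `c_i(p, s)` does not depend on `p`. -/
def K (S : PovertySpec) (c : Fin 2 → ℝ → ℝ → ℝ) (Z : Fin 2 → ℝ) (ρ : Measure (Fin 2 → ℝ))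
    (i : Fin 2) : ℝ :=
  ∫ s in (0 : ℝ)..1, deriv (fun p => c i p s) (F ρ i (Z i)) * q S Z i (ell ρ i s)

/-- `g_i(x) = c_i(F_i(Z(i)), F_i(x)) q_i(x) + K_i 1_{x ≤ Z(i)}`. -/
def g (S : PovertySpec) (c : Fin 2 → ℝ → ℝ → ℝ) (Z : Fin 2 → ℝ) (ρ : Measure (Fin 2 → ℝ))
    (i : Fin 2) (x : ℝ) : ℝ :=
  c i (F ρ i (Z i)) (F ρ i x) * q S Z i x + (Iic (Z i)).indicator (fun _ => K S c Z ρ i) x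

/-- `ν_i(s) = (∂c_i/∂s)(F_i(Z(i)), s) q_i(ℓ_i(s))`. -/
def nu (S : PovertySpec) (c : Fin 2 → ℝ → ℝ → ℝ) (Z : Fin 2 → ℝ) (ρ : Measure (Fin 2 → ℝ))
    (i : Fin 2) (s : ℝ) : ℝ :=
  deriv (fun t => c i (F ρ i (Z i)) t) s * q S Z i (ell ρ i s)

/-- `F*_J(u) = g_2(ℓ_2(u_2)) - g_1(ℓ_1(u_1))`. -/
def FstarJ (S : PovertySpec) (c : Fin 2 → ℝ → ℝ → ℝ) (Z : Fin 2 → ℝ) (ρ : Measure (Fin 2 → ℝ))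
    (u : Fin 2 → ℝ) : ℝ :=
  g S c Z ρ 1 (ell ρ 1 (u 1)) - g S c Z ρ 0 (ell ρ 0 (u 0))

/-! ### Asymptotic variances and covariance -/

/-- `σ²_{ΔGI}`. -/
def varGini (C ρ : Measure (Fin 2 → ℝ)) : ℝ :=
  Gam C (Fstar ρ) (Fstar ρ) + Gam C (Ftilde ρ) (Ftilde ρ) + BetaBeta C (L ρ) (L ρ)
    - 2 * (Gam C (Fstar ρ) (Ftilde ρ) + GamBeta C (Ftilde ρ) (L ρ) - GamBeta C (Fstar ρ) (L ρ))

/-- `σ²_{ΔGPI}`. -/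
def varGpi (S : PovertySpec) (c : Fin 2 → ℝ → ℝ → ℝ) (Z : Fin 2 → ℝ)
    (C ρ : Measure (Fin 2 → ℝ)) : ℝ :=
  Gam C (FstarJ S c Z ρ) (FstarJ S c Z ρ) + BetaBeta C (nu S c Z ρ) (nu S c Z ρ)
    + 2 * GamBeta C (FstarJ S c Z ρ) (nu S c Z ρ)

/-- `σ_{ΔGPI,ΔGI}`. -/
def covGpiGini (S : PovertySpec) (c : Fin 2 → ℝ → ℝ → ℝ) (Z : Fin 2 → ℝ)
    (C ρ : Measure (Fin 2 → ℝ)) : ℝ :=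
  Gam C (FstarJ S c Z ρ) (Fstar ρ) + GamBeta C (FstarJ S c Z ρ) (L ρ)
    - Gam C (FstarJ S c Z ρ) (Ftilde ρ)
    + GamBeta C (Fstar ρ) (nu S c Z ρ) + BetaBeta C (L ρ) (nu S c Z ρ)
    - GamBeta C (Ftilde ρ) (nu S c Z ρ)

/-- The covariance matrix `Σ`. -/
def Sig (S : PovertySpec) (c : Fin 2 → ℝ → ℝ → ℝ) (Z : Fin 2 → ℝ)
    (C ρ : Measure (Fin 2 → ℝ)) : Matrix (Fin 2) (Fin 2) ℝ :=
  !![varGpi S c Z C ρ, covGpiGini S c Z C ρ; covGpiGini S c Z C ρ, varGini C ρ]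

/-! ### Variations between the two periods and their ratio -/

/-- `ΔJ(1,2)`. -/
def deltaGpi (S : PovertySpec) (c : Fin 2 → ℝ → ℝ → ℝ) (Z : Fin 2 → ℝ) (ρ : Measure (Fin 2 → ℝ)) :
    ℝ := gpi S c Z ρ 1 - gpi S c Z ρ 0

/-- `ΔGI(1,2)`. -/
def deltaGini (ρ : Measure (Fin 2 → ℝ)) : ℝ := gini ρ 1 - gini ρ 0

/-- `ΔJ_n(1,2)`. -/
def deltaGpiN (S : PovertySpec) (Z : Fin 2 → ℝ) (y : ℕ → Fin 2 → ℝ) (n : ℕ) : ℝ :=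
  gpiN S (Z 1) y 1 n - gpiN S (Z 0) y 0 n

/-- `ΔGI_n(1,2)`. -/
def deltaGiniN (y : ℕ → Fin 2 → ℝ) (n : ℕ) : ℝ := giniN y 1 n - giniN y 0 n

/-- `a = 1 / ΔGI(1,2)`. -/
def coefA (ρ : Measure (Fin 2 → ℝ)) : ℝ := 1 / deltaGini ρ

/-- `b = ΔJ(1,2) / ΔGI(1,2)²`. -/
def coefB (S : PovertySpec) (c : Fin 2 → ℝ → ℝ → ℝ) (Z : Fin 2 → ℝ) (ρ : Measure (Fin 2 → ℝ)) :
    ℝ := deltaGpi S c Z ρ / deltaGini ρ ^ 2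

/-- `σ²_R = a² σ²_{ΔGPI} + b² σ²_{ΔGI} - 2 a b σ_{ΔGPI,ΔGI}`. -/
def varR (S : PovertySpec) (c : Fin 2 → ℝ → ℝ → ℝ) (Z : Fin 2 → ℝ)
    (C ρ : Measure (Fin 2 → ℝ)) : ℝ :=
  coefA ρ ^ 2 * varGpi S c Z C ρ + coefB S c Z ρ ^ 2 * varGini C ρ
    - 2 * coefA ρ * coefB S c Z ρ * covGpiGini S c Z C ρ

/-! ### The limiting Gaussian field and the limits built from it -/

/-- `f_{i,s}(u) = 1_{(0,s)}(u_i)`. -/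
def fInd (i : Fin 2) (s : ℝ) (u : Fin 2 → ℝ) : ℝ := (Ioo 0 s).indicator (fun _ => (1 : ℝ)) (u i)

/-- `T` is a functional Brownian bridge of `C`: a centered Gaussian process indexed by the
square integrable functions, with covariance `Γ*`, and measurable in `(s, ω)` along the
indicators `f_{i,s}` (so that they can be integrated in `s`). -/
structure IsBrownianBridge {Ω' : Type*} [MeasurableSpace Ω'] (P' : Measure Ω')
    (C : Measure (Fin 2 → ℝ)) (T : ((Fin 2 → ℝ) → ℝ) → Ω' → ℝ) : Prop where
  gaussian : IsGaussianProcess (fun f : {f : (Fin 2 → ℝ) → ℝ // MemLp f 2 C} => T f) P'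
  centered : ∀ f, MemLp f 2 C → ∫ ω, T f ω ∂P' = 0
  covariance_eq : ∀ f g, MemLp f 2 C → MemLp g 2 C → ∫ ω, T f ω * T g ω ∂P' = Gam C f g
  measurable_path : ∀ i, AEMeasurable (fun a : ℝ × Ω' => T (fInd i a.1) a.2)
    (((volume : Measure ℝ).restrict (Ioo 0 1)).prod P')

/-- `β*(φ) = ∫_0^1 (T(f_{2,s}) φ_2(s) - T(f_{1,s}) φ_1(s)) ds`. -/
def betaStar {Ω' : Type*} (T : ((Fin 2 → ℝ) → ℝ) → Ω' → ℝ) (φ : Fin 2 → ℝ → ℝ) (ω : Ω') : ℝ :=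
  ∫ s in (0 : ℝ)..1, (T (fInd 1 s) ω * φ 1 s - T (fInd 0 s) ω * φ 0 s)

/-- `𝒢_{ΔGPI} = T(F*_J) + β*(ν)`. -/
def limGpi {Ω' : Type*} (S : PovertySpec) (c : Fin 2 → ℝ → ℝ → ℝ) (Z : Fin 2 → ℝ)
    (ρ : Measure (Fin 2 → ℝ)) (T : ((Fin 2 → ℝ) → ℝ) → Ω' → ℝ) (ω : Ω') : ℝ :=
  T (FstarJ S c Z ρ) ω + betaStar T (nu S c Z ρ) ω

/-- `𝒢_{ΔGI} = T(F*) + β*(L) - T(F̃*)`. -/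
def limGini {Ω' : Type*} (ρ : Measure (Fin 2 → ℝ)) (T : ((Fin 2 → ℝ) → ℝ) → Ω' → ℝ) (ω : Ω') :
    ℝ :=
  T (Fstar ρ) ω + betaStar T (L ρ) ω - T (Ftilde ρ) ω

end

end GiniPoverty

namespace GiniPoverty

/-! ### Negligible and bounded sequences in probability -/

/-- `X n` tends to `0` in probability; no measurability is required. -/
def NegligibleInProb {Ω : Type*} [MeasurableSpace Ω] (P : Measure Ω) (X : ℕ → Ω → ℝ) : Prop :=
  ∀ ε : ℝ, 0 < ε → Tendsto (fun n => P {ω | ε ≤ |X n ω|}) atTop (𝓝 0)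

/-- `X n` is bounded in probability; no measurability is required. -/
def BoundedInProb {Ω : Type*} [MeasurableSpace Ω] (P : Measure Ω) (X : ℕ → Ω → ℝ) : Prop :=
  ∀ ε : ENNReal, 0 < ε → ∃ M : ℝ, 0 < M ∧ ∀ᶠ n in atTop, P {ω | M ≤ |X n ω|} ≤ ε

section InProb

variable {Ω : Type*} [MeasurableSpace Ω] {P : Measure Ω} {X X' T : ℕ → Ω → ℝ}

theorem negligibleInProb_iff_tendstoInMeasure :
    NegligibleInProb P X ↔ TendstoInMeasure P X atTop (fun _ => 0) := by
  rw [tendstoInMeasure_iff_norm]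
  simp only [sub_zero, Real.norm_eq_abs, NegligibleInProb]

theorem NegligibleInProb.of_ae_le (h : NegligibleInProb P X')
    (hle : ∀ᶠ n in atTop, ∀ᵐ ω ∂P, |X n ω| ≤ |X' n ω|) : NegligibleInProb P X := by
  intro ε hε
  refine tendsto_of_tendsto_of_tendsto_of_le_of_le' tendsto_const_nhds (h ε hε)
    (Eventually.of_forall fun _ => zero_le) ?_
  filter_upwards [hle] with n hn
  exact measure_mono_ae (by filter_upwards [hn] with ω hω using fun h => le_trans h hω)

theorem NegligibleInProb.congr (h : NegligibleInProb P X')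
    (hle : ∀ᶠ n in atTop, ∀ᵐ ω ∂P, X n ω = X' n ω) : NegligibleInProb P X :=
  h.of_ae_le (hle.mono fun n hn => hn.mono fun ω hω => by rw [hω])

theorem NegligibleInProb.add (h : NegligibleInProb P X) (h' : NegligibleInProb P X') :
    NegligibleInProb P (fun n ω => X n ω + X' n ω) := by
  intro ε hε
  have := (h (ε / 2) (by positivity)).add (h' (ε / 2) (by positivity))
  rw [add_zero] at this
  refine tendsto_of_tendsto_of_tendsto_of_le_of_le tendsto_const_nhds this (fun _ => zero_le)
    fun n => ?_
  refine (measure_mono fun ω hω => ?_).trans (measure_union_le _ _)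
  simp only [mem_ofPred_eq, mem_union] at hω ⊢
  by_contra! hcon
  have := abs_add_le (X n ω) (X' n ω)
  linarith

theorem NegligibleInProb.const_mul (h : NegligibleInProb P X) (a : ℝ) :
    NegligibleInProb P (fun n ω => a * X n ω) := by
  intro ε hε
  refine tendsto_of_tendsto_of_tendsto_of_le_of_le tendsto_const_nhds
    (h (ε / (|a| + 1)) (by positivity)) (fun _ => zero_le) fun n => measure_mono fun ω hω => ?_
  simp only [mem_ofPred_eq, abs_mul] at hω ⊢
  rw [div_le_iff₀ (by positivity)]
  nlinarith [abs_nonneg a, abs_nonneg (X n ω)]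

theorem NegligibleInProb.neg (h : NegligibleInProb P X) :
    NegligibleInProb P (fun n ω => -X n ω) := by
  simpa using h.const_mul (-1)

theorem NegligibleInProb.sub (h : NegligibleInProb P X) (h' : NegligibleInProb P X') :
    NegligibleInProb P (fun n ω => X n ω - X' n ω) := by
  simpa [sub_eq_add_neg] using h.add h'.neg

theorem negligibleInProb_of_tendsto {a : ℕ → ℝ} (ha : Tendsto a atTop (𝓝 0)) :
    NegligibleInProb P (fun n _ => a n) := by
  intro ε hε
  refine tendsto_const_nhds.congr' ?_
  have := ha.abs
  rw [abs_zero] at this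
  filter_upwards [this.eventually (gt_mem_nhds hε)] with n hn
  simp [not_le.2 hn]

theorem negligibleInProb_of_lintegral (hX : ∀ n, AEMeasurable (X n) P)
    (h : Tendsto (fun n => ∫⁻ ω, ‖X n ω‖ₑ ∂P) atTop (𝓝 0)) : NegligibleInProb P X := by
  intro ε hε
  have h2 := ENNReal.Tendsto.mul_const (b := (ENNReal.ofReal ε)⁻¹) h
    (Or.inr (ENNReal.inv_ne_top.2 (by simpa using hε)))
  rw [zero_mul] at h2
  refine tendsto_of_tendsto_of_tendsto_of_le_of_le tendsto_const_nhds h2 (fun _ => zero_le)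
    fun n => ?_
  have h3 := mul_meas_ge_le_lintegral₀ (hX n).enorm (ENNReal.ofReal ε)
  have h4 : {ω | ENNReal.ofReal ε ≤ ‖X n ω‖ₑ} = {ω | ε ≤ |X n ω|} := by
    ext ω
    simp [Real.enorm_eq_ofReal_abs, ENNReal.ofReal_le_ofReal_iff]
  rw [h4] at h3
  rw [← div_eq_mul_inv, ENNReal.le_div_iff_mul_le (Or.inl (by simpa using hε)) (Or.inl (by simp)),
    mul_comm]
  exact h3

theorem boundedInProb_of_lintegral_le (hX : ∀ n, AEMeasurable (X n) P) {B : ENNReal} (hB : B ≠ ⊤)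
    (h : ∀ᶠ n in atTop, ∫⁻ ω, ‖X n ω‖ₑ ∂P ≤ B) : BoundedInProb P X := by
  intro ε hε
  by_cases hεt : ε = ⊤
  · exact ⟨1, one_pos, by simp [hεt]⟩
  have hne : B / ε ≠ ⊤ := ENNReal.div_ne_top hB hε.ne'
  refine ⟨(B / ε).toReal + 1, by positivity, h.mono fun n hn => ?_⟩
  have h3 := mul_meas_ge_le_lintegral₀ (hX n).enorm (ENNReal.ofReal ((B / ε).toReal + 1))
  have h4 : {ω | ENNReal.ofReal ((B / ε).toReal + 1) ≤ ‖X n ω‖ₑ}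
      = {ω | (B / ε).toReal + 1 ≤ |X n ω|} := by
    ext ω
    simp [Real.enorm_eq_ofReal_abs, ENNReal.ofReal_le_ofReal_iff]
  rw [h4] at h3
  have h5 : P {ω | (B / ε).toReal + 1 ≤ |X n ω|} ≤ B / ENNReal.ofReal ((B / ε).toReal + 1) := by
    rw [ENNReal.le_div_iff_mul_le (Or.inl (by simp; positivity)) (Or.inl (by simp)), mul_comm]
    exact h3.trans hn
  refine h5.trans ?_
  have h6 : B / ε ≤ ENNReal.ofReal ((B / ε).toReal + 1) := by
    conv_lhs => rw [← ENNReal.ofReal_toReal hne]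
    exact ENNReal.ofReal_le_ofReal (by linarith)
  rw [ENNReal.div_le_iff_le_mul (Or.inl hε.ne') (Or.inl hεt)] at h6
  rw [ENNReal.div_le_iff_le_mul (Or.inl (by simp; positivity)) (Or.inl (by simp)), mul_comm]
  exact h6

theorem NegligibleInProb.boundedInProb (h : NegligibleInProb P X) : BoundedInProb P X := by
  intro ε hε
  exact ⟨1, one_pos, (h 1 one_pos).eventually_le_const hε⟩

theorem BoundedInProb.add (h : BoundedInProb P X) (h' : BoundedInProb P X') :
    BoundedInProb P (fun n ω => X n ω + X' n ω) := by
  intro ε hε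
  obtain ⟨M, hM, h1⟩ := h (ε / 2) (ENNReal.half_pos hε.ne')
  obtain ⟨M', hM', h2⟩ := h' (ε / 2) (ENNReal.half_pos hε.ne')
  refine ⟨M + M', by positivity, ?_⟩
  filter_upwards [h1, h2] with n h1 h2
  rw [← ENNReal.add_halves ε]
  refine le_trans ?_ (add_le_add h1 h2)
  refine (measure_mono fun ω hω => ?_).trans (measure_union_le _ _)
  simp only [mem_ofPred_eq, mem_union] at hω ⊢
  by_contra! hcon
  have := abs_add_le (X n ω) (X' n ω)
  linarith

theorem BoundedInProb.congr (h : BoundedInProb P X')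
    (hle : ∀ᶠ n in atTop, ∀ᵐ ω ∂P, X n ω = X' n ω) : BoundedInProb P X := by
  intro ε hε
  obtain ⟨M, hM, h1⟩ := h ε hε
  refine ⟨M, hM, ?_⟩
  filter_upwards [h1, hle] with n h1 hn
  refine le_trans (measure_mono_ae ?_) h1
  filter_upwards [hn] with ω hω
  intro h
  change M ≤ |X' n ω|
  rw [← hω]
  exact h

theorem boundedInProb_const (a : ℝ) : BoundedInProb P (fun _ _ => a) := by
  intro ε hε
  refine ⟨|a| + 1, by positivity, Eventually.of_forall fun n => ?_⟩
  have : {ω : Ω | |a| + 1 ≤ |a|} = ∅ := by ext; simp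
  rw [this]
  simp

theorem BoundedInProb.mul (h : BoundedInProb P X) (h' : BoundedInProb P X') :
    BoundedInProb P (fun n ω => X n ω * X' n ω) := by
  intro ε hε
  obtain ⟨M, hM, h1⟩ := h (ε / 2) (ENNReal.half_pos hε.ne')
  obtain ⟨M', hM', h2⟩ := h' (ε / 2) (ENNReal.half_pos hε.ne')
  refine ⟨M * M', by positivity, ?_⟩
  filter_upwards [h1, h2] with n h1 h2
  rw [← ENNReal.add_halves ε]
  refine le_trans ?_ (add_le_add h1 h2)
  refine (measure_mono fun ω hω => ?_).trans (measure_union_le _ _)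
  simp only [mem_ofPred_eq, mem_union] at hω ⊢
  by_contra! hcon
  rw [abs_mul] at hω
  have := mul_lt_mul'' hcon.1 hcon.2 (abs_nonneg _) (abs_nonneg _)
  linarith

/-- If `|X n| ≤ δ |T n|` with probability tending to `1`, for every `δ > 0`, where `T` is bounded
in probability, then `X` is negligible. -/
theorem negligibleInProb_of_forall_le_mul (hT : BoundedInProb P T)
    (h : ∀ δ : ℝ, 0 < δ → Tendsto (fun n => P {ω | ¬ |X n ω| ≤ δ * |T n ω|}) atTop (𝓝 0)) :
    NegligibleInProb P X := by
  intro ε hε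
  rw [ENNReal.tendsto_nhds_zero]
  intro η hη
  obtain ⟨M, hM, h1⟩ := hT (η / 2) (ENNReal.half_pos hη.ne')
  have h2 := (h (ε / M) (by positivity)).eventually_le_const (ENNReal.half_pos hη.ne')
  filter_upwards [h1, h2] with n h1 h2
  rw [← ENNReal.add_halves η]
  refine le_trans ?_ (add_le_add h1 h2)
  refine (measure_mono fun ω hω => ?_).trans (measure_union_le _ _)
  simp only [mem_ofPred_eq, mem_union] at hω ⊢
  by_contra! hcon
  have h3 : ε / M * |T n ω| < ε / M * M := mul_lt_mul_of_pos_left hcon.1 (by positivity)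
  rw [div_mul_cancel₀ _ hM.ne'] at h3
  linarith [hcon.2]

theorem BoundedInProb.mul_negligible (hT : BoundedInProb P T) (h : NegligibleInProb P X) :
    NegligibleInProb P (fun n ω => T n ω * X n ω) := by
  refine negligibleInProb_of_forall_le_mul hT fun δ hδ => ?_
  refine tendsto_of_tendsto_of_tendsto_of_le_of_le tendsto_const_nhds (h δ hδ)
    (fun _ => zero_le) fun n => measure_mono fun ω hω => ?_
  simp only [mem_ofPred_eq, abs_mul] at hω ⊢
  by_contra! hcon
  exact hω (by rw [mul_comm]; exact mul_le_mul_of_nonneg_right hcon.le (abs_nonneg _))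

/-- If `X n → a ≠ 0` in probability then `(X n)⁻¹ → a⁻¹` in probability. -/
theorem NegligibleInProb.inv_sub_const_inv {a : ℝ} (ha : a ≠ 0)
    (h : NegligibleInProb P (fun n ω => X n ω - a)) :
    NegligibleInProb P (fun n ω => (X n ω)⁻¹ - a⁻¹) := by
  refine negligibleInProb_of_forall_le_mul (boundedInProb_const (2 / a ^ 2)) fun δ hδ => ?_
  refine tendsto_of_tendsto_of_tendsto_of_le_of_le tendsto_const_nhds
    (h (min δ (|a| / 2)) (by positivity)) (fun _ => zero_le) fun n => measure_mono fun ω hω => ?_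
  simp only [mem_ofPred_eq] at hω ⊢
  by_contra! hcon
  rw [lt_min_iff] at hcon
  apply hω
  have h1 : |a| / 2 ≤ |X n ω| := by
    have := abs_sub_abs_le_abs_sub a (X n ω)
    rw [abs_sub_comm] at this
    linarith [hcon.2]
  have ha' : 0 < |a| := abs_pos.2 ha
  have hX : X n ω ≠ 0 := by
    rw [← abs_pos]; linarith
  rw [_root_.inv_sub_inv hX ha, abs_div, abs_mul, div_le_iff₀ (by positivity), abs_of_nonneg (by positivity : (0:ℝ) ≤ 2 / a ^ 2),
    abs_sub_comm]
  refine hcon.1.le.trans ?_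
  have h2 : δ * (2 / a ^ 2) * (|a| / 2 * |a|) = δ := by
    rw [show |a| / 2 * |a| = a ^ 2 / 2 by rw [← sq_abs a]; ring]
    field_simp
  calc δ = δ * (2 / a ^ 2) * (|a| / 2 * |a|) := h2.symm
    _ ≤ _ := by gcongr

theorem BoundedInProb.of_sub_negligible {a : ℝ} (h : NegligibleInProb P (fun n ω => X n ω - a)) :
    BoundedInProb P X :=
  (h.boundedInProb.add (boundedInProb_const a)).congr
    (Eventually.of_forall fun n => Eventually.of_forall fun ω => by ring)

end InProb

/-! ### Sums of independent identically distributed variables -/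

section IID

variable {Ω E : Type*} [MeasurableSpace Ω] [MeasurableSpace E] {P : Measure Ω}
  {ρ : Measure E} {Y : ℕ → Ω → E}

theorem aemeasurable_sum_comp (hlaw : ∀ n, HasLaw (Y n) ρ P) {f : E → ℝ}
    (hf : AEMeasurable f ρ) (a b : ℝ) (n : ℕ) :
    AEMeasurable (fun ω => a * ∑ k ∈ Finset.range n, (f (Y k ω) - b)) P := by
  refine AEMeasurable.const_mul (Finset.aemeasurable_fun_sum _ fun k _ => ?_) _
  exact (AEMeasurable.comp_aemeasurable ((hlaw k).map_eq ▸ hf) (hlaw k).aemeasurable).sub_const _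

variable [IsProbabilityMeasure P]

theorem memLp_sum_sub (hlaw : ∀ n, HasLaw (Y n) ρ P) {f : E → ℝ} (hf : MemLp f 2 ρ)
    (s : Finset ℕ) : MemLp (fun ω => ∑ k ∈ s, (f (Y k ω) - ∫ x, f x ∂ρ)) 2 P :=
  memLp_finsetSum _ fun k _ =>
    (((hlaw k).map_eq ▸ hf).comp_of_map (hlaw k).aemeasurable).sub (memLp_const _)

theorem integral_sq_sum_sub (hlaw : ∀ n, HasLaw (Y n) ρ P) (hindep : iIndepFun Y P)
    {f : E → ℝ} (hf : MemLp f 2 ρ) (s : Finset ℕ) :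
    ∫ ω, (∑ k ∈ s, (f (Y k ω) - ∫ x, f x ∂ρ)) ^ 2 ∂P = s.card * Var[f; ρ] := by
  have : IsProbabilityMeasure ρ := (hlaw 0).isProbabilityMeasure_iff.1 inferInstance
  set X : ℕ → Ω → ℝ := fun k ω => f (Y k ω) - ∫ x, f x ∂ρ with hX
  have hmem : ∀ k, MemLp (fun ω => f (Y k ω)) 2 P := fun k =>
    ((hlaw k).map_eq ▸ hf).comp_of_map (hlaw k).aemeasurable
  have hXmem : ∀ k, MemLp (X k) 2 P := fun k => (hmem k).sub (memLp_const _)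
  have hXm : ∀ k, ∫ ω, X k ω ∂P = 0 := fun k => by
    rw [hX, integral_sub ((hmem k).integrable (by norm_num)) (integrable_const _)]
    have := (hlaw k).integral_comp (f := f) hf.aestronglyMeasurable
    simp only [Function.comp_def] at this
    simp [this]
  have hXv : ∀ k, Var[X k; P] = Var[f; ρ] := fun k => by
    rw [hX, variance_sub_const (hmem k).aestronglyMeasurable]
    rw [show (fun ω => f (Y k ω)) = f ∘ Y k from rfl, ← (hlaw k).map_eq, variance_map]
    · exact (hlaw k).map_eq ▸ hf.aestronglyMeasurable.aemeasurable
    · exact (hlaw k).aemeasurable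
  have hXind : iIndepFun X P :=
    hindep.comp₀ (fun _ x => f x - ∫ x, f x ∂ρ) (fun k => (hlaw k).aemeasurable)
      (fun k => by
        rw [(hlaw k).map_eq]
        exact hf.aestronglyMeasurable.aemeasurable.sub_const _)
  set W : Ω → ℝ := fun ω => ∑ k ∈ s, X k ω with hW
  have hWmem : MemLp W 2 P := memLp_finsetSum _ fun k _ => hXmem k
  have hW0 : ∫ ω, W ω ∂P = 0 := by
    rw [hW, integral_finsetSum _ fun k _ => (hXmem k).integrable (by norm_num)]
    simp [hXm]
  change ∫ ω, W ω ^ 2 ∂P = _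
  rw [← variance_of_integral_eq_zero hWmem.aestronglyMeasurable.aemeasurable hW0]
  rw [show W = ∑ k ∈ s, X k by ext; simp [hW]]
  rw [IndepFun.variance_sum (fun k _ => hXmem k) fun i _ j _ hij => hXind.indepFun hij]
  simp [hXv]

theorem lintegral_enorm_sum_sub_le (hlaw : ∀ n, HasLaw (Y n) ρ P) (hindep : iIndepFun Y P)
    {f : E → ℝ} (hf : MemLp f 2 ρ) (s : Finset ℕ) :
    ∫⁻ ω, ‖∑ k ∈ s, (f (Y k ω) - ∫ x, f x ∂ρ)‖ₑ ∂P
      ≤ ENNReal.ofReal √(s.card * Var[f; ρ]) := by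
  set W : Ω → ℝ := fun ω => ∑ k ∈ s, (f (Y k ω) - ∫ x, f x ∂ρ) with hW
  have hWmem : MemLp W 2 P := memLp_sum_sub hlaw hf s
  calc ∫⁻ ω, ‖W ω‖ₑ ∂P = eLpNorm W 1 P := eLpNorm_one_eq_lintegral_enorm.symm
    _ ≤ eLpNorm W 2 P := eLpNorm_le_eLpNorm_of_exponent_le (by norm_num)
        hWmem.aestronglyMeasurable
    _ = ENNReal.ofReal √(s.card * Var[f; ρ]) := by
        rw [hWmem.eLpNorm_eq_integral_rpow_norm (by norm_num) (by norm_num),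
          ← integral_sq_sum_sub hlaw hindep hf s]
        simp [Real.sqrt_eq_rpow, hW]

theorem lintegral_enorm_normalized_sum_le (hlaw : ∀ n, HasLaw (Y n) ρ P) (hindep : iIndepFun Y P)
    {f : E → ℝ} (hf : MemLp f 2 ρ) (n : ℕ) :
    ∫⁻ ω, ‖(√(n : ℝ))⁻¹ * ∑ k ∈ Finset.range n, (f (Y k ω) - ∫ x, f x ∂ρ)‖ₑ ∂P
      ≤ ENNReal.ofReal √(Var[f; ρ]) := by
  simp only [enorm_mul]
  rw [lintegral_const_mul' _ _ (by simp)]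
  rcases Nat.eq_zero_or_pos n with rfl | hn
  · simp
  have hn' : (0 : ℝ) < √(n : ℝ) := Real.sqrt_pos.2 (by exact_mod_cast hn)
  refine (mul_le_mul_right (lintegral_enorm_sum_sub_le hlaw hindep hf _) _).trans ?_
  rw [Real.enorm_of_nonneg (by positivity), ← ENNReal.ofReal_mul (by positivity)]
  rw [Finset.card_range, Real.sqrt_mul (by positivity), inv_mul_cancel_left₀ hn'.ne']

theorem boundedInProb_normalized_sum (hlaw : ∀ n, HasLaw (Y n) ρ P) (hindep : iIndepFun Y P)
    {f : E → ℝ} (hf : MemLp f 2 ρ) :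
    BoundedInProb P
      (fun n ω => (√(n : ℝ))⁻¹ * ∑ k ∈ Finset.range n, (f (Y k ω) - ∫ x, f x ∂ρ)) :=
  boundedInProb_of_lintegral_le
    (fun n => aemeasurable_sum_comp hlaw hf.aestronglyMeasurable.aemeasurable _ _ n)
    ENNReal.ofReal_ne_top
    (Eventually.of_forall fun n => lintegral_enorm_normalized_sum_le hlaw hindep hf n)

theorem negligibleInProb_mean_sub (hlaw : ∀ n, HasLaw (Y n) ρ P) (hindep : iIndepFun Y P)
    {f : E → ℝ} (hf : Integrable f ρ) :
    NegligibleInProb P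
      (fun n ω => (1 / (n : ℝ)) * ∑ k ∈ Finset.range n, f (Y k ω) - ∫ x, f x ∂ρ) := by
  have hfm : ∀ k, AEMeasurable f (P.map (Y k)) := fun k =>
    (hlaw k).map_eq ▸ hf.aestronglyMeasurable.aemeasurable
  have hint : Integrable (f ∘ Y 0) P :=
    ((hlaw 0).map_eq ▸ hf).comp_aemeasurable (hlaw 0).aemeasurable
  have hind : iIndepFun (fun k => f ∘ Y k) P :=
    hindep.comp₀ (fun _ => f) (fun k => (hlaw k).aemeasurable) hfm
  have hid : ∀ k, IdentDistrib (f ∘ Y k) (f ∘ Y 0) P P := fun k =>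
    IdentDistrib.comp_of_aemeasurable (u := f)
      ⟨(hlaw k).aemeasurable, (hlaw 0).aemeasurable, by rw [(hlaw k).map_eq, (hlaw 0).map_eq]⟩
      (hfm k)
  have hlln := strong_law_ae_real (fun k => f ∘ Y k) hint (fun i j hij => hind.indepFun hij) hid
  have hmean : ∫ ω, (f ∘ Y 0) ω ∂P = ∫ x, f x ∂ρ :=
    (hlaw 0).integral_comp hf.aestronglyMeasurable
  have hmeas : ∀ n : ℕ, AEMeasurable
      (fun ω => (1 / (n : ℝ)) * ∑ k ∈ Finset.range n, f (Y k ω)) P := fun n => by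
    simpa using aemeasurable_sum_comp hlaw hf.aestronglyMeasurable.aemeasurable (1 / (n : ℝ)) 0 n
  rw [negligibleInProb_iff_tendstoInMeasure]
  refine tendstoInMeasure_of_tendsto_ae (fun n => ((hmeas n).sub_const _).aestronglyMeasurable) ?_
  filter_upwards [hlln] with ω hω
  rw [hmean] at hω
  have := hω.sub_const (∫ x, f x ∂ρ)
  rw [sub_self] at this
  refine this.congr fun n => ?_
  simp only [Function.comp_apply]
  ring

end IID

end GiniPoverty

namespace GiniPoverty

noncomputable section

/-! ### Empirical distribution functions -/

/-- Empirical distribution function of `x 0, …, x (n - 1)`. -/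
def empCdf (x : ℕ → ℝ) (n : ℕ) (t : ℝ) : ℝ :=
  (1 / (n : ℝ)) * ∑ k ∈ Finset.range n, (if x k ≤ t then (1 : ℝ) else 0)

/-- Projection `y ↦ ∫ h(x) (1_{y ≤ x} - F(x)) dF(x)` of the kernel `h(x) (1_{y ≤ x} - F(x))`. -/
def projKernel (m : Measure ℝ) (h : ℝ → ℝ) (y : ℝ) : ℝ :=
  ∫ x, h x * ((if y ≤ x then (1 : ℝ) else 0) - cdf m x) ∂m

/-- Error made when the weighted empirical process is replaced by its projection. -/
def projError (m : Measure ℝ) (h : ℝ → ℝ) (x : ℕ → ℝ) (n : ℕ) : ℝ :=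
  √(n : ℝ) * ((1 / (n : ℝ)) * ∑ j ∈ Finset.range n, h (x j) * (empCdf x n (x j) - cdf m (x j)))
    - (√(n : ℝ))⁻¹ * ∑ j ∈ Finset.range n, projKernel m h (x j)

theorem nullSingletonClass_of_continuous_cdf {m : Measure ℝ} [IsProbabilityMeasure m]
    (hF : Continuous (cdf m)) : NullSingletonClass m := by
  refine ⟨fun x => ?_⟩
  rw [← measure_cdf m, StieltjesFunction.measure_singleton]
  rw [← ENNReal.ofReal_zero]
  congr 1
  rw [(hF.continuousAt.continuousWithinAt).leftLim_eq, sub_self]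

theorem measurable_cdf (m : Measure ℝ) : Measurable (cdf m) := (monotone_cdf m).measurable

theorem abs_indicator_sub_cdf_le (m : Measure ℝ) (x y : ℝ) :
    |(if y ≤ x then (1 : ℝ) else 0) - cdf m x| ≤ 1 := by
  have h0 := cdf_nonneg m x
  have h1 := cdf_le_one m x
  split_ifs <;> rw [abs_le] <;> constructor <;> linarith

theorem measurable_le_indicator : Measurable
    (fun a : ℝ × ℝ => if a.1 ≤ a.2 then (1 : ℝ) else 0) :=
  Measurable.ite (measurableSet_le measurable_fst measurable_snd) measurable_const measurable_const

theorem integral_indicator_le (m : Measure ℝ) [IsProbabilityMeasure m] (x : ℝ) :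
    ∫ y, (if y ≤ x then (1 : ℝ) else 0) ∂m = cdf m x := by
  rw [cdf_eq_real, ← integral_indicator_one measurableSet_Iic]
  rfl

section Kernel

variable {m : Measure ℝ} {h h' : ℝ → ℝ}

theorem integrable_kernel (hi : Integrable h m) (y : ℝ) :
    Integrable (fun x => h x * ((if y ≤ x then (1 : ℝ) else 0) - cdf m x)) m := by
  refine hi.mul_bdd (c := 1) ?_ ?_
  · exact ((measurable_le_indicator.comp (measurable_const.prodMk measurable_id)).sub
      (measurable_cdf m)).aestronglyMeasurable
  · exact Eventually.of_forall fun x => abs_indicator_sub_cdf_le m x y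

theorem projKernel_const_mul (a y : ℝ) :
    projKernel m (fun x => a * h x) y = a * projKernel m h y := by
  unfold projKernel
  rw [← integral_const_mul]
  simp only [mul_assoc]

theorem projError_const_mul (a : ℝ) (x : ℕ → ℝ) (n : ℕ) :
    projError m (fun x => a * h x) x n = a * projError m h x n := by
  unfold projError
  simp only [projKernel_const_mul, mul_assoc, ← Finset.mul_sum]
  ring

theorem abs_projKernel_le (hi : Integrable h m) (y : ℝ) :
    |projKernel m h y| ≤ ∫ x, |h x| ∂m := by
  refine (abs_integral_le_integral_abs).trans ?_
  refine integral_mono (integrable_kernel hi y).abs hi.abs fun x => ?_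
  change |_| ≤ |_|
  rw [abs_mul]
  exact mul_le_of_le_one_right (abs_nonneg _) (abs_indicator_sub_cdf_le m x y)

theorem projKernel_sub (hi : Integrable h m) (hi' : Integrable h' m) (y : ℝ) :
    projKernel m (fun x => h x - h' x) y = projKernel m h y - projKernel m h' y := by
  unfold projKernel
  rw [← integral_sub (integrable_kernel hi y) (integrable_kernel hi' y)]
  simp only [sub_mul]

theorem projError_sub (hi : Integrable h m) (hi' : Integrable h' m) (x : ℕ → ℝ) (n : ℕ) :
    projError m (fun x => h x - h' x) x n = projError m h x n - projError m h' x n := by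
  unfold projError
  simp only [projKernel_sub hi hi', sub_mul, Finset.sum_sub_distrib]
  ring

variable [IsProbabilityMeasure m]

theorem measurable_projKernel (hm : Measurable h) : Measurable (projKernel m h) := by
  have : StronglyMeasurable (fun a : ℝ × ℝ =>
      h a.2 * ((if a.1 ≤ a.2 then (1 : ℝ) else 0) - cdf m a.2)) :=
    ((hm.comp measurable_snd).mul (measurable_le_indicator.sub
      ((measurable_cdf m).comp measurable_snd))).stronglyMeasurable
  exact this.integral_prod_right.measurable

theorem integral_projKernel (hi : Integrable h m) :
    ∫ y, projKernel m h y ∂m = 0 := by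
  have hint : Integrable (fun a : ℝ × ℝ =>
      h a.2 * ((if a.1 ≤ a.2 then (1 : ℝ) else 0) - cdf m a.2)) (m.prod m) := by
    refine (hi.comp_snd m).mul_bdd (c := 1) ?_ ?_
    · exact (measurable_le_indicator.sub
        ((measurable_cdf m).comp measurable_snd)).aestronglyMeasurable
    · exact Eventually.of_forall fun a => abs_indicator_sub_cdf_le m a.2 a.1
  unfold projKernel
  rw [integral_integral_swap hint]
  have : ∀ x, ∫ y, h x * ((if y ≤ x then (1 : ℝ) else 0) - cdf m x) ∂m = 0 := fun x => by
    rw [integral_const_mul, integral_sub _ (integrable_const _), integral_indicator_le]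
    · simp
    · refine Integrable.of_bound (C := 1) ?_ (Eventually.of_forall fun y => ?_)
      · exact (measurable_le_indicator.comp
          (measurable_id.prodMk measurable_const)).aestronglyMeasurable
      · split_ifs <;> simp
  simp [this]

theorem memLp_projKernel (hm : Measurable h) (hi : Integrable h m) :
    MemLp (projKernel m h) 2 m :=
  MemLp.of_bound (measurable_projKernel hm).aestronglyMeasurable _
    (Eventually.of_forall fun y => abs_projKernel_le hi y)

theorem variance_projKernel_le (hm : Measurable h) (hi : Integrable h m) :
    Var[projKernel m h; m] ≤ (∫ x, |h x| ∂m) ^ 2 := by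
  have := variance_le_sq_of_bounded (μ := m) (X := projKernel m h) (a := -∫ x, |h x| ∂m)
    (b := ∫ x, |h x| ∂m)
    (Eventually.of_forall fun y => abs_le.1 (abs_projKernel_le hi y))
    (measurable_projKernel hm).aemeasurable
  refine this.trans (le_of_eq ?_)
  ring

theorem projKernel_indicator_Iic (a y : ℝ) [NullSingletonClass m] :
    projKernel m ((Iic a).indicator 1) y
      = (Iic a).indicator (fun y => cdf m a - cdf m y) y - ∫ x in Iic a, cdf m x ∂m := by
  have h1 : ∀ x, (Iic a).indicator (1 : ℝ → ℝ) x * ((if y ≤ x then (1 : ℝ) else 0) - cdf m x)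
      = (Icc y a).indicator 1 x - (Iic a).indicator (fun x => cdf m x) x := fun x => by
    simp only [indicator, mem_Iic, mem_Icc, Pi.one_apply]
    split_ifs <;> simp_all
  have h3 : IntegrableOn (cdf m) (Iic a) m :=
    (Integrable.of_bound (C := 1) (measurable_cdf m).aestronglyMeasurable
      (Eventually.of_forall fun x => by
        rw [Real.norm_of_nonneg (cdf_nonneg m x)]; exact cdf_le_one m x)).integrableOn
  unfold projKernel
  simp only [h1]
  rw [integral_sub, integral_indicator measurableSet_Iic, integral_indicator_one measurableSet_Icc]
  · congr 1
    simp only [indicator, mem_Iic]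
    split_ifs with hya
    · rw [measureReal_congr Ioc_ae_eq_Icc.symm, cdf_eq_real, cdf_eq_real,
        show Ioc y a = Iic a \ Iic y by ext; simp [and_comm], measureReal_sdiff (Iic_subset_Iic.2 hya) measurableSet_Iic]
    · rw [Icc_eq_empty hya]; simp
  · exact (integrable_const (1 : ℝ)).indicator measurableSet_Icc
  · exact h3.integrable_indicator measurableSet_Iic

theorem setIntegral_cdf_Iic [NullSingletonClass m] (a : ℝ) :
    ∫ x in Iic a, cdf m x ∂m = cdf m a ^ 2 / 2 := by
  have h3 : IntegrableOn (cdf m) (Iic a) m :=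
    (Integrable.of_bound (C := 1) (measurable_cdf m).aestronglyMeasurable
      (Eventually.of_forall fun x => by
        rw [Real.norm_of_nonneg (cdf_nonneg m x)]; exact cdf_le_one m x)).integrableOn
  have h0 := integral_projKernel (m := m) (h := (Iic a).indicator 1)
    ((integrable_const (1 : ℝ)).indicator measurableSet_Iic)
  simp only [projKernel_indicator_Iic] at h0
  rw [integral_sub, integral_indicator measurableSet_Iic, integral_sub (by simp) h3] at h0
  · simp only [integral_const, MeasurableSet.univ, measureReal_restrict_apply, univ_inter,
      smul_eq_mul, probReal_univ, one_mul] at h0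
    rw [← cdf_eq_real] at h0
    linarith
  · exact IntegrableOn.integrable_indicator
      (Integrable.sub (integrable_const _) h3) measurableSet_Iic
  · exact integrable_const _

end Kernel

section Empirical

variable {Ω : Type*} [MeasurableSpace Ω] {P : Measure Ω} [IsProbabilityMeasure P]
  {m : Measure ℝ} [IsProbabilityMeasure m] {X : ℕ → Ω → ℝ} {h h' : ℝ → ℝ}

theorem ae_ne_of_indep [NullSingletonClass m] (hX : ∀ n, HasLaw (X n) m P) (hind : iIndepFun X P) :
    ∀ᵐ ω ∂P, ∀ j k, X j ω = X k ω → j = k := by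
  rw [ae_all_iff]; intro j
  rw [ae_all_iff]; intro k
  by_cases hjk : j = k
  · simp [hjk]
  have hlaw := (hind.indepFun hjk).hasLaw_prod (hX j) (hX k)
  have hdiag : MeasurableSet {a : ℝ × ℝ | a.1 = a.2} :=
    measurableSet_eq_fun measurable_fst measurable_snd
  have h0 : (m.prod m) {a : ℝ × ℝ | a.1 = a.2} = 0 := by
    rw [Measure.measure_prod_null hdiag]
    refine Eventually.of_forall fun x => ?_
    have : Prod.mk x ⁻¹' {a : ℝ × ℝ | a.1 = a.2} = {x} := by ext; simp [eq_comm]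
    simp only [this, measure_singleton, Pi.zero_apply]
  have h1 : ∀ᵐ a ∂(m.prod m), ¬ a.1 = a.2 := by rw [ae_iff]; simpa using h0
  have h2 := (hlaw.ae_iff (p := fun a => ¬ a.1 = a.2) (measurableSet_setOfPred.1 hdiag.compl)).2 h1
  filter_upwards [h2] with ω hω h
  exact absurd h hω

theorem variance_indicator_le (x : ℝ) :
    Var[fun y => if y ≤ x then (1 : ℝ) else 0; m] ≤ 1 := by
  have := variance_le_sq_of_bounded (μ := m) (X := fun y => if y ≤ x then (1 : ℝ) else 0) (a := 0)
    (b := 1) (Eventually.of_forall fun y => by split_ifs <;> simp)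
    (measurable_le_indicator.comp (measurable_id.prodMk measurable_const)).aemeasurable
  linarith

theorem memLp_indicator_le (x : ℝ) :
    MemLp (fun y => if y ≤ x then (1 : ℝ) else 0) 2 m :=
  MemLp.of_bound (measurable_le_indicator.comp
    (measurable_id.prodMk measurable_const)).aestronglyMeasurable 1
    (Eventually.of_forall fun y => by split_ifs <;> simp)

/-- The centered count of the values below an independent level, weighted by a function of that
level. -/
theorem lintegral_weighted_count_le (hX : ∀ n, HasLaw (X n) m P) (hind : iIndepFun X P)
    (hm : Measurable h) (j : ℕ) (s : Finset ℕ) (hj : j ∉ s) :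
    ∫⁻ ω, ‖h (X j ω) * ∑ k ∈ s, ((if X k ω ≤ X j ω then (1 : ℝ) else 0) - cdf m (X j ω))‖ₑ ∂P
      ≤ (∫⁻ x, ‖h x‖ₑ ∂m) * ENNReal.ofReal √(s.card) := by
  set T : Ω → (s → ℝ) := fun ω i => X i ω with hT
  have hTm : AEMeasurable T P := by
    rw [aemeasurable_pi_iff]
    exact fun i => (hX i).aemeasurable
  have hTlaw : HasLaw T (P.map T) P := ⟨hTm, rfl⟩
  have hXT : IndepFun (X j) T P := by
    have := hind.indepFun_finset₀ {j} s (by simpa using hj) (fun i => (hX i).aemeasurable)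
    exact this.comp (φ := fun a : (({j} : Finset ℕ) → ℝ) => a ⟨j, by simp⟩) (ψ := id)
      (measurable_pi_apply _) measurable_id
  have hlaw := hXT.hasLaw_prod (hX j) hTlaw
  set Φ : ℝ × (s → ℝ) → ENNReal := fun a =>
    ‖h a.1 * ∑ k : s, ((if a.2 k ≤ a.1 then (1 : ℝ) else 0) - cdf m a.1)‖ₑ with hΦ
  have hΦm : Measurable Φ := by
    refine Measurable.enorm (Measurable.mul (hm.comp measurable_fst) ?_)
    refine Finset.measurable_sum _ fun k _ => Measurable.sub ?_
      ((measurable_cdf m).comp measurable_fst)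
    exact Measurable.ite (measurableSet_le (by fun_prop) measurable_fst) measurable_const
      measurable_const
  have h1 : ∫⁻ ω, ‖h (X j ω) * ∑ k ∈ s, ((if X k ω ≤ X j ω then (1 : ℝ) else 0)
      - cdf m (X j ω))‖ₑ ∂P = ∫⁻ a, Φ a ∂(m.prod (P.map T)) := by
    rw [← hlaw.lintegral_comp hΦm.aemeasurable]
    refine lintegral_congr fun ω => ?_
    simp only [hΦ, hT]
    rw [Finset.sum_coe_sort s
      (fun k => (if X k ω ≤ X j ω then (1 : ℝ) else 0) - cdf m (X j ω))]
  have : SFinite (P.map T) := inferInstance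
  rw [h1, lintegral_prod _ hΦm.aemeasurable, ← lintegral_mul_const _ hm.enorm]
  refine lintegral_mono fun x => ?_
  simp only [hΦ, enorm_mul]
  rw [lintegral_const_mul' _ _ (by simp)]
  refine mul_le_mul_right ?_ _
  have h2 : Measurable (fun a : s → ℝ =>
      ‖∑ k : s, ((if a k ≤ x then (1 : ℝ) else 0) - cdf m x)‖ₑ) := by
    refine Measurable.enorm (Finset.measurable_sum _ fun k _ => Measurable.sub ?_
      measurable_const)
    exact Measurable.ite (measurableSet_le (by fun_prop) measurable_const) measurable_const
      measurable_const
  rw [lintegral_map' h2.aemeasurable hTm]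
  have h3 := lintegral_enorm_sum_sub_le hX hind (memLp_indicator_le (m := m) x) s
  simp only [integral_indicator_le] at h3
  refine le_trans (le_of_eq ?_) (h3.trans (ENNReal.ofReal_le_ofReal (Real.sqrt_le_sqrt ?_)))
  · refine lintegral_congr fun ω => ?_
    rw [← Finset.sum_coe_sort s
      (fun k => (if X k ω ≤ x then (1 : ℝ) else 0) - cdf m x)]
  · exact mul_le_of_le_one_right (by positivity) (variance_indicator_le x)

theorem lintegral_weighted_empCdf_sub_le (hX : ∀ n, HasLaw (X n) m P) (hind : iIndepFun X P)
    (hm : Measurable h) {n : ℕ} {j : ℕ} (hj : j < n) :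
    ∫⁻ ω, ‖h (X j ω) * (√(n : ℝ) * (empCdf (fun k => X k ω) n (X j ω) - cdf m (X j ω)))‖ₑ ∂P
      ≤ 2 * ∫⁻ x, ‖h x‖ₑ ∂m := by
  have hn : (0 : ℝ) < n := by exact_mod_cast (Nat.zero_le j).trans_lt hj
  have hs : (0 : ℝ) < √(n : ℝ) := Real.sqrt_pos.2 hn
  have hs1 : (1 : ℝ) ≤ √(n : ℝ) := Real.one_le_sqrt.2 (by
    exact_mod_cast (Nat.zero_le j).trans_lt hj)
  set s := (Finset.range n).erase j with hs_def
  have hcard : s.card ≤ n := (Finset.card_erase_le).trans (by simp)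
  have hpt : ∀ ω, ‖h (X j ω) * (√(n : ℝ) * (empCdf (fun k => X k ω) n (X j ω)
      - cdf m (X j ω)))‖ₑ ≤ ENNReal.ofReal (√(n : ℝ))⁻¹ * (‖h (X j ω)‖ₑ
        + ‖h (X j ω) * ∑ k ∈ s, ((if X k ω ≤ X j ω then (1 : ℝ) else 0)
          - cdf m (X j ω))‖ₑ) := fun ω => by
    have hkey : √(n : ℝ) * (empCdf (fun k => X k ω) n (X j ω) - cdf m (X j ω))
        = (√(n : ℝ))⁻¹ * ((1 - cdf m (X j ω)) + ∑ k ∈ s,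
          ((if X k ω ≤ X j ω then (1 : ℝ) else 0) - cdf m (X j ω))) := by
      have h1 : ∑ k ∈ Finset.range n, ((if X k ω ≤ X j ω then (1 : ℝ) else 0) - cdf m (X j ω))
          = (1 - cdf m (X j ω)) + ∑ k ∈ s,
          ((if X k ω ≤ X j ω then (1 : ℝ) else 0) - cdf m (X j ω)) := by
        rw [← Finset.add_sum_erase _ _ (Finset.mem_range.2 hj)]
        simp [hs_def]
      rw [← h1, Finset.sum_sub_distrib]
      simp only [empCdf, Finset.sum_const, Finset.card_range, nsmul_eq_mul]
      have h2 : (n : ℝ) = √(n : ℝ) * √(n : ℝ) := (Real.mul_self_sqrt hn.le).symm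
      generalize √(n : ℝ) = r at hs h2 ⊢
      rw [h2]
      field_simp
    rw [hkey, ← Real.enorm_of_nonneg (by positivity : (0 : ℝ) ≤ (√(n : ℝ))⁻¹), mul_left_comm,
      enorm_mul, mul_add]
    refine mul_le_mul_right ((enorm_add_le _ _).trans (add_le_add_left ?_ _)) _
    rw [enorm_mul]
    refine mul_le_of_le_one_right zero_le ?_
    rw [Real.enorm_eq_ofReal_abs, ENNReal.ofReal_le_one, abs_le]
    constructor <;> linarith [cdf_nonneg m (X j ω), cdf_le_one m (X j ω)]
  refine (lintegral_mono hpt).trans ?_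
  have hhm : AEMeasurable (fun ω => ‖h (X j ω)‖ₑ) P :=
    (hm.comp_aemeasurable (hX j).aemeasurable).enorm
  rw [lintegral_const_mul' _ _ (by simp), lintegral_add_left' hhm]
  have h1 : ∫⁻ ω, ‖h (X j ω)‖ₑ ∂P = ∫⁻ x, ‖h x‖ₑ ∂m :=
    (hX j).lintegral_comp (f := fun x => ‖h x‖ₑ) hm.enorm.aemeasurable
  rw [h1]
  have h2 := lintegral_weighted_count_le hX hind hm j s (by simp [hs_def])
  calc _ ≤ ENNReal.ofReal (√(n : ℝ))⁻¹ * (∫⁻ x, ‖h x‖ₑ ∂m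
          + (∫⁻ x, ‖h x‖ₑ ∂m) * ENNReal.ofReal √(s.card)) := by gcongr
    _ ≤ ENNReal.ofReal (√(n : ℝ))⁻¹ * ((∫⁻ x, ‖h x‖ₑ ∂m) * ENNReal.ofReal √(n : ℝ)
          + (∫⁻ x, ‖h x‖ₑ ∂m) * ENNReal.ofReal √(n : ℝ)) := by
        gcongr
        exact le_mul_of_one_le_right zero_le (by simpa using hs1)
    _ = (ENNReal.ofReal (√(n : ℝ))⁻¹ * ENNReal.ofReal √(n : ℝ)) * (2 * ∫⁻ x, ‖h x‖ₑ ∂m) := by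
        ring
    _ = 2 * ∫⁻ x, ‖h x‖ₑ ∂m := by
        rw [← ENNReal.ofReal_mul (by positivity), inv_mul_cancel₀ hs.ne']
        simp

end Empirical

theorem empCdf_nonneg (x : ℕ → ℝ) (n : ℕ) (t : ℝ) : 0 ≤ empCdf x n t :=
  mul_nonneg (by positivity) (Finset.sum_nonneg fun k _ => by split_ifs <;> simp)

theorem empCdf_le_one (x : ℕ → ℝ) (n : ℕ) (t : ℝ) : empCdf x n t ≤ 1 := by
  have h : ∑ k ∈ Finset.range n, (if x k ≤ t then (1 : ℝ) else 0) ≤ n := by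
    calc _ ≤ ∑ k ∈ Finset.range n, (1 : ℝ) :=
          Finset.sum_le_sum fun k _ => by split_ifs <;> simp
      _ = n := by simp
  unfold empCdf
  rcases Nat.eq_zero_or_pos n with rfl | hn
  · simp
  · rw [one_div, inv_mul_le_iff₀ (by exact_mod_cast hn)]
    simpa using h

theorem monotone_empCdf (x : ℕ → ℝ) (n : ℕ) : Monotone (empCdf x n) := by
  intro s t hst
  unfold empCdf
  gcongr with k _
  split_ifs with h1 h2
  · exact le_rfl
  · exact absurd (h1.trans hst) h2
  · exact zero_le_one
  · exact le_rfl

/-- Sum of the ranks of the values below `a`, for distinct values. -/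
theorem sum_rank_le {x : ℕ → ℝ} (hx : Function.Injective x) (s : Finset ℕ) (a : ℝ) :
    ∑ j ∈ s, (if x j ≤ a then (1 : ℝ) else 0) * ∑ k ∈ s, (if x k ≤ x j then (1 : ℝ) else 0)
      = ((∑ j ∈ s, (if x j ≤ a then (1 : ℝ) else 0)) ^ 2
          + ∑ j ∈ s, (if x j ≤ a then (1 : ℝ) else 0)) / 2 := by
  have h1 : ∑ j ∈ s, (if x j ≤ a then (1 : ℝ) else 0) * ∑ k ∈ s, (if x k ≤ x j then (1 : ℝ) else 0)
      = ∑ j ∈ s, ∑ k ∈ s, (if x j ≤ a ∧ x k ≤ a ∧ x k ≤ x j then (1 : ℝ) else 0) := by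
    refine Finset.sum_congr rfl fun j _ => ?_
    rw [Finset.mul_sum]
    refine Finset.sum_congr rfl fun k _ => ?_
    split_ifs with h1 h2 h3 h4 h5 <;> simp_all
    linarith
  have h2 : ∑ j ∈ s, ∑ k ∈ s, (if x j ≤ a ∧ x k ≤ a ∧ x k ≤ x j then (1 : ℝ) else 0)
      = ∑ j ∈ s, ∑ k ∈ s, (if x j ≤ a ∧ x k ≤ a ∧ x j ≤ x k then (1 : ℝ) else 0) := by
    rw [Finset.sum_comm]
    refine Finset.sum_congr rfl fun j _ => Finset.sum_congr rfl fun k _ => ?_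
    congr 1
    simp only [eq_iff_iff]
    tauto
  have h3 : ∑ j ∈ s, ∑ k ∈ s, (if x j ≤ a ∧ x k ≤ a ∧ x k ≤ x j then (1 : ℝ) else 0)
      + ∑ j ∈ s, ∑ k ∈ s, (if x j ≤ a ∧ x k ≤ a ∧ x j ≤ x k then (1 : ℝ) else 0)
      = (∑ j ∈ s, (if x j ≤ a then (1 : ℝ) else 0)) ^ 2
          + ∑ j ∈ s, (if x j ≤ a then (1 : ℝ) else 0) := by
    rw [sq, Finset.sum_mul_sum, ← Finset.sum_add_distrib, ← Finset.sum_add_distrib]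
    refine Finset.sum_congr rfl fun j hj => ?_
    have : (if x j ≤ a then (1 : ℝ) else 0)
        = ∑ k ∈ s, if k = j then (if x j ≤ a then (1 : ℝ) else 0) else 0 := by
      rw [Finset.sum_ite_eq' s j]; simp [hj]
    refine Eq.trans ?_ (congrArg (fun z => _ + z) this.symm)
    rw [← Finset.sum_add_distrib, ← Finset.sum_add_distrib]
    refine Finset.sum_congr rfl fun k _ => ?_
    by_cases hkj : k = j
    · subst hkj
      by_cases hk : x k ≤ a <;> simp [hk]
    · have hne : x k ≠ x j := fun h => hkj (hx h)
      rcases lt_or_gt_of_ne hne with h | h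
      · by_cases hj : x j ≤ a <;> by_cases hk : x k ≤ a <;> simp [hj, hk, hkj, h.le, not_le.2 h]
      · by_cases hj : x j ≤ a <;> by_cases hk : x k ≤ a <;> simp [hj, hk, hkj, h.le, not_le.2 h]
  rw [h1]
  linarith [h2, h3]

theorem projError_indicator_Iic {m : Measure ℝ} [IsProbabilityMeasure m] [NullSingletonClass m]
    {x : ℕ → ℝ} (hx : Function.Injective x) (a : ℝ) {n : ℕ} (hn : 0 < n) :
    projError m ((Iic a).indicator 1) x n
      = √(n : ℝ) * (((empCdf x n a - cdf m a) ^ 2 + empCdf x n a / n) / 2) := by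
  have hn' : (n : ℝ) ≠ 0 := by exact_mod_cast hn.ne'
  have hs : √(n : ℝ) ≠ 0 := Real.sqrt_ne_zero'.2 (by exact_mod_cast hn)
  unfold projError
  simp only [projKernel_indicator_Iic, setIntegral_cdf_Iic]
  have hind : ∀ y, (Iic a).indicator (1 : ℝ → ℝ) y = if y ≤ a then (1 : ℝ) else 0 := fun y => by
    simp [indicator]
  have hind2 : ∀ y, (Iic a).indicator (fun y => cdf m a - cdf m y) y
      = (if y ≤ a then (1 : ℝ) else 0) * cdf m a - (if y ≤ a then (1 : ℝ) else 0) * cdf m y :=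
    fun y => by simp only [indicator, mem_Iic]; split_ifs <;> simp
  simp only [hind, hind2]
  have h1 := sum_rank_le hx (Finset.range n) a
  have h2 : ∑ j ∈ Finset.range n, (if x j ≤ a then (1 : ℝ) else 0)
        * (empCdf x n (x j) - cdf m (x j))
      = (1 / (n : ℝ)) * (((∑ j ∈ Finset.range n, (if x j ≤ a then (1 : ℝ) else 0)) ^ 2
          + ∑ j ∈ Finset.range n, (if x j ≤ a then (1 : ℝ) else 0)) / 2)
        - ∑ j ∈ Finset.range n, (if x j ≤ a then (1 : ℝ) else 0) * cdf m (x j) := by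
    rw [← h1, Finset.mul_sum, ← Finset.sum_sub_distrib]
    refine Finset.sum_congr rfl fun j _ => ?_
    unfold empCdf
    ring
  rw [h2]
  simp only [Finset.sum_sub_distrib, ← Finset.sum_mul, Finset.sum_const, Finset.card_range,
    nsmul_eq_mul]
  unfold empCdf
  generalize ∑ j ∈ Finset.range n, (if x j ≤ a then (1 : ℝ) else 0) = N
  generalize ∑ j ∈ Finset.range n, (if x j ≤ a then (1 : ℝ) else 0) * cdf m (x j) = G
  have h3 : (n : ℝ) = √(n : ℝ) * √(n : ℝ) := (Real.mul_self_sqrt (by positivity)).symm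
  generalize √(n : ℝ) = r at hs h3 ⊢
  rw [h3]
  field_simp
  ring

section Empirical

variable {Ω : Type*} [MeasurableSpace Ω] {P : Measure Ω}
  {m : Measure ℝ} {X : ℕ → Ω → ℝ} {h h' : ℝ → ℝ}

theorem aemeasurable_empCdf (hX : ∀ n, HasLaw (X n) m P) (n j : ℕ) :
    AEMeasurable (fun ω => empCdf (fun k => X k ω) n (X j ω)) P := by
  refine AEMeasurable.const_mul (Finset.aemeasurable_fun_sum _ fun k _ => ?_) _
  exact measurable_le_indicator.comp_aemeasurable ((hX k).aemeasurable.prodMk (hX j).aemeasurable)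

theorem aemeasurable_weighted_empCdf_sub (hX : ∀ n, HasLaw (X n) m P) (hm : Measurable h)
    (n j : ℕ) : AEMeasurable (fun ω =>
      h (X j ω) * (empCdf (fun k => X k ω) n (X j ω) - cdf m (X j ω))) P :=
  (hm.comp_aemeasurable (hX j).aemeasurable).mul
    ((aemeasurable_empCdf hX n j).sub ((measurable_cdf m).comp_aemeasurable (hX j).aemeasurable))

variable [IsProbabilityMeasure m]

theorem aemeasurable_projError (hX : ∀ n, HasLaw (X n) m P) (hm : Measurable h)
    (n : ℕ) : AEMeasurable (fun ω => projError m h (fun k => X k ω) n) P := by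
  refine AEMeasurable.sub (((Finset.aemeasurable_fun_sum _ fun j _ =>
    aemeasurable_weighted_empCdf_sub hX hm n j).const_mul _).const_mul _) ?_
  refine (Finset.aemeasurable_fun_sum _ fun j _ => ?_).const_mul _
  exact (measurable_projKernel hm).comp_aemeasurable (hX j).aemeasurable

variable [IsProbabilityMeasure P]

theorem lintegral_mean_weighted_empCdf_sub_le (hX : ∀ n, HasLaw (X n) m P) (hind : iIndepFun X P)
    (hm : Measurable h) (n : ℕ) :
    ∫⁻ ω, ‖(1 / (n : ℝ)) * ∑ j ∈ Finset.range n, |h (X j ω) * (√(n : ℝ)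
      * (empCdf (fun k => X k ω) n (X j ω) - cdf m (X j ω)))|‖ₑ ∂P ≤ 2 * ∫⁻ x, ‖h x‖ₑ ∂m := by
  simp only [enorm_mul (1 / (n : ℝ))]
  rw [lintegral_const_mul' _ _ (by simp)]
  rcases Nat.eq_zero_or_pos n with rfl | hn
  · simp
  have h1 : ∫⁻ ω, ‖∑ j ∈ Finset.range n, |h (X j ω) * (√(n : ℝ)
      * (empCdf (fun k => X k ω) n (X j ω) - cdf m (X j ω)))|‖ₑ ∂P
      ≤ n * (2 * ∫⁻ x, ‖h x‖ₑ ∂m) := by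
    calc _ ≤ ∫⁻ ω, ∑ j ∈ Finset.range n, ‖h (X j ω) * (√(n : ℝ)
      * (empCdf (fun k => X k ω) n (X j ω) - cdf m (X j ω)))‖ₑ ∂P := by
          refine lintegral_mono fun ω => (enorm_sum_le _ _).trans (le_of_eq ?_)
          refine Finset.sum_congr rfl fun j _ => ?_
          rw [Real.enorm_abs]
      _ = ∑ j ∈ Finset.range n, ∫⁻ ω, ‖h (X j ω) * (√(n : ℝ)
      * (empCdf (fun k => X k ω) n (X j ω) - cdf m (X j ω)))‖ₑ ∂P := by
          refine lintegral_finsetSum' _ fun j _ => ?_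
          have := (aemeasurable_weighted_empCdf_sub hX hm n j).const_mul √(n : ℝ)
          refine AEMeasurable.enorm (this.congr (Eventually.of_forall fun ω => ?_))
          ring
      _ ≤ ∑ j ∈ Finset.range n, 2 * ∫⁻ x, ‖h x‖ₑ ∂m := Finset.sum_le_sum fun j hj =>
          lintegral_weighted_empCdf_sub_le hX hind hm (Finset.mem_range.1 hj)
      _ = n * (2 * ∫⁻ x, ‖h x‖ₑ ∂m) := by simp
  refine (mul_le_mul_right h1 _).trans (le_of_eq ?_)
  rw [← mul_assoc, Real.enorm_of_nonneg (by positivity), ← ENNReal.ofReal_natCast,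
    ← ENNReal.ofReal_mul (by positivity), one_div, inv_mul_cancel₀ (by exact_mod_cast hn.ne')]
  simp

theorem lintegral_projError_le (hX : ∀ n, HasLaw (X n) m P) (hind : iIndepFun X P)
    (hm : Measurable h) (hi : Integrable h m) (n : ℕ) :
    ∫⁻ ω, ‖projError m h (fun k => X k ω) n‖ₑ ∂P ≤ 3 * ∫⁻ x, ‖h x‖ₑ ∂m := by
  have hB := lintegral_enorm_normalized_sum_le hX hind (memLp_projKernel hm hi) n
  rw [integral_projKernel hi] at hB
  simp only [sub_zero] at hB
  have hB2 : ENNReal.ofReal √(Var[projKernel m h; m]) ≤ ∫⁻ x, ‖h x‖ₑ ∂m := by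
    calc _ ≤ ENNReal.ofReal (∫ x, |h x| ∂m) := by
          refine ENNReal.ofReal_le_ofReal ?_
          rw [Real.sqrt_le_left (integral_nonneg fun _ => abs_nonneg _)]
          exact variance_projKernel_le hm hi
      _ = _ := ofReal_integral_norm_eq_lintegral_enorm hi
  have hA := lintegral_mean_weighted_empCdf_sub_le hX hind hm n
  have hmeas : AEMeasurable (fun ω => ‖(√(n : ℝ))⁻¹ *
      ∑ j ∈ Finset.range n, projKernel m h (X j ω)‖ₑ) P := by
    refine ((Finset.aemeasurable_fun_sum _ fun j _ => ?_).const_mul _).enorm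
    exact (measurable_projKernel hm).comp_aemeasurable (hX j).aemeasurable
  calc ∫⁻ ω, ‖projError m h (fun k => X k ω) n‖ₑ ∂P
      ≤ ∫⁻ ω, (‖(1 / (n : ℝ)) * ∑ j ∈ Finset.range n, |h (X j ω) * (√(n : ℝ)
        * (empCdf (fun k => X k ω) n (X j ω) - cdf m (X j ω)))|‖ₑ
        + ‖(√(n : ℝ))⁻¹ * ∑ j ∈ Finset.range n, projKernel m h (X j ω)‖ₑ) ∂P := by
        refine lintegral_mono fun ω => ?_
        unfold projError
        refine (enorm_sub_le).trans (add_le_add_left ?_ _)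
        rw [enorm_le_iff_norm_le, Real.norm_eq_abs, Real.norm_eq_abs, mul_left_comm, Finset.mul_sum,
          abs_mul (1 / (n : ℝ)), abs_mul (1 / (n : ℝ))]
        refine mul_le_mul_of_nonneg_left ?_ (abs_nonneg _)
        refine (Finset.abs_sum_le_sum_abs _ _).trans (le_trans (le_of_eq ?_) (le_abs_self _))
        refine Finset.sum_congr rfl fun j _ => ?_
        congr 1
        ring
    _ ≤ 2 * ∫⁻ x, ‖h x‖ₑ ∂m + ∫⁻ x, ‖h x‖ₑ ∂m := by
        rw [lintegral_add_right' _ hmeas]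
        exact add_le_add hA (hB.trans hB2)
    _ = 3 * ∫⁻ x, ‖h x‖ₑ ∂m := by ring

/-- `h` has a projection error that vanishes in mean. -/
def NegligibleProjError (P : Measure Ω) (m : Measure ℝ) (X : ℕ → Ω → ℝ) (h : ℝ → ℝ) : Prop :=
  Tendsto (fun n => ∫⁻ ω, ‖projError m h (fun k => X k ω) n‖ₑ ∂P) atTop (𝓝 0)

theorem negligibleProjError_of_approx (hX : ∀ n, HasLaw (X n) m P) (hind : iIndepFun X P)
    (hm : Measurable h) (hi : Integrable h m)
    (happ : ∀ ε : ENNReal, 0 < ε → ∃ h' : ℝ → ℝ, Measurable h' ∧ Integrable h' m ∧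
      NegligibleProjError P m X h' ∧ ∫⁻ x, ‖h x - h' x‖ₑ ∂m ≤ ε) :
    NegligibleProjError P m X h := by
  unfold NegligibleProjError
  rw [ENNReal.tendsto_nhds_zero]
  intro η hη
  obtain ⟨h', hm', hi', hN, hle⟩ := happ (η / 2 / 3)
    (ENNReal.div_pos (ENNReal.half_pos hη.ne').ne' (by simp))
  unfold NegligibleProjError at hN
  filter_upwards [hN.eventually_le_const (ENNReal.half_pos hη.ne')] with n hn
  have hb := lintegral_projError_le hX hind (hm.sub hm') (hi.sub hi') n
  calc ∫⁻ ω, ‖projError m h (fun k => X k ω) n‖ₑ ∂P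
      ≤ ∫⁻ ω, (‖projError m (fun x => h x - h' x) (fun k => X k ω) n‖ₑ
        + ‖projError m h' (fun k => X k ω) n‖ₑ) ∂P := by
        refine lintegral_mono fun ω => ?_
        rw [projError_sub hi hi']
        refine le_trans (le_of_eq ?_) (enorm_add_le _ _)
        rw [sub_add_cancel]
    _ = ∫⁻ ω, ‖projError m (fun x => h x - h' x) (fun k => X k ω) n‖ₑ ∂P
        + ∫⁻ ω, ‖projError m h' (fun k => X k ω) n‖ₑ ∂P :=
        lintegral_add_right' _ (aemeasurable_projError hX hm' n).enorm
    _ ≤ 3 * (η / 2 / 3) + η / 2 := by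
        refine add_le_add (hb.trans ?_) hn
        gcongr
        exact hle
    _ = η := by
        rw [ENNReal.mul_div_cancel (by simp) (by simp), ENNReal.add_halves]

end Empirical

section Empirical

variable {Ω : Type*} [MeasurableSpace Ω] {P : Measure Ω}
  {m : Measure ℝ} {X : ℕ → Ω → ℝ} {h h' : ℝ → ℝ}

theorem NegligibleProjError.const_mul (hN : NegligibleProjError P m X h) (a : ℝ) :
    NegligibleProjError P m X (fun x => a * h x) := by
  unfold NegligibleProjError
  simp only [projError_const_mul, enorm_mul]
  have : ∀ n, ∫⁻ ω, ‖a‖ₑ * ‖projError m h (fun k => X k ω) n‖ₑ ∂P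
      = ‖a‖ₑ * ∫⁻ ω, ‖projError m h (fun k => X k ω) n‖ₑ ∂P := fun n =>
    lintegral_const_mul' _ _ (by simp)
  simp only [this]
  have h2 := ENNReal.Tendsto.const_mul (a := ‖a‖ₑ) hN (Or.inr (by simp))
  rwa [mul_zero] at h2

variable [IsProbabilityMeasure m]

theorem NegligibleProjError.sub (hX : ∀ n, HasLaw (X n) m P)
    (hm' : Measurable h')
    (hi : Integrable h m) (hi' : Integrable h' m) (hN : NegligibleProjError P m X h)
    (hN' : NegligibleProjError P m X h') :
    NegligibleProjError P m X (fun x => h x - h' x) := by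
  have := hN.add hN'
  rw [add_zero] at this
  refine tendsto_of_tendsto_of_tendsto_of_le_of_le tendsto_const_nhds this (fun _ => zero_le)
    fun n => ?_
  dsimp only
  rw [← lintegral_add_right' _ (aemeasurable_projError hX hm' n).enorm]
  refine lintegral_mono fun ω => ?_
  rw [projError_sub hi hi']
  exact enorm_sub_le

theorem NegligibleProjError.add (hX : ∀ n, HasLaw (X n) m P)
    (hm' : Measurable h')
    (hi : Integrable h m) (hi' : Integrable h' m) (hN : NegligibleProjError P m X h)
    (hN' : NegligibleProjError P m X h') :
    NegligibleProjError P m X (fun x => h x + h' x) := by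
  have := hN.sub hX (hm'.const_mul (-1)) hi (hi'.const_mul (-1)) (hN'.const_mul (-1))
  simpa using this

variable [IsProbabilityMeasure P]

theorem integral_sq_empCdf_sub_le (hX : ∀ n, HasLaw (X n) m P) (hind : iIndepFun X P) (a : ℝ)
    {n : ℕ} (hn : 0 < n) :
    ∫ ω, (empCdf (fun k => X k ω) n a - cdf m a) ^ 2 ∂P ≤ 1 / (n : ℝ) := by
  have hn' : (0 : ℝ) < n := by exact_mod_cast hn
  have h1 := integral_sq_sum_sub hX hind (memLp_indicator_le (m := m) a) (Finset.range n)
  simp only [integral_indicator_le, Finset.card_range] at h1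
  have h2 : ∀ ω, (empCdf (fun k => X k ω) n a - cdf m a) ^ 2
      = (1 / (n : ℝ)) ^ 2 * (∑ k ∈ Finset.range n,
        ((if X k ω ≤ a then (1 : ℝ) else 0) - cdf m a)) ^ 2 := fun ω => by
    rw [← mul_pow]
    congr 1
    unfold empCdf
    simp only [Finset.sum_sub_distrib, Finset.sum_const, Finset.card_range, nsmul_eq_mul]
    field_simp
  simp only [h2]
  rw [integral_const_mul, h1]
  have := variance_indicator_le (m := m) a
  calc (1 / (n : ℝ)) ^ 2 * ((n : ℝ) * Var[fun y => if y ≤ a then (1 : ℝ) else 0; m])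
      ≤ (1 / (n : ℝ)) ^ 2 * ((n : ℝ) * 1) := by gcongr
    _ = 1 / (n : ℝ) := by field_simp

theorem negligibleProjError_indicator_Iic [NullSingletonClass m] (hX : ∀ n, HasLaw (X n) m P)
    (hind : iIndepFun X P) (a : ℝ) :
    NegligibleProjError P m X ((Iic a).indicator 1) := by
  have hbound : ∀ᶠ n : ℕ in atTop, ∫⁻ ω, ‖projError m ((Iic a).indicator 1) (fun k => X k ω) n‖ₑ ∂P
      ≤ ENNReal.ofReal (√(n : ℝ))⁻¹ := by
    filter_upwards [eventually_gt_atTop 0] with n hn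
    have hn' : (0 : ℝ) < n := by exact_mod_cast hn
    have hsq : Integrable (fun ω => (empCdf (fun k => X k ω) n a - cdf m a) ^ 2) P := by
      refine Integrable.of_bound (C := 1) ?_ (Eventually.of_forall fun ω => ?_)
      · refine AEMeasurable.aestronglyMeasurable (AEMeasurable.pow_const (AEMeasurable.sub_const
          ((Finset.aemeasurable_fun_sum _ fun k _ => ?_).const_mul _) _) _)
        exact measurable_le_indicator.comp_aemeasurable
          ((hX k).aemeasurable.prodMk aemeasurable_const)
      · rw [Real.norm_of_nonneg (sq_nonneg _), sq_le_one_iff_abs_le_one, abs_le]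
        constructor <;> linarith [cdf_nonneg m a, cdf_le_one m a,
          empCdf_nonneg (fun k => X k ω) n a, empCdf_le_one (fun k => X k ω) n a]
    calc ∫⁻ ω, ‖projError m ((Iic a).indicator 1) (fun k => X k ω) n‖ₑ ∂P
        ≤ ∫⁻ ω, ENNReal.ofReal (√(n : ℝ) *
          (((empCdf (fun k => X k ω) n a - cdf m a) ^ 2 + 1 / n) / 2)) ∂P := by
          refine lintegral_mono_ae ?_
          filter_upwards [ae_ne_of_indep hX hind] with ω hω
          rw [projError_indicator_Iic (fun j k hjk => hω j k hjk) a hn, Real.enorm_of_nonneg]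
          · have := empCdf_le_one (fun k => X k ω) n a
            gcongr
          · have := empCdf_nonneg (fun k => X k ω) n a
            positivity
      _ = ENNReal.ofReal (∫ ω, √(n : ℝ) *
          (((empCdf (fun k => X k ω) n a - cdf m a) ^ 2 + 1 / n) / 2) ∂P) := by
          rw [ofReal_integral_eq_lintegral_ofReal]
          · exact ((hsq.add (integrable_const _)).div_const _).const_mul _
          · exact Eventually.of_forall fun ω => by dsimp; positivity
      _ ≤ ENNReal.ofReal (√(n : ℝ))⁻¹ := by
          refine ENNReal.ofReal_le_ofReal ?_
          rw [integral_const_mul, integral_div, integral_add hsq (integrable_const _)]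
          have h1 := integral_sq_empCdf_sub_le hX hind a hn
          simp only [integral_const, probReal_univ, smul_eq_mul, one_mul]
          calc √(n : ℝ) * ((∫ ω, (empCdf (fun k => X k ω) n a - cdf m a) ^ 2 ∂P + 1 / n) / 2)
              ≤ √(n : ℝ) * ((1 / n + 1 / n) / 2) := by gcongr
            _ = (√(n : ℝ))⁻¹ := by
              have hs : √(n : ℝ) ≠ 0 := (Real.sqrt_pos.2 hn').ne'
              have h3 : (n : ℝ) = √(n : ℝ) * √(n : ℝ) := (Real.mul_self_sqrt hn'.le).symm
              generalize √(n : ℝ) = r at hs h3 ⊢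
              rw [h3]
              field_simp
              norm_num
  have hlim : Tendsto (fun n : ℕ => ENNReal.ofReal (√(n : ℝ))⁻¹) atTop (𝓝 0) := by
    rw [← ENNReal.ofReal_zero]
    exact ENNReal.tendsto_ofReal (tendsto_inv_atTop_zero.comp
      (Real.tendsto_sqrt_atTop.comp tendsto_natCast_atTop_atTop))
  exact tendsto_of_tendsto_of_tendsto_of_le_of_le' tendsto_const_nhds hlim
    (Eventually.of_forall fun _ => zero_le) hbound

theorem negligibleProjError_one (hX : ∀ n, HasLaw (X n) m P) (hind : iIndepFun X P)
    [NullSingletonClass m] : NegligibleProjError P m X 1 := by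
  refine negligibleProjError_of_approx hX hind measurable_one (integrable_const 1) fun ε hε => ?_
  have h1 : Tendsto (fun n : ℕ => m (Ioi (n : ℝ))) atTop (𝓝 0) := by
    have h2 := tendsto_measure_iInter_atTop (μ := m) (s := fun n : ℕ => Ioi (n : ℝ))
      (fun n => measurableSet_Ioi.nullMeasurableSet)
      (fun i j hij => Ioi_subset_Ioi (by exact_mod_cast hij)) ⟨0, measure_ne_top _ _⟩
    have h3 : ⋂ n : ℕ, Ioi (n : ℝ) = ∅ := by
      ext x
      simp only [mem_iInter, mem_Ioi, mem_empty_iff_false, iff_false, not_forall, not_lt]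
      exact exists_nat_ge x
    rwa [h3, measure_empty] at h2
  obtain ⟨n, hn⟩ := (h1.eventually_le_const hε).exists
  refine ⟨(Iic (n : ℝ)).indicator 1, measurable_one.indicator measurableSet_Iic,
    (integrable_const (1 : ℝ)).indicator measurableSet_Iic,
    negligibleProjError_indicator_Iic hX hind _, le_trans (le_of_eq ?_) hn⟩
  rw [← lintegral_indicator_one measurableSet_Ioi]
  refine lintegral_congr fun x => ?_
  by_cases hx : x ≤ n
  · simp [indicator, hx, not_lt.2 hx]
  · simp [indicator, hx, not_le.1 hx]

theorem negligibleProjError_indicator (hX : ∀ n, HasLaw (X n) m P) (hind : iIndepFun X P)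
    [NullSingletonClass m] {A : Set ℝ} (hA : MeasurableSet A) :
    NegligibleProjError P m X (A.indicator 1) := by
  have hint : ∀ B : Set ℝ, MeasurableSet B → Integrable (B.indicator (1 : ℝ → ℝ)) m :=
    fun B hB => (integrable_const (1 : ℝ)).indicator hB
  induction A, hA using MeasurableSpace.induction_on_inter (borel_eq_generateFrom_Iic ℝ)
    isPiSystem_Iic with
  | empty =>
    have := (negligibleProjError_one hX hind).const_mul 0
    refine this.congr fun n => ?_
    simp
  | basic t ht =>
    obtain ⟨a, rfl⟩ := ht
    exact negligibleProjError_indicator_Iic hX hind a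
  | compl t ht ih =>
    have := (negligibleProjError_one hX hind).sub hX (measurable_one.indicator ht)
      (integrable_const 1) (hint t ht) ih
    convert this using 1
    ext x
    by_cases hx : x ∈ t <;> simp [hx]
  | iUnion f hdisj hf ih =>
    have hfin : ∀ N : ℕ, NegligibleProjError P m X ((⋃ k ∈ Finset.range N, f k).indicator 1) := by
      intro N
      induction N with
      | zero =>
        have := (negligibleProjError_one hX hind).const_mul 0
        convert this using 1
        ext x
        simp
      | succ N ihN =>
        have hmU : MeasurableSet (⋃ k ∈ Finset.range N, f k) :=
          Finset.measurableSet_biUnion _ fun k _ => hf k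
        have := ihN.add hX (measurable_one.indicator (hf N)) (hint _ hmU) (hint _ (hf N)) (ih N)
        convert this using 1
        have hd : Disjoint (⋃ k ∈ Finset.range N, f k) (f N) := by
          simp only [disjoint_iUnion_left, Finset.mem_range]
          exact fun k hk => hdisj hk.ne
        rw [Finset.range_add_one, Finset.set_biUnion_insert, union_comm,
          indicator_union_of_disjoint hd]
    refine negligibleProjError_of_approx hX hind
      (measurable_one.indicator (MeasurableSet.iUnion hf)) (hint _ (MeasurableSet.iUnion hf))
      fun ε hε => ?_
    set V : ℕ → Set ℝ := fun N => (⋃ k, f k) \ ⋃ k ∈ Finset.range N, f k with hV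
    have hmU : ∀ N, MeasurableSet (⋃ k ∈ Finset.range N, f k) := fun N =>
      Finset.measurableSet_biUnion _ fun k _ => hf k
    have hVm : ∀ N, MeasurableSet (V N) := fun N => (MeasurableSet.iUnion hf).diff (hmU N)
    have h1 : Tendsto (fun N => m (V N)) atTop (𝓝 0) := by
      have h2 := tendsto_measure_iInter_atTop (μ := m) (s := V)
        (fun n => (hVm n).nullMeasurableSet)
        (fun i j hij => sdiff_subset_sdiff_right (biUnion_subset_biUnion_left fun k hk => by
          simp only [Finset.coe_range, mem_Iio] at hk ⊢
          exact lt_of_lt_of_le hk hij)) ⟨0, measure_ne_top _ _⟩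
      have h3 : ⋂ n : ℕ, V n = ∅ := by
        refine eq_empty_of_forall_notMem fun x hx => ?_
        have hx' := mem_iInter.1 hx
        obtain ⟨k, hk⟩ := mem_iUnion.1 (hx' 0).1
        exact (hx' (k + 1)).2 (mem_biUnion (Finset.mem_range.2 (Nat.lt_succ_self k)) hk)
      rwa [h3, measure_empty] at h2
    obtain ⟨N, hN⟩ := (h1.eventually_le_const hε).exists
    refine ⟨_, measurable_one.indicator (hmU N), hint _ (hmU N), hfin N,
      le_trans (le_of_eq ?_) hN⟩
    rw [← lintegral_indicator_one (hVm N)]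
    refine lintegral_congr fun x => ?_
    have hsub : (⋃ k ∈ Finset.range N, f k) ⊆ ⋃ k, f k :=
      iUnion_subset fun k => iUnion_subset fun _ => subset_iUnion f k
    by_cases hx : x ∈ ⋃ k ∈ Finset.range N, f k
    · have hx2 := hsub hx
      have hx3 : x ∉ V N := fun h => h.2 hx
      simp only [indicator_of_mem hx, indicator_of_mem hx2, indicator_of_notMem hx3]
      simp
    · by_cases hx2 : x ∈ ⋃ k, f k
      · have hx3 : x ∈ V N := ⟨hx2, hx⟩
        simp only [indicator_of_notMem hx, indicator_of_mem hx2, indicator_of_mem hx3]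
        simp
      · have hx3 : x ∉ V N := fun h => hx2 h.1
        simp only [indicator_of_notMem hx, indicator_of_notMem hx2, indicator_of_notMem hx3]
        simp

/-- The weighted empirical process is asymptotically its projection, for integrable weights. -/
theorem negligibleProjError_of_integrable (hX : ∀ n, HasLaw (X n) m P) (hind : iIndepFun X P)
    [NullSingletonClass m] (hm : Measurable h) (hi : Integrable h m) :
    NegligibleProjError P m X h := by
  have hsimple : ∀ f : SimpleFunc ℝ ℝ, NegligibleProjError P m X f := by
    intro f
    induction f using SimpleFunc.induction with
    | const a hs =>
      have := (negligibleProjError_indicator hX hind hs).const_mul a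
      convert this using 1
      ext x
      simp [indicator]
    | add hd hf hg =>
      rename_i f g
      exact hf.add hX g.measurable (f.integrable_of_isFiniteMeasure)
        (g.integrable_of_isFiniteMeasure) hg
  refine negligibleProjError_of_approx hX hind hm hi fun ε hε => ?_
  obtain ⟨f, hf, -⟩ := (memLp_one_iff_integrable.2 hi).exists_simpleFunc_eLpNorm_sub_lt
    (by simp) hε.ne'
  refine ⟨f, f.measurable, f.integrable_of_isFiniteMeasure, hsimple f, ?_⟩
  rw [eLpNorm_one_eq_lintegral_enorm] at hf
  exact hf.le

theorem negligibleInProb_projError (hX : ∀ n, HasLaw (X n) m P) (hind : iIndepFun X P)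
    [NullSingletonClass m] (hm : Measurable h) (hi : Integrable h m) :
    NegligibleInProb P (fun n ω => projError m h (fun k => X k ω) n) :=
  negligibleInProb_of_lintegral (fun n => aemeasurable_projError hX hm n)
    (negligibleProjError_of_integrable hX hind hm hi)

end Empirical

/-! ### Order statistics and ranks -/

/-- Rank of `x j` among `x 0, …, x (n - 1)`. -/
def rankN (x : ℕ → ℝ) (n j : ℕ) : ℕ := ((Finset.range n).filter (fun k => x k ≤ x j)).card

theorem rankN_div_eq_empCdf (x : ℕ → ℝ) (n j : ℕ) :
    (rankN x n j : ℝ) / n = empCdf x n (x j) := by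
  unfold rankN empCdf
  rw [Finset.card_filter]
  push_cast
  ring

theorem poorN_div_eq_empCdf (z : ℝ) (y : ℕ → Fin 2 → ℝ) (i : Fin 2) (n : ℕ) :
    (poorN z y i n : ℝ) / n = empCdf (fun k => y k i) n z := by
  unfold poorN empCdf
  rw [Finset.card_filter]
  push_cast
  ring

theorem card_filter_range_eq (n : ℕ) (p : ℕ → Prop) [DecidablePred p] :
    ((Finset.range n).filter p).card = (Finset.univ.filter (fun k : Fin n => p k)).card := by
  rw [Finset.card_filter, Finset.card_filter, ← Fin.sum_univ_eq_sum_range (fun k => if p k then 1 else 0)]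

theorem rankN_sort (x : ℕ → ℝ) (hx : Function.Injective x) (n : ℕ) (k : Fin n) :
    rankN x n (Tuple.sort (fun j : Fin n => x j) k : Fin n) = (k : ℕ) + 1 := by
  set σ := Tuple.sort (fun j : Fin n => x j) with hσ
  have hmono : StrictMono ((fun j : Fin n => x j) ∘ σ) :=
    (Tuple.monotone_sort (fun j : Fin n => x j)).strictMono_of_injective
      ((hx.comp Fin.val_injective).comp σ.injective)
  unfold rankN
  rw [card_filter_range_eq]
  have h1 : (Finset.univ.filter (fun l : Fin n => x l ≤ x (σ k))).card
      = (Finset.univ.filter (fun l : Fin n => x (σ l) ≤ x (σ k))).card := by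
    rw [Finset.card_filter, Finset.card_filter,
      ← Equiv.sum_comp σ (fun l : Fin n => if x l ≤ x (σ k) then 1 else 0)]
  rw [h1]
  have h2 : ∀ l : Fin n, x (σ l) ≤ x (σ k) ↔ l ≤ k := fun l => hmono.le_iff_le
  simp only [h2]
  have h3 : Finset.univ.filter (fun l : Fin n => l ≤ k) = Finset.Iic k := by ext; simp
  rw [h3, Fin.card_Iic]

theorem sum_orderStat (y : ℕ → Fin 2 → ℝ) (i : Fin 2) (hy : Function.Injective fun j => y j i)
    (n : ℕ) (Φ : ℕ → ℝ → ℝ) :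
    ∑ k : Fin n, Φ ((k : ℕ) + 1) (orderStat y i n k)
      = ∑ j ∈ Finset.range n, Φ (rankN (fun j => y j i) n j) (y j i) := by
  set x : ℕ → ℝ := fun j => y j i with hx
  rw [← Fin.sum_univ_eq_sum_range (fun j => Φ (rankN x n j) (x j)),
    ← Equiv.sum_comp (Tuple.sort (fun j : Fin n => x j)) (fun j : Fin n => Φ (rankN x n j) (x j))]
  refine Finset.sum_congr rfl fun k _ => ?_
  rw [rankN_sort x hy n k]
  rfl

theorem lt_poorN_iff (z : ℝ) (y : ℕ → Fin 2 → ℝ) (i : Fin 2) (n : ℕ) (k : Fin n) :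
    (k : ℕ) < poorN z y i n ↔ orderStat y i n k ≤ z := by
  have h := Tuple.lt_card_le_iff_apply_le_of_monotone (j := k) (a := z)
    (Tuple.monotone_sort (fun j : Fin n => y j i))
  unfold poorN orderStat
  rw [card_filter_range_eq, ← h]
  have h1 : (Finset.univ.filter (fun l : Fin n => y l i ≤ z)).card
      = (Finset.univ.filter (fun l : Fin n => ((fun j : Fin n => y j i) ∘
        Tuple.sort (fun j : Fin n => y j i)) l ≤ z)).card := by
    rw [Finset.card_filter, Finset.card_filter,
      ← Equiv.sum_comp (Tuple.sort (fun j : Fin n => y j i))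
        (fun l : Fin n => if y l i ≤ z then 1 else 0)]
    rfl
  rw [h1]

theorem rankN_le_poorN (z : ℝ) (y : ℕ → Fin 2 → ℝ) (i : Fin 2) (n j : ℕ) (hj : y j i ≤ z) :
    rankN (fun j => y j i) n j ≤ poorN z y i n := by
  unfold rankN poorN
  exact Finset.card_le_card fun k hk => by
    simp only [Finset.mem_filter] at hk ⊢
    exact ⟨hk.1, hk.2.trans hj⟩

theorem rankN_pos (x : ℕ → ℝ) {n j : ℕ} (hj : j < n) : 0 < rankN x n j :=
  Finset.card_pos.2 ⟨j, by simp [hj]⟩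

theorem gpiN_eq (S : PovertySpec) (z : ℝ) (y : ℕ → Fin 2 → ℝ) (i : Fin 2)
    (hy : Function.Injective fun j => y j i) (n : ℕ) :
    gpiN S z y i n = (1 / (n : ℝ)) * ∑ j ∈ Finset.range n,
      (S.A (poorN z y i n) n z * S.w (S.mu₁ * n + S.mu₂ * (poorN z y i n)
        - S.mu₃ * (rankN (fun j => y j i) n j) + S.mu₄) / S.B (poorN z y i n))
        * (Iic z).indicator (fun x => S.d ((z - x) / z)) (y j i) := by
  have h := sum_orderStat y i hy n (fun r x => S.w (S.mu₁ * n + S.mu₂ * (poorN z y i n)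
        - S.mu₃ * r + S.mu₄) * (Iic z).indicator (fun x => S.d ((z - x) / z)) x)
  unfold gpiN
  rw [Finset.sum_filter]
  have h2 : ∑ k : Fin n, (if (k : ℕ) < poorN z y i n then
      S.w (S.mu₁ * n + S.mu₂ * (poorN z y i n) - S.mu₃ * ((k : ℕ) + 1) + S.mu₄) *
        S.d ((z - orderStat y i n k) / z) else 0)
      = ∑ k : Fin n, S.w (S.mu₁ * n + S.mu₂ * (poorN z y i n)
        - S.mu₃ * ((k : ℕ) + 1 : ℕ) + S.mu₄)
          * (Iic z).indicator (fun x => S.d ((z - x) / z)) (orderStat y i n k) := by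
    refine Finset.sum_congr rfl fun k _ => ?_
    simp only [lt_poorN_iff, indicator, mem_Iic, mul_ite, mul_zero]
    push_cast
    rfl
  rw [h2, h, Finset.mul_sum, Finset.mul_sum]
  refine Finset.sum_congr rfl fun j _ => ?_
  rw [div_mul_eq_div_div_swap]
  ring

theorem giniN_eq (y : ℕ → Fin 2 → ℝ) (i : Fin 2) (hy : Function.Injective fun j => y j i)
    {n : ℕ} (hn : 0 < n) (hmean : empMean y i n ≠ 0) :
    giniN y i n = 2 * ((1 / (n : ℝ)) * ∑ j ∈ Finset.range n,
      y j i * empCdf (fun k => y k i) n (y j i)) / empMean y i n - 1 - 1 / n := by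
  have hn' : (n : ℝ) ≠ 0 := by exact_mod_cast hn.ne'
  have h := sum_orderStat y i hy n (fun r x => ((2 * (r : ℝ) - 1) / n - 1) * x)
  unfold giniN
  push_cast at h
  rw [h]
  have h1 : ∑ j ∈ Finset.range n, ((2 * (rankN (fun j => y j i) n j : ℝ) - 1) / n - 1) * y j i
      = 2 * ∑ j ∈ Finset.range n, y j i * empCdf (fun k => y k i) n (y j i)
        - (1 / n + 1) * (n * empMean y i n) := by
    have h2 : (n : ℝ) * empMean y i n = ∑ j ∈ Finset.range n, y j i := by
      unfold empMean
      rw [Fin.sum_univ_eq_sum_range (fun j => y j i)]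
      field_simp
    rw [h2, Finset.mul_sum, Finset.mul_sum, ← Finset.sum_sub_distrib]
    refine Finset.sum_congr rfl fun j _ => ?_
    have := rankN_div_eq_empCdf (fun j => y j i) n j
    rw [← this]
    ring
  rw [h1]
  field_simp
  ring

/-! ### Uniform convergence of the empirical distribution function -/

theorem abs_sub_le_of_grid {F G : ℝ → ℝ} (hF : Monotone F) (hG : Monotone G)
    (hF0 : ∀ t, 0 ≤ F t) (hF1 : ∀ t, F t ≤ 1) (hG0 : ∀ t, 0 ≤ G t) (hG1 : ∀ t, G t ≤ 1)
    {N : ℕ} (hN : 0 < N) {u : ℕ → ℝ} (hu : ∀ k, 0 < k → k < N → F (u k) = (k : ℝ) / N)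
    {ε : ℝ} (hε : 0 ≤ ε) (hFG : ∀ k, 0 < k → k < N → |G (u k) - F (u k)| ≤ ε) (t : ℝ) :
    |G t - F t| ≤ ε + 2 / N := by
  have hN' : (0 : ℝ) < N := by exact_mod_cast hN
  set k := ⌊F t * N⌋₊ with hk
  have hk1 : (k : ℝ) ≤ F t * N := Nat.floor_le (mul_nonneg (hF0 t) hN'.le)
  have hk2 : F t * N < k + 1 := Nat.lt_floor_add_one _
  have hkF : F t < ((k + 1 : ℕ) : ℝ) / N := by
    rw [lt_div_iff₀ hN']; push_cast; exact hk2
  have hkF' : (k : ℝ) / N ≤ F t := by rw [div_le_iff₀ hN']; exact hk1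
  have hstep : ((k + 1 : ℕ) : ℝ) / N = (k : ℝ) / N + 1 / N := by push_cast; ring
  have hinv : (0 : ℝ) < 1 / N := by positivity
  have h2N : (2 : ℝ) / N = 1 / N + 1 / N := by ring
  rw [abs_le]
  constructor
  · rcases Nat.lt_or_ge 1 k with h | h
    · have hkN : k - 1 < N := by
        have : (k : ℝ) ≤ N := hk1.trans (mul_le_of_le_one_left hN'.le (hF1 t))
        have : k ≤ N := by exact_mod_cast this
        omega
      have h0 : 0 < k - 1 := by omega
      have hcast : ((k - 1 : ℕ) : ℝ) = k - 1 := by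
        rw [Nat.cast_sub (by omega)]; simp
      have hlt : F (u (k - 1)) < F t := by
        rw [hu _ h0 hkN, hcast]
        refine lt_of_lt_of_le ?_ hkF'
        gcongr
        linarith
      have hle : u (k - 1) ≤ t := (hF.reflect_lt hlt).le
      have h1 := (abs_le.1 (hFG _ h0 hkN)).1
      have h2 := hG hle
      rw [hu _ h0 hkN, hcast] at h1
      have : ((k : ℝ) - 1) / N = k / N - 1 / N := by ring
      linarith
    · have : ((k + 1 : ℕ) : ℝ) / N ≤ 2 / N := by
        gcongr
        exact_mod_cast Nat.succ_le_succ h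
      linarith [hG0 t]
  · rcases Nat.lt_or_ge (k + 1) N with h | h
    · have hlt : F t < F (u (k + 1)) := by rw [hu _ (by omega) h]; exact hkF
      have h1 := (abs_le.1 (hFG _ (Nat.succ_pos k) h)).2
      have h2 := hG (hF.reflect_lt hlt).le
      rw [hu _ (by omega) h] at h1
      linarith
    · have : (1 : ℝ) ≤ ((k + 1 : ℕ) : ℝ) / N := by
        rw [one_le_div hN']; exact_mod_cast h
      linarith [hG1 t]

theorem exists_cdf_eq {m : Measure ℝ} (hF : Continuous (cdf m))
    {r : ℝ} (h0 : 0 < r) (h1 : r < 1) : ∃ t, cdf m t = r := by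
  obtain ⟨a, ha⟩ := ((tendsto_cdf_atBot m).eventually_lt_const h0).exists
  obtain ⟨b, hb⟩ := ((tendsto_cdf_atTop m).eventually_const_lt h1).exists
  exact mem_range_of_exists_le_of_exists_ge hF ⟨a, ha.le⟩ ⟨b, hb.le⟩

/-- **Glivenko-Cantelli theorem** (in probability) for a continuous distribution function. -/
theorem tendsto_measure_exists_lt_abs_empCdf_sub {Ω : Type*} [MeasurableSpace Ω] {P : Measure Ω}
    [IsProbabilityMeasure P] {m : Measure ℝ} [IsProbabilityMeasure m] {X : ℕ → Ω → ℝ}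
    (hX : ∀ n, HasLaw (X n) m P) (hind : iIndepFun X P) (hF : Continuous (cdf m))
    {δ : ℝ} (hδ : 0 < δ) :
    Tendsto (fun n => P {ω | ∃ t, δ < |empCdf (fun k => X k ω) n t - cdf m t|}) atTop (𝓝 0) := by
  obtain ⟨N, hN⟩ := exists_nat_gt (4 / δ)
  have hN0 : 0 < N := by
    have : (0 : ℝ) < N := lt_trans (by positivity) hN
    exact_mod_cast this
  have hN' : (0 : ℝ) < N := by exact_mod_cast hN0
  have hex : ∀ k : ℕ, ∃ t, 0 < k → k < N → cdf m t = (k : ℝ) / N := fun k => by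
    by_cases hk : 0 < k ∧ k < N
    · obtain ⟨t, ht⟩ := exists_cdf_eq hF (r := (k : ℝ) / N)
        (div_pos (by exact_mod_cast hk.1) hN') ((div_lt_one hN').2 (by exact_mod_cast hk.2))
      exact ⟨t, fun _ _ => ht⟩
    · exact ⟨0, fun h1 h2 => absurd ⟨h1, h2⟩ hk⟩
  choose u hu using hex
  have hpt : ∀ k : ℕ, Tendsto (fun n => P {ω | δ / 2 ≤
      |empCdf (fun k => X k ω) n (u k) - cdf m (u k)|}) atTop (𝓝 0) := fun k => by
    have := negligibleInProb_mean_sub hX hind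
      ((memLp_indicator_le (m := m) (u k)).integrable (by norm_num)) (δ / 2) (by positivity)
    simp only [integral_indicator_le] at this
    exact this
  have hsum : Tendsto (fun n => ∑ k ∈ Finset.range N, P {ω | δ / 2 ≤
      |empCdf (fun k => X k ω) n (u k) - cdf m (u k)|}) atTop (𝓝 0) := by
    simpa using tendsto_finsetSum (Finset.range N) fun k _ => hpt k
  refine tendsto_of_tendsto_of_tendsto_of_le_of_le tendsto_const_nhds hsum (fun _ => zero_le)
    fun n => ?_
  refine le_trans (measure_mono ?_) (measure_biUnion_finset_le _ _)
  rintro ω ⟨t, ht⟩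
  by_contra hcon
  simp only [mem_iUnion, Finset.mem_range, mem_ofPred_eq, exists_prop, not_exists, not_and,
    not_le] at hcon
  have := abs_sub_le_of_grid (monotone_cdf m) (monotone_empCdf (fun k => X k ω) n)
    (cdf_nonneg m) (cdf_le_one m) (empCdf_nonneg _ n) (empCdf_le_one _ n) hN0 hu
    (by positivity : 0 ≤ δ / 2) (fun k _ hk => (hcon k hk).le) t
  have h2 : 2 / (N : ℝ) ≤ δ / 2 := by
    rw [div_lt_iff₀ hδ] at hN
    rw [div_le_iff₀ hN']
    linarith
  linarith

/-! ### First order expansion of a smooth weight along its segment -/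

/-- Uniform first order expansion of `c` along `{p} × [0,p]`, with coefficients `a₀, a₁, a₂`
(value and partial derivatives) extended to continuous bounded functions. -/
structure WeightExpansion (c : ℝ → ℝ → ℝ) (p : ℝ) (a₀ a₁ a₂ : ℝ → ℝ) : Prop where
  value_eq : ∀ s ∈ Icc 0 p, a₀ s = c p s
  deriv_fst_eq : ∀ s ∈ Icc 0 p, a₁ s = deriv (fun r => c r s) p
  deriv_snd_eq : ∀ s ∈ Icc 0 p, a₂ s = deriv (fun t => c p t) s
  measurable_value : Measurable a₀
  measurable_fst : Measurable a₁
  measurable_snd : Measurable a₂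
  bounded_value : ∃ M, ∀ s, |a₀ s| ≤ M
  bounded_fst : ∃ M, ∀ s, |a₁ s| ≤ M
  bounded_snd : ∃ M, ∀ s, |a₂ s| ≤ M
  taylor : ∀ δ : ℝ, 0 < δ → ∃ η : ℝ, 0 < η ∧ ∀ s ∈ Icc 0 p, ∀ p' s' : ℝ, |p' - p| ≤ η →
    |s' - s| ≤ η →
    |c p' s' - a₀ s - a₁ s * (p' - p) - a₂ s * (s' - s)| ≤ δ * (|p' - p| + |s' - s|)

theorem exists_bounded_extension {p : ℝ} (hp : 0 ≤ p) {f : ℝ → ℝ} (hf : ContinuousOn f (Icc 0 p)) :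
    ∃ a : ℝ → ℝ, (∀ s ∈ Icc 0 p, a s = f s) ∧ Measurable a ∧ ∃ M, ∀ s, |a s| ≤ M := by
  refine ⟨IccExtend hp ((Icc 0 p).domRestrict f), fun s hs => ?_, ?_, ?_⟩
  · rw [IccExtend_of_mem hp _ hs]; rfl
  · exact (continuous_IccExtend_iff.2 (continuousOn_iff_continuous_domRestrict.1 hf)).measurable
  · obtain ⟨M, hM⟩ := isCompact_Icc.exists_bound_of_continuousOn hf
    exact ⟨M, fun s => hM _ (projIcc 0 p hp s).2⟩

theorem SmoothWeight.exists_expansion {c : ℝ → ℝ → ℝ} {p : ℝ} (hp : 0 ≤ p)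
    (hc : SmoothWeight c p) : ∃ a₀ a₁ a₂ : ℝ → ℝ, WeightExpansion c p a₀ a₁ a₂ := by
  obtain ⟨U, hU, hsub, hcd⟩ := hc
  set f : ℝ × ℝ → ℝ := fun a => c a.1 a.2 with hf
  have hdiff : ∀ a ∈ U, HasFDerivAt f (fderiv ℝ f a) a := fun a ha =>
    ((hcd.differentiableOn (by norm_num)).differentiableAt (hU.mem_nhds ha)).hasFDerivAt
  have hcont : ContinuousOn (fderiv ℝ f) U := hcd.continuousOn_fderiv_of_isOpen hU le_rfl
  have hmaps : MapsTo (fun s : ℝ => (p, s)) (Icc 0 p) U := fun s hs => hsub s hs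
  have hpair : ContinuousOn (fun s : ℝ => (p, s)) (Icc 0 p) := by fun_prop
  have hD : ContinuousOn (fun s : ℝ => fderiv ℝ f (p, s)) (Icc 0 p) := hcont.comp hpair hmaps
  have h1 : ∀ s ∈ Icc 0 p, deriv (fun r => c r s) p = fderiv ℝ f (p, s) (1, 0) := fun s hs => by
    have := (hdiff _ (hsub s hs)).comp_hasDerivAt p ((hasDerivAt_id p).prodMk (hasDerivAt_const p s))
    exact this.deriv
  have h2 : ∀ s ∈ Icc 0 p, deriv (fun t => c p t) s = fderiv ℝ f (p, s) (0, 1) := fun s hs => by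
    have := (hdiff _ (hsub s hs)).comp_hasDerivAt s ((hasDerivAt_const s p).prodMk (hasDerivAt_id s))
    exact this.deriv
  obtain ⟨a₀, h0, hm0, hb0⟩ := exists_bounded_extension hp
    (f := fun s => c p s) ((hcd.continuousOn).comp hpair hmaps)
  obtain ⟨a₁, h1', hm1, hb1⟩ := exists_bounded_extension hp
    (f := fun s => fderiv ℝ f (p, s) (1, 0)) (hD.clm_apply continuousOn_const)
  obtain ⟨a₂, h2', hm2, hb2⟩ := exists_bounded_extension hp
    (f := fun s => fderiv ℝ f (p, s) (0, 1)) (hD.clm_apply continuousOn_const)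
  refine ⟨a₀, a₁, a₂, h0, fun s hs => (h1' s hs).trans (h1 s hs).symm,
    fun s hs => (h2' s hs).trans (h2 s hs).symm, hm0, hm1, hm2, hb0, hb1, hb2, fun δ hδ => ?_⟩
  have hcompact : IsCompact ((fun s : ℝ => (p, s)) '' Icc 0 p) := isCompact_Icc.image_of_continuousOn hpair
  have hKU : (fun s : ℝ => (p, s)) '' Icc 0 p ⊆ U := image_subset_iff.2 hmaps
  obtain ⟨η₁, hη₁, hthick⟩ := hcompact.exists_cthickening_subset_open hU hKU
  have hunif := hcompact.uniformContinuousAt_of_continuousAt (fderiv ℝ f)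
    (fun a ha => hcont.continuousAt (hU.mem_nhds (hKU ha))) (Metric.dist_mem_uniformity hδ)
  obtain ⟨η₂, hη₂, hη₂'⟩ := Metric.mem_uniformity_dist.1 hunif
  refine ⟨min η₁ (η₂ / 2), by positivity, fun s hs p' s' hp' hs' => ?_⟩
  set a : ℝ × ℝ := (p, s) with ha
  set η := min η₁ (η₂ / 2) with hη
  have hball : ∀ b ∈ Metric.closedBall a η, b ∈ U := fun b hb => hthick
    (Metric.closedBall_subset_cthickening (mem_image_of_mem _ hs) _
      (Metric.closedBall_subset_closedBall (min_le_left _ _) hb))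
  have hderiv : ∀ b ∈ Metric.closedBall a η, ‖fderiv ℝ f b - fderiv ℝ f a‖ ≤ δ := fun b hb => by
    have hd : dist a b < η₂ := by
      rw [dist_comm]
      refine lt_of_le_of_lt (Metric.mem_closedBall.1 hb) ?_
      refine lt_of_le_of_lt (min_le_right _ _) (by linarith)
    have := hη₂' hd (mem_image_of_mem _ hs)
    rw [← dist_eq_norm, dist_comm]
    exact le_of_lt this
  have hmv := (convex_closedBall a η).norm_image_sub_le_of_norm_hasFDerivWithin_le'
    (f := f) (f' := fderiv ℝ f) (φ := fderiv ℝ f a) (C := δ) (x := a) (y := (p', s'))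
    (fun b hb => (hdiff b (hball b hb)).hasFDerivWithinAt) hderiv
    (Metric.mem_closedBall_self (by positivity))
    (by
      rw [Metric.mem_closedBall, ha, Prod.dist_eq, Real.dist_eq, Real.dist_eq]
      exact max_le hp' hs')
  have hlin : fderiv ℝ f a ((p', s') - a) = a₁ s * (p' - p) + a₂ s * (s' - s) := by
    rw [h1' s hs, h2' s hs]
    have : (p', s') - a = (p' - p) • ((1 : ℝ), (0 : ℝ)) + (s' - s) • ((0 : ℝ), (1 : ℝ)) := by
      ext <;> simp [ha]
    rw [this, map_add, map_smul, map_smul]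
    simp [ha, mul_comm]
  rw [hlin] at hmv
  have hnorm : ‖(p', s') - a‖ ≤ |p' - p| + |s' - s| := by
    rw [Prod.norm_def]
    exact max_le (le_add_of_nonneg_right (abs_nonneg _)) (le_add_of_nonneg_left (abs_nonneg _))
  rw [h0 s hs]
  calc |c p' s' - c p s - a₁ s * (p' - p) - a₂ s * (s' - s)|
      = ‖f (p', s') - c p s - (a₁ s * (p' - p) + a₂ s * (s' - s))‖ := by
        rw [Real.norm_eq_abs, ← sub_sub]
    _ ≤ δ * ‖(p', s') - a‖ := hmv
    _ ≤ δ * (|p' - p| + |s' - s|) := by gcongr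

section Expansion

variable {Ω : Type*} [MeasurableSpace Ω] {P : Measure Ω} {m : Measure ℝ} {X : ℕ → Ω → ℝ}

theorem BoundedInProb.abs {X : ℕ → Ω → ℝ} (h : BoundedInProb P X) :
    BoundedInProb P (fun n ω => |X n ω|) := by
  intro ε hε
  obtain ⟨M, hM, h1⟩ := h ε hε
  exact ⟨M, hM, by simpa only [abs_abs] using h1⟩

theorem bdd_mul_integrable {a q : ℝ → ℝ} (ha : Measurable a)
    (hb : ∃ M, ∀ s, |a s| ≤ M) (hq : Integrable q m) :
    Integrable (fun x => a (cdf m x) * q x) m := by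
  obtain ⟨M, hM⟩ := hb
  refine hq.bdd_mul (c := M) (ha.comp (measurable_cdf m)).aestronglyMeasurable ?_
  exact Eventually.of_forall fun x => hM _

variable [IsProbabilityMeasure P] [IsProbabilityMeasure m]

theorem boundedInProb_sqrt_mul_empCdf_sub (hX : ∀ n, HasLaw (X n) m P) (hind : iIndepFun X P)
    (z : ℝ) :
    BoundedInProb P (fun n ω => √(n : ℝ) * (empCdf (fun k => X k ω) n z - cdf m z)) := by
  have h := boundedInProb_normalized_sum hX hind (memLp_indicator_le (m := m) z)
  simp only [integral_indicator_le] at h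
  refine h.congr ?_
  filter_upwards [eventually_gt_atTop 0] with n hn
  refine Eventually.of_forall fun ω => ?_
  have hn' : (0 : ℝ) < n := by exact_mod_cast hn
  have hs : √(n : ℝ) ≠ 0 := (Real.sqrt_pos.2 hn').ne'
  simp only [Finset.sum_sub_distrib, Finset.sum_const, Finset.card_range, nsmul_eq_mul, empCdf]
  have h3 : (n : ℝ) = √(n : ℝ) * √(n : ℝ) := (Real.mul_self_sqrt hn'.le).symm
  generalize √(n : ℝ) = r at hs h3 ⊢
  rw [h3]
  field_simp

/-- Weighted deviation of the empirical distribution function, at `z` and at the sample points. -/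
def weightedDeviation (m : Measure ℝ) (q : ℝ → ℝ) (z : ℝ) (x : ℕ → ℝ) (n : ℕ) : ℝ :=
  |√(n : ℝ) * (empCdf x n z - cdf m z)| * ((1 / (n : ℝ)) * ∑ j ∈ Finset.range n, |q (x j)|)
    + (1 / (n : ℝ)) * ∑ j ∈ Finset.range n, |q (x j) * (√(n : ℝ)
      * (empCdf x n (x j) - cdf m (x j)))|

theorem boundedInProb_weightedDeviation (hX : ∀ n, HasLaw (X n) m P) (hind : iIndepFun X P)
    (z : ℝ) {q : ℝ → ℝ} (hqm : Measurable q) (hq : Integrable q m) :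
    BoundedInProb P (fun n ω => weightedDeviation m q z (fun k => X k ω) n) := by
  have h1 : BoundedInProb P (fun n ω => (1 / (n : ℝ)) * ∑ j ∈ Finset.range n, |q (X j ω)|) :=
    BoundedInProb.of_sub_negligible (a := ∫ x, |q x| ∂m)
      (negligibleInProb_mean_sub hX hind (f := fun x => |q x|) hq.abs)
  have h2 : BoundedInProb P (fun n ω => (1 / (n : ℝ)) * ∑ j ∈ Finset.range n, |q (X j ω) *
      (√(n : ℝ) * (empCdf (fun k => X k ω) n (X j ω) - cdf m (X j ω)))|) := by
    have hfin : ∫⁻ x, ‖q x‖ₑ ∂m ≠ ⊤ := (hasFiniteIntegral_iff_enorm.1 hq.2).ne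
    refine boundedInProb_of_lintegral_le (fun n => ?_) (B := 2 * ∫⁻ x, ‖q x‖ₑ ∂m)
      (ENNReal.mul_ne_top ENNReal.ofNat_ne_top hfin)
      (Eventually.of_forall fun n => lintegral_mean_weighted_empCdf_sub_le hX hind hqm n)
    refine (Finset.aemeasurable_fun_sum _ fun j _ => ?_).const_mul _
    have := (aemeasurable_weighted_empCdf_sub hX hqm n j).const_mul √(n : ℝ)
    refine AEMeasurable.congr (f := fun ω => |√(n : ℝ) * (q (X j ω) *
      (empCdf (fun k => X k ω) n (X j ω) - cdf m (X j ω)))|)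
      (continuous_abs.measurable.comp_aemeasurable this) (Eventually.of_forall fun ω => ?_)
    dsimp only
    rw [mul_left_comm]
  exact ((boundedInProb_sqrt_mul_empCdf_sub hX hind z).abs.mul h1).add h2

/-- Remainder of the first order expansion of `c(F_n(z), F_n(y)) q(y)`. -/
def taylorRem (m : Measure ℝ) (c : ℝ → ℝ → ℝ) (a₀ a₁ a₂ q : ℝ → ℝ) (z : ℝ) (x : ℕ → ℝ) (n : ℕ)
    (y : ℝ) : ℝ :=
  (c (empCdf x n z) (empCdf x n y) - a₀ (cdf m y) - a₁ (cdf m y) * (empCdf x n z - cdf m z)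
    - a₂ (cdf m y) * (empCdf x n y - cdf m y)) * q y

theorem abs_sum_taylorRem_le {m : Measure ℝ} {c : ℝ → ℝ → ℝ} {a₀ a₁ a₂ q : ℝ → ℝ} {z δ : ℝ}
    (hδ : 0 ≤ δ) {x : ℕ → ℝ} {n : ℕ} (hqz : ∀ x, z < x → q x = 0)
    (h : ∀ y, y ≤ z → |c (empCdf x n z) (empCdf x n y) - a₀ (cdf m y)
      - a₁ (cdf m y) * (empCdf x n z - cdf m z) - a₂ (cdf m y) * (empCdf x n y - cdf m y)|
      ≤ δ * (|empCdf x n z - cdf m z| + |empCdf x n y - cdf m y|)) :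
    |√(n : ℝ) * ((1 / (n : ℝ)) * ∑ j ∈ Finset.range n, taylorRem m c a₀ a₁ a₂ q z x n (x j))|
      ≤ δ * |weightedDeviation m q z x n| := by
  have hr : ∀ y, |taylorRem m c a₀ a₁ a₂ q z x n y| ≤ δ * (|empCdf x n z - cdf m z| * |q y|
        + |q y| * |empCdf x n y - cdf m y|) := fun y => by
    rcases le_or_gt y z with hy | hy
    · rw [taylorRem, abs_mul]
      calc _ ≤ δ * (|empCdf x n z - cdf m z| + |empCdf x n y - cdf m y|) * |q y| := by
            gcongr
            exact h y hy
        _ = _ := by ring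
    · simp [taylorRem, hqz _ hy]
  have hs : (0 : ℝ) ≤ √(n : ℝ) := Real.sqrt_nonneg _
  rw [abs_mul, abs_mul, abs_of_nonneg hs, abs_of_nonneg (by positivity : (0 : ℝ) ≤ 1 / n)]
  have hsum : |∑ j ∈ Finset.range n, taylorRem m c a₀ a₁ a₂ q z x n (x j)|
      ≤ δ * (|empCdf x n z - cdf m z| * ∑ j ∈ Finset.range n, |q (x j)|
        + ∑ j ∈ Finset.range n, |q (x j)| * |empCdf x n (x j) - cdf m (x j)|) := by
    refine (Finset.abs_sum_le_sum_abs _ _).trans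
      ((Finset.sum_le_sum fun j _ => hr (x j)).trans (le_of_eq ?_))
    rw [← Finset.mul_sum, Finset.sum_add_distrib, ← Finset.mul_sum]
  have hdev : weightedDeviation m q z x n = √(n : ℝ) * (1 / n *
      (|empCdf x n z - cdf m z| * ∑ j ∈ Finset.range n, |q (x j)|
        + ∑ j ∈ Finset.range n, |q (x j)| * |empCdf x n (x j) - cdf m (x j)|)) := by
    have : ∑ j ∈ Finset.range n, |q (x j) * (√(n : ℝ) * (empCdf x n (x j) - cdf m (x j)))|
        = √(n : ℝ) * ∑ j ∈ Finset.range n, |q (x j)| * |empCdf x n (x j) - cdf m (x j)| := by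
      rw [Finset.mul_sum]
      refine Finset.sum_congr rfl fun j _ => ?_
      rw [abs_mul, abs_mul, abs_of_nonneg hs]
      ring
    rw [weightedDeviation, this, abs_mul, abs_of_nonneg hs]
    ring
  calc _ ≤ √(n : ℝ) * (1 / n * (δ * (|empCdf x n z - cdf m z| * ∑ j ∈ Finset.range n, |q (x j)|
        + ∑ j ∈ Finset.range n, |q (x j)| * |empCdf x n (x j) - cdf m (x j)|))) := by gcongr
    _ = δ * weightedDeviation m q z x n := by rw [hdev]; ring
    _ ≤ _ := by gcongr; exact le_abs_self _

theorem negligibleInProb_taylorRem (hX : ∀ n, HasLaw (X n) m P) (hind : iIndepFun X P)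
    (hF : Continuous (cdf m)) {z : ℝ} {c : ℝ → ℝ → ℝ} {a₀ a₁ a₂ : ℝ → ℝ}
    (hc : WeightExpansion c (cdf m z) a₀ a₁ a₂) {q : ℝ → ℝ} (hqm : Measurable q)
    (hq : Integrable q m) (hqz : ∀ x, z < x → q x = 0) :
    NegligibleInProb P (fun n ω => √(n : ℝ) * ((1 / (n : ℝ)) * ∑ j ∈ Finset.range n,
      taylorRem m c a₀ a₁ a₂ q z (fun k => X k ω) n (X j ω))) := by
  refine negligibleInProb_of_forall_le_mul (boundedInProb_weightedDeviation hX hind z hqm hq)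
    fun δ hδ => ?_
  obtain ⟨η, hη, htay⟩ := hc.taylor δ hδ
  refine tendsto_of_tendsto_of_tendsto_of_le_of_le tendsto_const_nhds
    (tendsto_measure_exists_lt_abs_empCdf_sub hX hind hF hη) (fun _ => zero_le)
    fun n => measure_mono fun ω hω => ?_
  by_contra hcon
  simp only [mem_ofPred_eq, not_exists, not_lt] at hcon hω
  exact hω (abs_sum_taylorRem_le hδ.le hqz fun y hy =>
    htay (cdf m y) ⟨cdf_nonneg m _, monotone_cdf m hy⟩ _ _ (hcon z) (hcon y))

theorem sqrt_mul_weighted_mean_sub {m : Measure ℝ} {c : ℝ → ℝ → ℝ} {a₀ a₁ a₂ q : ℝ → ℝ} {z : ℝ}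
    (x : ℕ → ℝ) {n : ℕ} (hn : 0 < n) (J K : ℝ) :
    √(n : ℝ) * ((1 / (n : ℝ)) * ∑ j ∈ Finset.range n,
        c (empCdf x n z) (empCdf x n (x j)) * q (x j) - J)
      - (√(n : ℝ))⁻¹ * ∑ j ∈ Finset.range n,
        ((a₀ (cdf m (x j)) * q (x j) - J) + K * ((if x j ≤ z then (1 : ℝ) else 0) - cdf m z)
          + projKernel m (fun x => a₂ (cdf m x) * q x) (x j))
      = √(n : ℝ) * (empCdf x n z - cdf m z) * ((1 / (n : ℝ)) *
          ∑ j ∈ Finset.range n, a₁ (cdf m (x j)) * q (x j) - K)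
        + projError m (fun x => a₂ (cdf m x) * q x) x n
        + √(n : ℝ) * ((1 / (n : ℝ)) *
          ∑ j ∈ Finset.range n, taylorRem m c a₀ a₁ a₂ q z x n (x j)) := by
  have hn' : (0 : ℝ) < n := by exact_mod_cast hn
  have hs : √(n : ℝ) ≠ 0 := (Real.sqrt_pos.2 hn').ne'
  have hsplit : ∑ j ∈ Finset.range n, taylorRem m c a₀ a₁ a₂ q z x n (x j)
      = ∑ j ∈ Finset.range n, c (empCdf x n z) (empCdf x n (x j)) * q (x j)
        - ∑ j ∈ Finset.range n, a₀ (cdf m (x j)) * q (x j)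
        - (empCdf x n z - cdf m z) * ∑ j ∈ Finset.range n, a₁ (cdf m (x j)) * q (x j)
        - ∑ j ∈ Finset.range n, a₂ (cdf m (x j)) * q (x j)
          * (empCdf x n (x j) - cdf m (x j)) := by
    rw [Finset.mul_sum, ← Finset.sum_sub_distrib, ← Finset.sum_sub_distrib,
      ← Finset.sum_sub_distrib]
    exact Finset.sum_congr rfl fun j _ => by rw [taylorRem]; ring
  have hemp : ∑ j ∈ Finset.range n, ((if x j ≤ z then (1 : ℝ) else 0) - cdf m z)
      = n * (empCdf x n z - cdf m z) := by
    simp only [Finset.sum_sub_distrib, Finset.sum_const, Finset.card_range, nsmul_eq_mul, empCdf]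
    field_simp
  have hJ : ∑ j ∈ Finset.range n, (a₀ (cdf m (x j)) * q (x j) - J)
      = ∑ j ∈ Finset.range n, a₀ (cdf m (x j)) * q (x j) - n * J := by simp
  rw [hsplit, Finset.sum_add_distrib, Finset.sum_add_distrib, ← Finset.mul_sum, hemp, hJ]
  unfold projError
  generalize ∑ j ∈ Finset.range n, c (empCdf x n z) (empCdf x n (x j)) * q (x j) = s0
  generalize ∑ j ∈ Finset.range n, a₀ (cdf m (x j)) * q (x j) = s1
  generalize ∑ j ∈ Finset.range n, a₁ (cdf m (x j)) * q (x j) = s2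
  generalize ∑ j ∈ Finset.range n, a₂ (cdf m (x j)) * q (x j)
          * (empCdf x n (x j) - cdf m (x j)) = s3
  generalize ∑ j ∈ Finset.range n, projKernel m (fun x => a₂ (cdf m x) * q x) (x j) = s4
  generalize empCdf x n z = e
  generalize cdf m z = p
  have h3 : (n : ℝ) = √(n : ℝ) * √(n : ℝ) := (Real.mul_self_sqrt hn'.le).symm
  generalize √(n : ℝ) = r at hs h3 ⊢
  rw [h3]
  field_simp
  ring

/-- Asymptotic linearity of `n⁻¹ ∑ c(F_n(z), F_n(X_j)) q(X_j)`. -/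
theorem negligibleInProb_weighted_mean_sub (hX : ∀ n, HasLaw (X n) m P) (hind : iIndepFun X P)
    (hF : Continuous (cdf m)) {z : ℝ} {c : ℝ → ℝ → ℝ} {a₀ a₁ a₂ : ℝ → ℝ}
    (hc : WeightExpansion c (cdf m z) a₀ a₁ a₂) {q : ℝ → ℝ} (hqm : Measurable q)
    (hq : Integrable q m) (hqz : ∀ x, z < x → q x = 0) :
    NegligibleInProb P (fun n ω =>
      √(n : ℝ) * ((1 / (n : ℝ)) * ∑ j ∈ Finset.range n,
        c (empCdf (fun k => X k ω) n z) (empCdf (fun k => X k ω) n (X j ω)) * q (X j ω)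
          - ∫ x, a₀ (cdf m x) * q x ∂m)
      - (√(n : ℝ))⁻¹ * ∑ j ∈ Finset.range n,
        ((a₀ (cdf m (X j ω)) * q (X j ω) - ∫ x, a₀ (cdf m x) * q x ∂m)
          + (∫ x, a₁ (cdf m x) * q x ∂m) * ((if X j ω ≤ z then (1 : ℝ) else 0) - cdf m z)
          + projKernel m (fun x => a₂ (cdf m x) * q x) (X j ω))) := by
  have : NullSingletonClass m := nullSingletonClass_of_continuous_cdf hF
  have hi1 := bdd_mul_integrable (m := m) hc.measurable_fst hc.bounded_fst hq
  have hi2 := bdd_mul_integrable (m := m) hc.measurable_snd hc.bounded_snd hq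
  have hA := (boundedInProb_sqrt_mul_empCdf_sub hX hind z).mul_negligible
    (negligibleInProb_mean_sub hX hind hi1)
  have hB := negligibleInProb_projError hX hind
    ((hc.measurable_snd.comp (measurable_cdf m)).mul hqm) hi2
  refine ((hA.add hB).add (negligibleInProb_taylorRem hX hind hF hc hqm hq hqz)).congr ?_
  filter_upwards [eventually_gt_atTop 0] with n hn
  exact Eventually.of_forall fun ω => sqrt_mul_weighted_mean_sub (fun k => X k ω) hn _ _

end Expansion

/-! ### Quantile functions and copulas -/

section Quantile

variable {m : Measure ℝ}

/-- Generalized inverse of the distribution function of `m`. -/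
def quantile (m : Measure ℝ) (s : ℝ) : ℝ := sInf {x : ℝ | s ≤ cdf m x}

theorem quantile_le_iff (hF : Continuous (cdf m)) {s : ℝ} (hs : s ∈ Ioo (0 : ℝ) 1) (x : ℝ) :
    quantile m s ≤ x ↔ s ≤ cdf m x := by
  have hbdd : BddBelow {x : ℝ | s ≤ cdf m x} := by
    obtain ⟨a, ha⟩ := ((tendsto_cdf_atBot m).eventually_lt_const hs.1).exists
    exact ⟨a, fun y hy => le_of_lt ((monotone_cdf m).reflect_lt (lt_of_lt_of_le ha hy))⟩
  have hne : {x : ℝ | s ≤ cdf m x}.Nonempty := by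
    obtain ⟨b, hb⟩ := ((tendsto_cdf_atTop m).eventually_const_lt hs.2).exists
    exact ⟨b, hb.le⟩
  have hcl : IsClosed {x : ℝ | s ≤ cdf m x} := isClosed_le continuous_const hF
  constructor
  · intro h
    exact le_trans (hcl.csInf_mem hne hbdd : s ≤ cdf m (quantile m s)) (monotone_cdf m h)
  · intro h
    exact csInf_le hbdd h

theorem cdf_quantile (hF : Continuous (cdf m)) {s : ℝ} (hs : s ∈ Ioo (0 : ℝ) 1) :
    cdf m (quantile m s) = s := by
  refine le_antisymm ?_ ((quantile_le_iff hF hs _).1 le_rfl)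
  obtain ⟨t, ht⟩ := exists_cdf_eq hF hs.1 hs.2
  rw [← ht]
  exact monotone_cdf m (by rw [ht]; exact (quantile_le_iff hF hs t).2 ht.ge)

theorem quantile_le_quantile_iff (hF : Continuous (cdf m)) {s t : ℝ} (hs : s ∈ Ioo (0 : ℝ) 1)
    (ht : t ∈ Ioo (0 : ℝ) 1) : quantile m s ≤ quantile m t ↔ s ≤ t := by
  rw [quantile_le_iff hF hs, cdf_quantile hF ht]

theorem aemeasurable_quantile (hF : Continuous (cdf m)) :
    AEMeasurable (quantile m) ((volume : Measure ℝ).restrict (Ioo 0 1)) :=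
  aemeasurable_restrict_of_monotoneOn measurableSet_Ioo
    fun _ hs _ ht hst => (quantile_le_quantile_iff hF hs ht).2 hst

theorem ae_restrict_Ioo_of_forall {p : ℝ → Prop} (h : ∀ s ∈ Ioo (0 : ℝ) 1, p s) :
    ∀ᵐ s ∂((volume : Measure ℝ).restrict (Ioo 0 1)), p s :=
  (ae_restrict_iff' measurableSet_Ioo).2 (Eventually.of_forall h)

theorem hasLaw_quantile [IsProbabilityMeasure m] (hF : Continuous (cdf m)) :
    HasLaw (quantile m) m ((volume : Measure ℝ).restrict (Ioo 0 1)) := by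
  refine ⟨aemeasurable_quantile hF, ?_⟩
  have : IsFiniteMeasure (((volume : Measure ℝ).restrict (Ioo 0 1)).map (quantile m)) :=
    Measure.isFiniteMeasure_map _ _
  refine Measure.ext_of_Iic _ _ fun x => ?_
  rw [Measure.map_apply_of_aemeasurable (aemeasurable_quantile hF) measurableSet_Iic]
  have h1 : ((volume : Measure ℝ).restrict (Ioo 0 1)) (quantile m ⁻¹' Iic x)
      = ((volume : Measure ℝ).restrict (Ioo 0 1)) (Iic (cdf m x)) := by
    refine measure_congr (eventuallyEq_set.2 ?_)
    exact ae_restrict_Ioo_of_forall fun s hs => quantile_le_iff hF hs x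
  rw [h1, ← ofReal_cdf m, Measure.restrict_apply measurableSet_Iic]
  rw [measure_congr (ae_eq_set_inter (ae_eq_refl (Iic (cdf m x))) Ioo_ae_eq_Ioc)]
  have h2 : Iic (cdf m x) ∩ Ioc 0 1 = Ioc 0 (cdf m x) := by
    ext s
    simp only [mem_inter_iff, mem_Iic, mem_Ioc]
    exact ⟨fun h => ⟨h.2.1, h.1⟩, fun h => ⟨h.2, h.1, h.2.trans (cdf_le_one m x)⟩⟩
  rw [h2, Real.volume_Ioc, sub_zero]

theorem intervalIntegral_eq_restrict_Ioo (f : ℝ → ℝ) :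
    ∫ s in (0 : ℝ)..1, f s = ∫ s, f s ∂((volume : Measure ℝ).restrict (Ioo 0 1)) := by
  rw [intervalIntegral.integral_of_le zero_le_one, integral_Ioc_eq_integral_Ioo]

theorem integral_quantile [IsProbabilityMeasure m] (hF : Continuous (cdf m)) {f : ℝ → ℝ}
    (hf : AEStronglyMeasurable f m) : ∫ s in (0 : ℝ)..1, f (quantile m s) = ∫ x, f x ∂m := by
  rw [intervalIntegral_eq_restrict_Ioo]
  exact (hasLaw_quantile hF).integral_comp hf

theorem integrable_quantile [IsProbabilityMeasure m] (hF : Continuous (cdf m)) {f : ℝ → ℝ}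
    (hf : Integrable f m) :
    Integrable (fun s => f (quantile m s)) ((volume : Measure ℝ).restrict (Ioo 0 1)) :=
  ((hasLaw_quantile hF).map_eq ▸ hf).comp_aemeasurable (aemeasurable_quantile hF)

/-- The projection kernel in terms of uniform variables. -/
theorem projKernel_quantile [IsProbabilityMeasure m] (hF : Continuous (cdf m)) {h : ℝ → ℝ}
    (hm : Measurable h) {v : ℝ} (hv : v ∈ Ioo (0 : ℝ) 1) :
    projKernel m h (quantile m v)
      = ∫ s in (0 : ℝ)..1, h (quantile m s) * ((Ioo 0 s).indicator (fun _ => (1 : ℝ)) v - s) := by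
  have hmeas : AEStronglyMeasurable
      (fun x => h x * ((if quantile m v ≤ x then (1 : ℝ) else 0) - cdf m x)) m :=
    (hm.mul ((measurable_le_indicator.comp (measurable_const.prodMk measurable_id)).sub
      (measurable_cdf m))).aestronglyMeasurable
  unfold projKernel
  rw [← integral_quantile hF hmeas, intervalIntegral_eq_restrict_Ioo,
    intervalIntegral_eq_restrict_Ioo]
  refine integral_congr_ae ?_
  have hne : ∀ᵐ s ∂((volume : Measure ℝ).restrict (Ioo 0 1)), s ≠ v :=
    ae_restrict_of_ae (by simp [ae_iff])
  filter_upwards [hne, ae_restrict_Ioo_of_forall (p := fun s => s ∈ Ioo (0 : ℝ) 1) fun s hs => hs]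
    with s hsv hs
  simp only [quantile_le_quantile_iff hF hv hs, cdf_quantile hF hs, indicator, mem_Ioo, hv.1,
    true_and, (Ne.symm hsv).le_iff_lt]

end Quantile

section Copula

variable {ρ C : Measure (Fin 2 → ℝ)}

instance instIsProbabilityMeasureMargin [IsProbabilityMeasure ρ] (i : Fin 2) :
    IsProbabilityMeasure (margin ρ i) :=
  Measure.isProbabilityMeasure_map (measurable_pi_apply i).aemeasurable

theorem IsCopulaOf.isProbabilityMeasure (hC : IsCopulaOf C ρ) : IsProbabilityMeasure C := by
  have h := hC.uniform_margin 0
  refine ⟨?_⟩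
  have h2 : C.map (fun u => u 0) univ = 1 := by rw [h]; simp
  rwa [Measure.map_apply (measurable_pi_apply 0) MeasurableSet.univ, preimage_univ] at h2

theorem IsCopulaOf.hasLaw_eval (hC : IsCopulaOf C ρ) (i : Fin 2) :
    HasLaw (fun u : Fin 2 → ℝ => u i) ((volume : Measure ℝ).restrict (Ioo 0 1)) C :=
  ⟨(measurable_pi_apply i).aemeasurable, by
    rw [hC.uniform_margin i, Measure.restrict_congr_set Ioo_ae_eq_Icc]⟩

theorem IsCopulaOf.ae_mem_Ioo (hC : IsCopulaOf C ρ) :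
    ∀ᵐ u ∂C, ∀ i, u i ∈ Ioo (0 : ℝ) 1 := by
  rw [ae_all_iff]
  intro i
  have := (hC.hasLaw_eval i).ae_iff (p := fun s => s ∈ Ioo (0 : ℝ) 1)
    (measurableSet_setOfPred.1 measurableSet_Ioo)
  exact this.2 (ae_restrict_Ioo_of_forall fun s hs => hs)

theorem ext_of_Iic_pi {μ ν : Measure (Fin 2 → ℝ)} [IsProbabilityMeasure μ] [IsProbabilityMeasure ν]
    (h : ∀ x : Fin 2 → ℝ, μ {y | ∀ i, y i ≤ x i} = ν {y | ∀ i, y i ≤ x i}) : μ = ν := by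
  have hgen : (inferInstance : MeasurableSpace (Fin 2 → ℝ)) = MeasurableSpace.generateFrom
      (pi univ '' pi univ fun _ : Fin 2 => range (Iic : ℝ → Set ℝ)) := by
    rw [generateFrom_eq_pi (C := fun _ : Fin 2 => range (Iic : ℝ → Set ℝ))]
    · exact fun _ => (borel_eq_generateFrom_Iic ℝ).symm.trans (BorelSpace.measurable_eq).symm
    · intro i
      refine ⟨fun n : ℕ => Iic (n : ℝ), fun n => mem_range_self _, ?_⟩
      rw [eq_univ_iff_forall]
      intro x
      obtain ⟨n, hn⟩ := exists_nat_ge x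
      exact mem_iUnion.2 ⟨n, hn⟩
  refine ext_of_generate_finite _ hgen (IsPiSystem.pi fun _ => isPiSystem_Iic) ?_ (by simp)
  rintro s ⟨t, ht, rfl⟩
  choose x hx using fun i => ht i (mem_univ i)
  have : pi univ t = {y : Fin 2 → ℝ | ∀ i, y i ≤ x i} := by
    ext y
    simp only [mem_univ_pi, mem_ofPred_eq]
    exact forall_congr' fun i => by rw [← hx i]; rfl
  rw [this]
  exact h x

theorem aemeasurable_ell (hC : IsCopulaOf C ρ) (hcont : ∀ i, Continuous (F ρ i)) (i : Fin 2) :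
    AEMeasurable (fun u : Fin 2 → ℝ => ell ρ i (u i)) C :=
  ((hC.hasLaw_eval i).map_eq ▸ aemeasurable_quantile (m := margin ρ i)
    (hcont i)).comp_aemeasurable (measurable_pi_apply i).aemeasurable

/-- **Sklar's theorem**: the quantile transform of the copula has law `ρ`. -/
theorem IsCopulaOf.hasLaw_ell [IsProbabilityMeasure ρ] (hC : IsCopulaOf C ρ)
    (hcont : ∀ i, Continuous (F ρ i)) :
    HasLaw (fun (u : Fin 2 → ℝ) i => ell ρ i (u i)) ρ C := by
  have hm : AEMeasurable (fun (u : Fin 2 → ℝ) i => ell ρ i (u i)) C := by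
    rw [aemeasurable_pi_iff]
    exact fun i => aemeasurable_ell hC hcont i
  refine ⟨hm, ?_⟩
  have := hC.isProbabilityMeasure
  have : IsProbabilityMeasure (C.map (fun (u : Fin 2 → ℝ) i => ell ρ i (u i))) :=
    Measure.isProbabilityMeasure_map hm
  refine ext_of_Iic_pi fun x => ?_
  have hms : MeasurableSet {y : Fin 2 → ℝ | ∀ i, y i ≤ x i} := by
    rw [show {y : Fin 2 → ℝ | ∀ i, y i ≤ x i} = Iic x by ext; simp [Pi.le_def]]
    exact measurableSet_Iic
  rw [Measure.map_apply_of_aemeasurable hm hms, ← hC.sklar x]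
  refine measure_congr (eventuallyEq_set.2 ?_)
  filter_upwards [hC.ae_mem_Ioo] with u hu
  exact forall_congr' fun i => quantile_le_iff (m := margin ρ i) (hcont i) (hu i) (x i)

end Copula

/-! ### Asymptotic linearity of the empirical indices at one period -/

/-- Influence function of the poverty index, up to a constant. -/
def inflGpi (S : PovertySpec) (c : Fin 2 → ℝ → ℝ → ℝ) (Z : Fin 2 → ℝ) (ρ : Measure (Fin 2 → ℝ))
    (i : Fin 2) (x : ℝ) : ℝ :=
  g S c Z ρ i x + projKernel (margin ρ i)
    (fun x => deriv (fun t => c i (F ρ i (Z i)) t) (F ρ i x) * q S Z i x) x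

/-- Influence function of the Gini index, up to a constant. -/
def inflGini (ρ : Measure (Fin 2 → ℝ)) (i : Fin 2) (x : ℝ) : ℝ :=
  2 / mean ρ i * (x * F ρ i x) + projKernel (margin ρ i) (fun x => 2 / mean ρ i * x) x
    - 2 * (giniA ρ i / mean ρ i ^ 2) * x

theorem measurable_q {S : PovertySpec} (hd : Measurable S.d) (Z : Fin 2 → ℝ) (i : Fin 2) :
    Measurable (q S Z i) := by
  unfold q
  exact (hd.comp (by fun_prop)).indicator measurableSet_Iic

theorem q_eq_zero {S : PovertySpec} {Z : Fin 2 → ℝ} {i : Fin 2} {x : ℝ} (hx : Z i < x) :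
    q S Z i x = 0 := indicator_of_notMem (by simpa using hx) _

section Coord

variable {Ω : Type*} [MeasurableSpace Ω] {P : Measure Ω}
  {ρ : Measure (Fin 2 → ℝ)} {Y : ℕ → Ω → Fin 2 → ℝ}

theorem hasLaw_coord (hlaw : ∀ n, HasLaw (Y n) ρ P) (i : Fin 2) (n : ℕ) :
    HasLaw (fun ω => Y n ω i) (margin ρ i) P :=
  HasLaw.fun_comp (Y := fun y : Fin 2 → ℝ => y i)
    ⟨(measurable_pi_apply i).aemeasurable, rfl⟩ (hlaw n)

theorem iIndepFun_coord (hindep : iIndepFun Y P) (i : Fin 2) :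
    iIndepFun (fun n ω => Y n ω i) P :=
  hindep.comp (fun _ y => y i) fun _ => measurable_pi_apply i

theorem aemeasurable_poorN (hlaw : ∀ n, HasLaw (Y n) ρ P) (z : ℝ) (i : Fin 2) (n : ℕ) :
    AEMeasurable (fun ω => poorN z (fun j => Y j ω) i n) P := by
  simp only [poorN, Finset.card_filter]
  refine Finset.aemeasurable_fun_sum _ fun k _ => ?_
  have : Measurable (fun x : ℝ => if x ≤ z then 1 else 0 : ℝ → ℕ) :=
    Measurable.ite measurableSet_Iic measurable_const measurable_const
  exact this.comp_aemeasurable (hasLaw_coord hlaw i k).aemeasurable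

theorem aemeasurable_rankN (hlaw : ∀ n, HasLaw (Y n) ρ P) (i : Fin 2) (n j : ℕ) :
    AEMeasurable (fun ω => rankN (fun j => Y j ω i) n j) P := by
  simp only [rankN, Finset.card_filter]
  refine Finset.aemeasurable_fun_sum _ fun k _ => ?_
  have : Measurable (fun a : ℝ × ℝ => if a.1 ≤ a.2 then 1 else 0 : ℝ × ℝ → ℕ) :=
    Measurable.ite (measurableSet_le measurable_fst measurable_snd) measurable_const
      measurable_const
  exact this.comp_aemeasurable
    ((hasLaw_coord hlaw i k).aemeasurable.prodMk (hasLaw_coord hlaw i j).aemeasurable)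

end Coord

section Weights

variable {S : PovertySpec} {Z : Fin 2 → ℝ} {c : Fin 2 → ℝ → ℝ → ℝ} {ρ : Measure (Fin 2 → ℝ)}
  {i : Fin 2} {a₀ a₁ a₂ : ℝ → ℝ}

theorem WeightExpansion.value_mul_q (hW : WeightExpansion (c i) (F ρ i (Z i)) a₀ a₁ a₂) (x : ℝ) :
    c i (F ρ i (Z i)) (F ρ i x) * q S Z i x = a₀ (F ρ i x) * q S Z i x := by
  rcases le_or_gt x (Z i) with h | h
  · rw [hW.value_eq (F ρ i x) ⟨cdf_nonneg _ _, monotone_cdf _ h⟩]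
  · rw [q_eq_zero h, mul_zero, mul_zero]

theorem WeightExpansion.deriv_snd_mul_q (hW : WeightExpansion (c i) (F ρ i (Z i)) a₀ a₁ a₂)
    (x : ℝ) : deriv (fun t => c i (F ρ i (Z i)) t) (F ρ i x) * q S Z i x
      = a₂ (F ρ i x) * q S Z i x := by
  rcases le_or_gt x (Z i) with h | h
  · rw [hW.deriv_snd_eq (F ρ i x) ⟨cdf_nonneg _ _, monotone_cdf _ h⟩]
  · rw [q_eq_zero h, mul_zero, mul_zero]

theorem WeightExpansion.gpi_eq (hW : WeightExpansion (c i) (F ρ i (Z i)) a₀ a₁ a₂)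
    (hpos : ∀ᵐ x ∂(margin ρ i), 0 < x) :
    gpi S c Z ρ i = ∫ x, a₀ (cdf (margin ρ i) x) * q S Z i x ∂(margin ρ i) := by
  unfold gpi
  rw [← integral_indicator measurableSet_Ioc]
  refine integral_congr_ae ?_
  filter_upwards [hpos] with x hx
  change _ = a₀ (F ρ i x) * q S Z i x
  rw [← hW.value_mul_q]
  by_cases h : x ≤ Z i
  · rw [indicator_of_mem (show x ∈ Ioc 0 (Z i) from ⟨hx, h⟩), q, indicator_of_mem (by simpa using h)]
  · rw [indicator_of_notMem (fun hm => h hm.2), q_eq_zero (not_le.1 h), mul_zero]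

theorem WeightExpansion.g_eq (hW : WeightExpansion (c i) (F ρ i (Z i)) a₀ a₁ a₂) (x : ℝ) :
    g S c Z ρ i x = a₀ (cdf (margin ρ i) x) * q S Z i x
      + K S c Z ρ i * (if x ≤ Z i then (1 : ℝ) else 0) := by
  unfold g
  rw [hW.value_mul_q]
  simp only [indicator, mem_Iic, mul_ite, mul_one, mul_zero]
  rfl

/-- The weight `ν̃(x) = ∂_s c(p, F(x)) q(x)`, so that `ν(s) = ν̃(ℓ(s))`. -/
def nuIncome (S : PovertySpec) (c : Fin 2 → ℝ → ℝ → ℝ) (Z : Fin 2 → ℝ) (ρ : Measure (Fin 2 → ℝ))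
    (i : Fin 2) (x : ℝ) : ℝ :=
  deriv (fun t => c i (F ρ i (Z i)) t) (F ρ i x) * q S Z i x

theorem WeightExpansion.nuIncome_eq (hW : WeightExpansion (c i) (F ρ i (Z i)) a₀ a₁ a₂) :
    nuIncome S c Z ρ i = fun x => a₂ (cdf (margin ρ i) x) * q S Z i x :=
  funext fun x => hW.deriv_snd_mul_q x

theorem WeightExpansion.measurable_nuIncome (hW : WeightExpansion (c i) (F ρ i (Z i)) a₀ a₁ a₂)
    (hd : Measurable S.d) : Measurable (nuIncome S c Z ρ i) := by
  rw [hW.nuIncome_eq]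
  exact (hW.measurable_snd.comp (measurable_cdf _)).mul (measurable_q hd Z i)

theorem WeightExpansion.integrable_nuIncome (hW : WeightExpansion (c i) (F ρ i (Z i)) a₀ a₁ a₂)
    (hq : Integrable (q S Z i) (margin ρ i)) :
    Integrable (nuIncome S c Z ρ i) (margin ρ i) := by
  rw [hW.nuIncome_eq]
  exact bdd_mul_integrable hW.measurable_snd hW.bounded_snd hq

theorem WeightExpansion.inflGpi_eq (hW : WeightExpansion (c i) (F ρ i (Z i)) a₀ a₁ a₂) (x : ℝ) :
    inflGpi S c Z ρ i x = g S c Z ρ i x + projKernel (margin ρ i)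
      (fun x => a₂ (cdf (margin ρ i) x) * q S Z i x) x := by
  unfold inflGpi
  congr 2
  exact hW.nuIncome_eq

variable [IsProbabilityMeasure ρ]

theorem WeightExpansion.K_eq (hW : WeightExpansion (c i) (F ρ i (Z i)) a₀ a₁ a₂)
    (hcont : Continuous (F ρ i)) (hd : Measurable S.d) :
    K S c Z ρ i = ∫ x, a₁ (cdf (margin ρ i) x) * q S Z i x ∂(margin ρ i) := by
  rw [← integral_quantile hcont
    (f := fun x => a₁ (cdf (margin ρ i) x) * q S Z i x) (((hW.measurable_fst.comp (measurable_cdf _)).mul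
    (measurable_q hd Z i)).aestronglyMeasurable)]
  unfold K
  rw [intervalIntegral_eq_restrict_Ioo, intervalIntegral_eq_restrict_Ioo]
  refine integral_congr_ae (ae_restrict_Ioo_of_forall fun s hs => ?_)
  change deriv (fun p => c i p s) (F ρ i (Z i)) * q S Z i (quantile (margin ρ i) s) = _
  beta_reduce
  rw [cdf_quantile hcont hs]
  rcases le_or_gt (quantile (margin ρ i) s) (Z i) with h | h
  · rw [hW.deriv_fst_eq s ⟨hs.1.le, (quantile_le_iff hcont hs _).1 h⟩]
  · rw [q_eq_zero h, mul_zero, mul_zero]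

theorem WeightExpansion.integrable_g (hW : WeightExpansion (c i) (F ρ i (Z i)) a₀ a₁ a₂)
    (hq : Integrable (q S Z i) (margin ρ i)) : Integrable (g S c Z ρ i) (margin ρ i) := by
  refine Integrable.congr ((bdd_mul_integrable hW.measurable_value hW.bounded_value hq).add
    (((memLp_indicator_le (m := margin ρ i) (Z i)).integrable (by norm_num)).const_mul
      (K S c Z ρ i))) (Eventually.of_forall fun x => ?_)
  rw [hW.g_eq]
  rfl

theorem WeightExpansion.integral_g (hW : WeightExpansion (c i) (F ρ i (Z i)) a₀ a₁ a₂)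
    (hq : Integrable (q S Z i) (margin ρ i)) (hpos : ∀ᵐ x ∂(margin ρ i), 0 < x) :
    ∫ x, g S c Z ρ i x ∂(margin ρ i) = gpi S c Z ρ i + K S c Z ρ i * F ρ i (Z i) := by
  simp only [hW.g_eq]
  rw [integral_add (bdd_mul_integrable hW.measurable_value hW.bounded_value hq)
    (((memLp_indicator_le (m := margin ρ i) (Z i)).integrable (by norm_num)).const_mul
      (K S c Z ρ i)), integral_const_mul, integral_indicator_le, hW.gpi_eq hpos]
  rfl

theorem WeightExpansion.integrable_inflGpi (hW : WeightExpansion (c i) (F ρ i (Z i)) a₀ a₁ a₂)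
    (hd : Measurable S.d) (hq : Integrable (q S Z i) (margin ρ i)) :
    Integrable (inflGpi S c Z ρ i) (margin ρ i) :=
  (hW.integrable_g hq).add ((memLp_projKernel (hW.measurable_nuIncome hd)
    (hW.integrable_nuIncome hq)).integrable (by norm_num))

theorem WeightExpansion.integral_inflGpi (hW : WeightExpansion (c i) (F ρ i (Z i)) a₀ a₁ a₂)
    (hd : Measurable S.d) (hq : Integrable (q S Z i) (margin ρ i))
    (hpos : ∀ᵐ x ∂(margin ρ i), 0 < x) :
    ∫ x, inflGpi S c Z ρ i x ∂(margin ρ i) = gpi S c Z ρ i + K S c Z ρ i * F ρ i (Z i) := by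
  have h := integral_add (hW.integrable_g hq) ((memLp_projKernel (hW.measurable_nuIncome hd)
    (hW.integrable_nuIncome hq)).integrable (by norm_num))
  rw [integral_projKernel (hW.integrable_nuIncome hq), hW.integral_g hq hpos, add_zero] at h
  exact h

theorem abs_weight_sub_le (S : PovertySpec) (c : ℝ → ℝ → ℝ) (z : ℝ) (n Q : ℕ) {r : ℕ}
    (hr : 0 < r) (hrQ : r ≤ Q) :
    |S.A Q n z * S.w (S.mu₁ * n + S.mu₂ * Q - S.mu₃ * r + S.mu₄) / S.B Q
      - c ((Q : ℝ) / n) ((r : ℝ) / n)| ≤ weightGap S c z n Q := by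
  have h := le_ciSup (f := fun k : Fin Q =>
    |S.A Q n z * S.w (S.mu₁ * n + S.mu₂ * Q - S.mu₃ * ((k : ℕ) + 1) + S.mu₄) / S.B Q
      - c ((Q : ℝ) / n) ((((k : ℕ) + 1 : ℕ) : ℝ) / n)|) (Set.finite_range _).bddAbove
    ⟨r - 1, by omega⟩
  have hcast : r - 1 + 1 = r := Nat.sub_add_cancel hr
  simp only [← Nat.cast_add_one, hcast] at h
  unfold weightGap
  simpa only [← Nat.cast_add_one] using h

end Weights

section Gpi

variable {Ω : Type*} [MeasurableSpace Ω] {P : Measure Ω} [IsProbabilityMeasure P]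
  {ρ : Measure (Fin 2 → ℝ)} [IsProbabilityMeasure ρ] {Y : ℕ → Ω → Fin 2 → ℝ}
  {S : PovertySpec} {Z : Fin 2 → ℝ} {c : Fin 2 → ℝ → ℝ → ℝ} {i : Fin 2}

theorem ae_injective_coord (hlaw : ∀ n, HasLaw (Y n) ρ P) (hindep : iIndepFun Y P)
    (hcont : Continuous (F ρ i)) : ∀ᵐ ω ∂P, Function.Injective fun j => Y j ω i := by
  have : NullSingletonClass (margin ρ i) := nullSingletonClass_of_continuous_cdf hcont
  filter_upwards [ae_ne_of_indep (hasLaw_coord hlaw i) (iIndepFun_coord hindep i)] with ω hω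
  exact fun j k h => hω j k h

theorem abs_gpiN_sub_le (y : ℕ → Fin 2 → ℝ) (hy : Function.Injective fun j => y j i) (n : ℕ) :
    |gpiN S (Z i) y i n - (1 / (n : ℝ)) * ∑ j ∈ Finset.range n,
      c i (empCdf (fun k => y k i) n (Z i)) (empCdf (fun k => y k i) n (y j i)) * q S Z i (y j i)|
    ≤ weightGap S (c i) (Z i) n (poorN (Z i) y i n)
      * ((1 / (n : ℝ)) * ∑ j ∈ Finset.range n, |q S Z i (y j i)|) := by
  rw [gpiN_eq S (Z i) y i hy n, ← mul_sub, ← Finset.sum_sub_distrib, abs_mul,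
    abs_of_nonneg (by positivity : (0 : ℝ) ≤ 1 / n), mul_left_comm]
  refine mul_le_mul_of_nonneg_left ?_ (by positivity)
  rw [Finset.mul_sum]
  refine (Finset.abs_sum_le_sum_abs _ _).trans (Finset.sum_le_sum fun j hj => ?_)
  change |_ * q S Z i (y j i) - _| ≤ _
  rw [← sub_mul, abs_mul]
  rcases le_or_gt (y j i) (Z i) with h | h
  · refine mul_le_mul_of_nonneg_right ?_ (abs_nonneg _)
    rw [← poorN_div_eq_empCdf, ← rankN_div_eq_empCdf (fun k => y k i) n j]
    exact abs_weight_sub_le S (c i) (Z i) n _ (rankN_pos _ (Finset.mem_range.1 hj))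
      (rankN_le_poorN _ y i n j h)
  · simp [q_eq_zero h]

/-- Asymptotic linearity of the General Poverty Index. -/
theorem negligibleInProb_gpiN (hlaw : ∀ n, HasLaw (Y n) ρ P) (hindep : iIndepFun Y P)
    (hpos : ∀ᵐ x ∂(margin ρ i), 0 < x) (hcont : Continuous (F ρ i)) (hd : Measurable S.d)
    (hc : SmoothWeight (c i) (F ρ i (Z i)))
    (hw : TendstoInMeasure P
      (fun (n : ℕ) ω => √(n : ℝ) * weightGap S (c i) (Z i) n (poorN (Z i) (fun j => Y j ω) i n))
      atTop (fun _ => 0))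
    (hq : Integrable (q S Z i) (margin ρ i)) :
    NegligibleInProb P (fun n ω =>
      √(n : ℝ) * (gpiN S (Z i) (fun j => Y j ω) i n - gpi S c Z ρ i)
        - (√(n : ℝ))⁻¹ * ∑ j ∈ Finset.range n,
          (inflGpi S c Z ρ i (Y j ω i) - ∫ x, inflGpi S c Z ρ i x ∂(margin ρ i))) := by
  obtain ⟨a₀, a₁, a₂, hW⟩ := hc.exists_expansion (cdf_nonneg (margin ρ i) (Z i))
  have hX := hasLaw_coord hlaw i
  have hind := iIndepFun_coord hindep i
  have hmain := negligibleInProb_weighted_mean_sub hX hind hcont hW (measurable_q hd Z i) hq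
    fun x hx => q_eq_zero hx
  have hmean : BoundedInProb P
      (fun n ω => (1 / (n : ℝ)) * ∑ j ∈ Finset.range n, |q S Z i (Y j ω i)|) :=
    BoundedInProb.of_sub_negligible (a := ∫ x, |q S Z i x| ∂(margin ρ i))
      (negligibleInProb_mean_sub hX hind (f := fun x => |q S Z i x|) hq.abs)
  have hgap := hmean.mul_negligible (negligibleInProb_iff_tendstoInMeasure.2 hw)
  have hdiff : NegligibleInProb P (fun n ω => √(n : ℝ) * (gpiN S (Z i) (fun j => Y j ω) i n
      - (1 / (n : ℝ)) * ∑ j ∈ Finset.range n, c i (empCdf (fun k => Y k ω i) n (Z i))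
        (empCdf (fun k => Y k ω i) n (Y j ω i)) * q S Z i (Y j ω i))) := by
    refine hgap.of_ae_le (Eventually.of_forall fun n => ?_)
    filter_upwards [ae_injective_coord hlaw hindep hcont] with ω hω
    have h := abs_gpiN_sub_le (S := S) (Z := Z) (c := c) (fun j => Y j ω) hω n
    rw [abs_mul, abs_of_nonneg (Real.sqrt_nonneg _)]
    calc _ ≤ √(n : ℝ) * (weightGap S (c i) (Z i) n (poorN (Z i) (fun j => Y j ω) i n)
          * ((1 / (n : ℝ)) * ∑ j ∈ Finset.range n, |q S Z i (Y j ω i)|)) := by gcongr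
      _ = (1 / (n : ℝ)) * (∑ j ∈ Finset.range n, |q S Z i (Y j ω i)|) *
          (√(n : ℝ) * weightGap S (c i) (Z i) n (poorN (Z i) (fun j => Y j ω) i n)) := by ring
      _ ≤ _ := le_abs_self _
  refine (hdiff.add hmain).congr (Eventually.of_forall fun n => Eventually.of_forall fun ω => ?_)
  have hinfl : ∀ x, inflGpi S c Z ρ i x - ∫ x, inflGpi S c Z ρ i x ∂(margin ρ i)
      = (a₀ (cdf (margin ρ i) x) * q S Z i x
          - ∫ x, a₀ (cdf (margin ρ i) x) * q S Z i x ∂(margin ρ i))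
        + (∫ x, a₁ (cdf (margin ρ i) x) * q S Z i x ∂(margin ρ i))
          * ((if x ≤ Z i then (1 : ℝ) else 0) - cdf (margin ρ i) (Z i))
        + projKernel (margin ρ i) (fun x => a₂ (cdf (margin ρ i) x) * q S Z i x) x := fun x => by
    rw [hW.integral_inflGpi hd hq hpos, hW.inflGpi_eq, hW.g_eq, ← hW.K_eq hcont hd,
      ← hW.gpi_eq hpos]
    change _ = _ + K S c Z ρ i * (_ - F ρ i (Z i)) + _
    ring
  simp only [hinfl]
  rw [hW.gpi_eq hpos]
  ring

theorem aemeasurable_gpiN (hlaw : ∀ n, HasLaw (Y n) ρ P) (hindep : iIndepFun Y P)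
    (hcont : Continuous (F ρ i)) (hd : Measurable S.d) (z : ℝ) (n : ℕ) :
    AEMeasurable (fun ω => gpiN S z (fun j => Y j ω) i n) P := by
  refine AEMeasurable.congr (f := fun ω => (1 / (n : ℝ)) * ∑ j ∈ Finset.range n,
      (S.A (poorN z (fun j => Y j ω) i n) n z * S.w (S.mu₁ * n
        + S.mu₂ * (poorN z (fun j => Y j ω) i n) - S.mu₃ * (rankN (fun j => Y j ω i) n j)
        + S.mu₄) / S.B (poorN z (fun j => Y j ω) i n))
        * (Iic z).indicator (fun x => S.d ((z - x) / z)) (Y j ω i)) ?_ ?_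
  · refine (Finset.aemeasurable_fun_sum _ fun j _ => AEMeasurable.mul ?_ ?_).const_mul _
    · have hm : Measurable (fun a : ℕ × ℕ => S.A a.1 n z * S.w (S.mu₁ * n
        + S.mu₂ * (a.1 : ℝ) - S.mu₃ * (a.2 : ℝ) + S.mu₄) / S.B a.1) := measurable_of_countable _
      exact hm.comp_aemeasurable ((aemeasurable_poorN hlaw z i n).prodMk
        (aemeasurable_rankN hlaw i n j))
    · exact Measurable.comp_aemeasurable ((hd.comp (by fun_prop)).indicator measurableSet_Iic)
        (hasLaw_coord hlaw i j).aemeasurable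
  · filter_upwards [ae_injective_coord hlaw hindep hcont] with ω hω
    exact (gpiN_eq S z (fun j => Y j ω) i hω n).symm

end Gpi

section Gini

variable {Ω : Type*} [MeasurableSpace Ω] {P : Measure Ω} [IsProbabilityMeasure P]
  {ρ : Measure (Fin 2 → ℝ)} [IsProbabilityMeasure ρ] {Y : ℕ → Ω → Fin 2 → ℝ} {i : Fin 2}

theorem exists_ae_abs_le (hcont : Continuous (F ρ i)) (hmean0 : mean ρ i ≠ 0)
    (hL : ∃ M : ℝ, ∀ s ∈ Ioo (0 : ℝ) 1, |L ρ i s| ≤ M) :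
    ∃ M : ℝ, ∀ᵐ x ∂(margin ρ i), |x| ≤ M := by
  obtain ⟨M, hM⟩ := hL
  refine ⟨|mean ρ i| / 2 * M, ?_⟩
  have h := (hasLaw_quantile (m := margin ρ i) hcont).ae_iff
    (p := fun x => |x| ≤ |mean ρ i| / 2 * M)
    (measurableSet_setOfPred.1 (measurableSet_le continuous_abs.measurable measurable_const))
  refine h.1 (ae_restrict_Ioo_of_forall fun s hs => ?_)
  have h1 := hM s hs
  have hell : quantile (margin ρ i) s = mean ρ i / 2 * L ρ i s := by
    change ell ρ i s = _
    unfold L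
    field_simp
  rw [hell, abs_mul, abs_div, abs_two]
  gcongr

theorem measurable_F (ρ : Measure (Fin 2 → ℝ)) (i : Fin 2) : Measurable (F ρ i) :=
  measurable_cdf (margin ρ i)

theorem memLp_mul_F (hb : ∃ M : ℝ, ∀ᵐ x ∂(margin ρ i), |x| ≤ M) :
    MemLp (fun x => x * F ρ i x) 2 (margin ρ i) := by
  obtain ⟨M, hM⟩ := hb
  refine MemLp.of_bound (measurable_id.mul (measurable_F ρ i)).aestronglyMeasurable M ?_
  filter_upwards [hM] with x hx
  rw [Real.norm_eq_abs, abs_mul]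
  refine (mul_le_of_le_one_right (abs_nonneg _) ?_).trans hx
  change |cdf (margin ρ i) x| ≤ 1
  rw [abs_of_nonneg (cdf_nonneg _ _)]
  exact cdf_le_one _ _

theorem memLp_id_margin (hb : ∃ M : ℝ, ∀ᵐ x ∂(margin ρ i), |x| ≤ M) :
    MemLp (fun x : ℝ => x) 2 (margin ρ i) := by
  obtain ⟨M, hM⟩ := hb
  exact MemLp.of_bound measurable_id.aestronglyMeasurable M hM

theorem memLp_projKernel_mean (hb : ∃ M : ℝ, ∀ᵐ x ∂(margin ρ i), |x| ≤ M) :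
    MemLp (projKernel (margin ρ i) (fun x => 2 / mean ρ i * x)) 2 (margin ρ i) :=
  memLp_projKernel (measurable_id.const_mul _)
    (((memLp_id_margin hb).integrable (by norm_num)).const_mul _)

theorem memLp_inflGini (hb : ∃ M : ℝ, ∀ᵐ x ∂(margin ρ i), |x| ≤ M) :
    MemLp (inflGini ρ i) 2 (margin ρ i) :=
  (((memLp_mul_F hb).const_mul _).add (memLp_projKernel_mean hb)).sub
    ((memLp_id_margin hb).const_mul _)

theorem integral_inflGini (hb : ∃ M : ℝ, ∀ᵐ x ∂(margin ρ i), |x| ≤ M) :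
    ∫ x, inflGini ρ i x ∂(margin ρ i)
      = 2 / mean ρ i * giniA ρ i - 2 * (giniA ρ i / mean ρ i ^ 2) * mean ρ i := by
  have h1 := ((memLp_mul_F hb).integrable (by norm_num)).const_mul (2 / mean ρ i)
  have h2 := (memLp_projKernel_mean hb).integrable (by norm_num)
  have h3 := ((memLp_id_margin hb).integrable (by norm_num)).const_mul
    (2 * (giniA ρ i / mean ρ i ^ 2))
  have h4 : ∫ x, projKernel (margin ρ i) (fun x => 2 / mean ρ i * x) x ∂(margin ρ i) = 0 :=
    integral_projKernel (((memLp_id_margin hb).integrable (by norm_num)).const_mul _)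
  have e1 := integral_sub (h1.add h2) h3
  have e2 := integral_add h1 h2
  simp only [Pi.add_apply] at e1
  unfold inflGini
  rw [e1, e2, integral_const_mul, integral_const_mul, h4]
  simp only [giniA, mean]
  ring

theorem gini_linearization (x : ℕ → ℝ) {n : ℕ} (hn : 0 < n) {A M mu : ℝ} (hM : M ≠ 0)
    (hmu : mu ≠ 0) (hAv : (1 / (n : ℝ)) * ∑ j ∈ Finset.range n, x j = M) (G B : ℝ)
    (m : Measure ℝ)
    (hB : B = (1 / (n : ℝ)) * ∑ j ∈ Finset.range n, x j * empCdf x n (x j))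
    (hG : G = 2 * B / M - 1 - 1 / n) :
    √(n : ℝ) * (G - (2 * A / mu - 1))
      - (√(n : ℝ))⁻¹ * ∑ j ∈ Finset.range n, (2 / mu * (x j * cdf m (x j))
        + projKernel m (fun x => 2 / mu * x) (x j) - 2 * (A / mu ^ 2) * x j
        - (2 / mu * A - 2 * (A / mu ^ 2) * mu))
      = 2 / mu * projError m (fun x => x) x n
        + ((√(n : ℝ))⁻¹ * ∑ j ∈ Finset.range n, (2 / mu * (x j * cdf m (x j))
        + projKernel m (fun x => 2 / mu * x) (x j) - 2 * (A / mu ^ 2) * x j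
        - (2 / mu * A - 2 * (A / mu ^ 2) * mu)) + 2 / mu * projError m (fun x => x) x n)
        * (mu * (M⁻¹ - mu⁻¹)) - (√(n : ℝ))⁻¹ := by
  have hn' : (0 : ℝ) < n := by exact_mod_cast hn
  have hs : √(n : ℝ) ≠ 0 := (Real.sqrt_pos.2 hn').ne'
  have hsum : ∑ j ∈ Finset.range n, x j = n * M := by rw [← hAv]; field_simp
  have hsumB : ∑ j ∈ Finset.range n, x j * empCdf x n (x j) = n * B := by rw [hB]; field_simp
  have hk : ∀ y, projKernel m (fun x => 2 / mu * x) y = 2 / mu * projKernel m (fun x => x) y :=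
    projKernel_const_mul _
  unfold projError
  simp only [mul_sub, hk, Finset.sum_sub_distrib, Finset.sum_add_distrib,
    ← Finset.mul_sum, Finset.sum_const, Finset.card_range, nsmul_eq_mul]
  rw [hsum, hsumB, hG]
  generalize ∑ j ∈ Finset.range n, x j * cdf m (x j) = s1
  generalize ∑ j ∈ Finset.range n, projKernel m (fun x => x) (x j) = s2
  have h3 : (n : ℝ) = √(n : ℝ) * √(n : ℝ) := (Real.mul_self_sqrt hn'.le).symm
  generalize √(n : ℝ) = r at hs h3 ⊢
  rw [h3]
  field_simp
  ring

/-- Asymptotic linearity of the Gini index. -/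
theorem negligibleInProb_giniN (hlaw : ∀ n, HasLaw (Y n) ρ P) (hindep : iIndepFun Y P)
    (hpos : ∀ᵐ x ∂(margin ρ i), 0 < x) (hcont : Continuous (F ρ i))
    (hmean0 : mean ρ i ≠ 0) (hb : ∃ M : ℝ, ∀ᵐ x ∂(margin ρ i), |x| ≤ M) :
    NegligibleInProb P (fun n ω =>
      √(n : ℝ) * (giniN (fun j => Y j ω) i n - gini ρ i)
        - (√(n : ℝ))⁻¹ * ∑ j ∈ Finset.range n,
          (inflGini ρ i (Y j ω i) - ∫ x, inflGini ρ i x ∂(margin ρ i))) := by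
  have : NullSingletonClass (margin ρ i) := nullSingletonClass_of_continuous_cdf hcont
  have hX := hasLaw_coord hlaw i
  have hind := iIndepFun_coord hindep i
  have hid := (memLp_id_margin hb).integrable (μ := margin ρ i) (by norm_num)
  have hE := (negligibleInProb_projError hX hind measurable_id hid).const_mul (2 / mean ρ i)
  have hS := boundedInProb_normalized_sum hX hind (memLp_inflGini hb)
  have hM := (NegligibleInProb.inv_sub_const_inv hmean0
    (negligibleInProb_mean_sub hX hind (f := fun x : ℝ => x) hid)).const_mul (mean ρ i)
  have hlim : Tendsto (fun n : ℕ => (√(n : ℝ))⁻¹) atTop (𝓝 0) :=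
    tendsto_inv_atTop_zero.comp (Real.tendsto_sqrt_atTop.comp tendsto_natCast_atTop_atTop)
  refine ((hE.add ((hS.add hE.boundedInProb).mul_negligible hM)).sub
    (negligibleInProb_of_tendsto hlim)).congr ?_
  filter_upwards [eventually_gt_atTop 0] with n hn
  have hposY : ∀ᵐ ω ∂P, ∀ j, 0 < Y j ω i := by
    rw [ae_all_iff]
    exact fun j => ((hX j).ae_iff (p := fun x => 0 < x)
      (measurableSet_setOfPred.1 measurableSet_Ioi)).2 hpos
  filter_upwards [hposY, ae_injective_coord hlaw hindep hcont] with ω hω hinj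
  have hmean : empMean (fun j => Y j ω) i n = (1 / (n : ℝ)) * ∑ j ∈ Finset.range n, Y j ω i := by
    unfold empMean
    rw [Fin.sum_univ_eq_sum_range (fun j => Y j ω i)]
  have hn' : (0 : ℝ) < n := by exact_mod_cast hn
  have hmeanpos : empMean (fun j => Y j ω) i n ≠ 0 := by
    rw [hmean]
    have : 0 < ∑ j ∈ Finset.range n, Y j ω i :=
      Finset.sum_pos (fun j _ => hω j) ⟨0, Finset.mem_range.2 hn⟩
    positivity
  have hG := giniN_eq (fun j => Y j ω) i hinj hn hmeanpos
  rw [integral_inflGini hb]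
  have h := gini_linearization (fun j => Y j ω i) hn (A := giniA ρ i) hmeanpos hmean0 hmean.symm _
    _ (margin ρ i) rfl hG
  rw [hmean] at h
  exact h

theorem aemeasurable_giniN (hlaw : ∀ n, HasLaw (Y n) ρ P) (hindep : iIndepFun Y P)
    (hcont : Continuous (F ρ i)) (n : ℕ) :
    AEMeasurable (fun ω => giniN (fun j => Y j ω) i n) P := by
  refine AEMeasurable.congr (f := fun ω => (1 / empMean (fun j => Y j ω) i n) * ((1 / (n : ℝ)) *
    ∑ j ∈ Finset.range n, ((2 * (rankN (fun j => Y j ω i) n j : ℝ) - 1) / n - 1) * Y j ω i)) ?_ ?_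
  · have hmean : AEMeasurable (fun ω => empMean (fun j => Y j ω) i n) P :=
      (Finset.aemeasurable_fun_sum Finset.univ fun (j : Fin n) _ =>
        (hasLaw_coord hlaw i j).aemeasurable).const_mul _
    refine (hmean.const_div _).mul
      ((Finset.aemeasurable_fun_sum _ fun j _ => AEMeasurable.mul ?_
        (hasLaw_coord hlaw i j).aemeasurable).const_mul _)
    have hm : Measurable (fun a : ℕ => (2 * (a : ℝ) - 1) / n - 1) := measurable_of_countable _
    exact hm.comp_aemeasurable (aemeasurable_rankN hlaw i n j)
  · filter_upwards [ae_injective_coord hlaw hindep hcont] with ω hω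
    have h := sum_orderStat (fun j => Y j ω) i hω n (fun r x => ((2 * (r : ℝ) - 1) / n - 1) * x)
    push_cast at h
    unfold giniN
    rw [h]

end Gini

/-! ### Weighted averages of a square integrable process over the unit interval -/

section Average

open scoped ENNReal

variable {Ω' : Type*} [MeasurableSpace Ω'] {P' : Measure Ω'} [IsProbabilityMeasure P']
  {lam : Measure ℝ} {k : ℝ → Ω' → ℝ} {φ : ℝ → ℝ}

theorem ennreal_mul_le_sq_add_sq (a b : ℝ≥0∞) : a * b ≤ a ^ 2 + b ^ 2 := by
  rcases le_total a b with h | h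
  · calc a * b ≤ b * b := by gcongr
      _ = b ^ 2 := (sq b).symm
      _ ≤ _ := le_add_self
  · calc a * b ≤ a * a := by gcongr
      _ = a ^ 2 := (sq a).symm
      _ ≤ _ := le_self_add

theorem lintegral_mul_sq_le {a b : ℝ → ℝ≥0∞} (ha : AEMeasurable a lam) (hb : AEMeasurable b lam) :
    (∫⁻ s, a s * b s ∂lam) ^ 2 ≤ (∫⁻ s, a s ∂lam) * ∫⁻ s, a s * b s ^ 2 ∂lam := by
  have hpq : (2 : ℝ).HolderConjugate 2 := Real.HolderConjugate.two_two
  have h := ENNReal.lintegral_mul_le_Lp_mul_Lq lam hpq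
    (f := fun s => a s ^ (1 / 2 : ℝ)) (g := fun s => a s ^ (1 / 2 : ℝ) * b s)
    (ha.pow_const _) ((ha.pow_const _).mul hb)
  have hsq : ∀ x : ℝ≥0∞, x ^ (1 / 2 : ℝ) * x ^ (1 / 2 : ℝ) = x := fun x => by
    rw [← ENNReal.rpow_add_of_nonneg _ _ (by norm_num) (by norm_num)]; norm_num
  have e1 : ∀ s, ((fun s => a s ^ (1 / 2 : ℝ)) * fun s => a s ^ (1 / 2 : ℝ) * b s) s
      = a s * b s := fun s => by
    simp only [Pi.mul_apply, ← mul_assoc, hsq]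
  have e2 : ∀ s, (a s ^ (1 / 2 : ℝ)) ^ (2 : ℝ) = a s := fun s => by
    rw [ENNReal.rpow_two, sq, hsq]
  have e3 : ∀ s, (a s ^ (1 / 2 : ℝ) * b s) ^ (2 : ℝ) = a s * b s ^ 2 := fun s => by
    rw [ENNReal.rpow_two, mul_pow, sq (a s ^ _), hsq]
  simp only [e1, e2, e3] at h
  calc (∫⁻ s, a s * b s ∂lam) ^ 2
      ≤ ((∫⁻ s, a s ∂lam) ^ (1 / 2 : ℝ) * (∫⁻ s, a s * b s ^ 2 ∂lam) ^ (1 / 2 : ℝ)) ^ 2 := by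
        gcongr
    _ = _ := by rw [mul_pow, sq, sq, hsq, hsq]

theorem integrable_prod_average
    (hk : AEMeasurable (fun a : ℝ × Ω' => k a.1 a.2) (lam.prod P'))
    (hk2 : ∀ᵐ s ∂lam, ∫⁻ ω, ‖k s ω‖ₑ ^ 2 ∂P' ≤ 1) (hφ : Integrable φ lam)
    {Ψ : Ω' → ℝ} (hΨ : MemLp Ψ 2 P') :
    Integrable (fun a : ℝ × Ω' => φ a.1 * (k a.1 a.2 * Ψ a.2)) (lam.prod P') := by
  have hm : AEMeasurable (fun a : ℝ × Ω' => φ a.1 * (k a.1 a.2 * Ψ a.2)) (lam.prod P') :=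
    (hφ.aemeasurable.comp_quasiMeasurePreserving Measure.quasiMeasurePreserving_fst).mul
      (hk.mul (hΨ.aemeasurable.comp_quasiMeasurePreserving Measure.quasiMeasurePreserving_snd))
  refine ⟨hm.aestronglyMeasurable, ?_⟩
  unfold HasFiniteIntegral
  rw [lintegral_prod _ hm.enorm]
  have hΨ2 : ∫⁻ ω, ‖Ψ ω‖ₑ ^ 2 ∂P' ≠ ∞ := by
    have := lintegral_rpow_enorm_lt_top_of_eLpNorm_lt_top (p := 2) (by simp) (by simp) hΨ.2
    simpa using this.ne
  calc ∫⁻ s, ∫⁻ ω, ‖φ s * (k s ω * Ψ ω)‖ₑ ∂P' ∂lam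
      ≤ ∫⁻ s, ‖φ s‖ₑ * (1 + ∫⁻ ω, ‖Ψ ω‖ₑ ^ 2 ∂P') ∂lam := by
        refine lintegral_mono_ae ?_
        filter_upwards [hk2] with s hs
        simp only [enorm_mul]
        rw [lintegral_const_mul' _ _ enorm_ne_top]
        gcongr
        refine (lintegral_mono fun ω => ennreal_mul_le_sq_add_sq _ _).trans ?_
        rw [lintegral_add_right' _ (hΨ.aemeasurable.enorm.pow_const 2)]
        gcongr
    _ < ∞ := by
        rw [lintegral_mul_const' _ _ (by simp [hΨ2])]
        exact ENNReal.mul_lt_top hφ.2 (by simp [hΨ2, lt_top_iff_ne_top])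

variable [SFinite lam]

theorem integral_average_mul
    (hk : AEMeasurable (fun a : ℝ × Ω' => k a.1 a.2) (lam.prod P'))
    (hk2 : ∀ᵐ s ∂lam, ∫⁻ ω, ‖k s ω‖ₑ ^ 2 ∂P' ≤ 1) (hφ : Integrable φ lam)
    {Ψ : Ω' → ℝ} (hΨ : MemLp Ψ 2 P') :
    ∫ ω, (∫ s, φ s * k s ω ∂lam) * Ψ ω ∂P' = ∫ s, φ s * ∫ ω, k s ω * Ψ ω ∂P' ∂lam := by
  have h := integral_integral_swap (f := fun s ω => φ s * (k s ω * Ψ ω))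
    (integrable_prod_average hk hk2 hφ hΨ)
  simp only [← integral_mul_const, ← integral_const_mul]
  rw [h]
  simp only [mul_assoc]

theorem ae_integrable_average
    (hk : AEMeasurable (fun a : ℝ × Ω' => k a.1 a.2) (lam.prod P'))
    (hk2 : ∀ᵐ s ∂lam, ∫⁻ ω, ‖k s ω‖ₑ ^ 2 ∂P' ≤ 1) (hφ : Integrable φ lam) :
    ∀ᵐ ω ∂P', Integrable (fun s => φ s * k s ω) lam := by
  have h := (integrable_prod_average hk hk2 hφ (memLp_const (1 : ℝ))).prod_left_ae
  simpa using h

theorem memLp_average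
    (hk : AEMeasurable (fun a : ℝ × Ω' => k a.1 a.2) (lam.prod P'))
    (hk2 : ∀ᵐ s ∂lam, ∫⁻ ω, ‖k s ω‖ₑ ^ 2 ∂P' ≤ 1) (hφ : Integrable φ lam) :
    MemLp (fun ω => ∫ s, φ s * k s ω ∂lam) 2 P' := by
  have hint := integrable_prod_average hk hk2 hφ (memLp_const (1 : ℝ))
  simp only [mul_one] at hint
  have hmeas : AEStronglyMeasurable (fun ω => ∫ s, φ s * k s ω ∂lam) P' :=
    hint.integral_prod_right.aestronglyMeasurable
  refine ⟨hmeas, ?_⟩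
  rw [eLpNorm_lt_top_iff_lintegral_rpow_enorm_lt_top (by simp) (by simp)]
  simp only [ENNReal.toReal_ofNat, ENNReal.rpow_two]
  have hslice : ∀ᵐ ω ∂P', AEMeasurable (fun s => k s ω) lam := by
    filter_upwards [hk.aestronglyMeasurable.prod_swap.prodMk_left] with ω hω
    exact hω.aemeasurable
  have hm : AEMeasurable (fun a : ℝ × Ω' => ‖φ a.1‖ₑ * ‖k a.1 a.2‖ₑ ^ 2) (lam.prod P') :=
    (hφ.aemeasurable.comp_quasiMeasurePreserving Measure.quasiMeasurePreserving_fst).enorm.mul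
      (hk.enorm.pow_const 2)
  calc ∫⁻ ω, ‖∫ s, φ s * k s ω ∂lam‖ₑ ^ 2 ∂P'
      ≤ ∫⁻ ω, (∫⁻ s, ‖φ s‖ₑ ∂lam) * ∫⁻ s, ‖φ s‖ₑ * ‖k s ω‖ₑ ^ 2 ∂lam ∂P' := by
        refine lintegral_mono_ae ?_
        filter_upwards [hslice] with ω hω
        refine le_trans ?_ (lintegral_mul_sq_le hφ.aemeasurable.enorm hω.enorm)
        gcongr
        refine (enorm_integral_le_lintegral_enorm _).trans (le_of_eq ?_)
        simp only [enorm_mul]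
    _ = (∫⁻ s, ‖φ s‖ₑ ∂lam) * ∫⁻ s, ∫⁻ ω, ‖φ s‖ₑ * ‖k s ω‖ₑ ^ 2 ∂P' ∂lam := by
        rw [lintegral_const_mul' _ _ hφ.2.ne,
          ← lintegral_lintegral_swap (f := fun s ω => ‖φ s‖ₑ * ‖k s ω‖ₑ ^ 2) hm]
    _ ≤ (∫⁻ s, ‖φ s‖ₑ ∂lam) * ∫⁻ s, ‖φ s‖ₑ ∂lam := by
        gcongr _ * ?_
        refine lintegral_mono_ae ?_
        filter_upwards [hk2] with s hs
        rw [lintegral_const_mul' _ _ enorm_ne_top]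
        exact mul_le_of_le_one_right' hs
    _ < ∞ := ENNReal.mul_lt_top hφ.2 hφ.2

end Average


/-! ### The bridge averages as functions of the copula -/

section Copula

variable {ρ C : Measure (Fin 2 → ℝ)}

/-- Square integrable representative `u ↦ ∫_0^1 φ(s) (1_{(0,s)}(u_i) - s) ds` of the average
of the bridge `s ↦ 𝕋(f_{i,s})` against `φ`. -/
def bridgeAvg (i : Fin 2) (φ : ℝ → ℝ) (u : Fin 2 → ℝ) : ℝ :=
  ∫ s, φ s * (fInd i s u - s) ∂((volume : Measure ℝ).restrict (Ioo 0 1))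

theorem measurable_fInd_uncurry (i : Fin 2) :
    Measurable (fun a : ℝ × (Fin 2 → ℝ) => fInd i a.1 a.2) := by
  have h : MeasurableSet {a : ℝ × (Fin 2 → ℝ) | 0 < a.2 i ∧ a.2 i < a.1} := by
    refine MeasurableSet.inter ?_ ?_
    · exact measurableSet_lt measurable_const ((measurable_pi_apply i).comp measurable_snd)
    · exact measurableSet_lt ((measurable_pi_apply i).comp measurable_snd) measurable_fst
  exact (measurable_const (a := (1 : ℝ))).indicator h

theorem measurable_fInd (i : Fin 2) (s : ℝ) : Measurable (fInd i s) :=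
  (measurable_fInd_uncurry i).comp (measurable_const.prodMk measurable_id)

theorem fInd_nonneg (i : Fin 2) (s : ℝ) (u : Fin 2 → ℝ) : 0 ≤ fInd i s u :=
  indicator_nonneg (fun _ _ => zero_le_one) _

theorem fInd_le_one (i : Fin 2) (s : ℝ) (u : Fin 2 → ℝ) : fInd i s u ≤ 1 :=
  indicator_le_self' (fun _ _ => zero_le_one) _

theorem memLp_fInd [IsProbabilityMeasure C] (i : Fin 2) (s : ℝ) : MemLp (fInd i s) 2 C :=
  MemLp.of_bound (measurable_fInd i s).aestronglyMeasurable 1 (Eventually.of_forall fun u => by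
    rw [Real.norm_of_nonneg (fInd_nonneg i s u)]; exact fInd_le_one i s u)

theorem gam_eq_covariance (f g : (Fin 2 → ℝ) → ℝ) : Gam C f g = cov[f, g; C] := rfl

theorem gam_comm (f g : (Fin 2 → ℝ) → ℝ) : Gam C f g = Gam C g f := by
  simp only [gam_eq_covariance, covariance_comm]

theorem measurableSet_coord_Ioo (i : Fin 2) (s : ℝ) :
    MeasurableSet {u : Fin 2 → ℝ | u i ∈ Ioo 0 s} :=
  measurable_pi_apply i measurableSet_Ioo

theorem mul_fInd (f : (Fin 2 → ℝ) → ℝ) (i : Fin 2) (s : ℝ) :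
    (fun u => f u * fInd i s u) = {u : Fin 2 → ℝ | u i ∈ Ioo 0 s}.indicator f := by
  ext u
  simp only [fInd, indicator, mem_ofPred_eq]
  split_ifs <;> simp

theorem integral_mul_fInd (f : (Fin 2 → ℝ) → ℝ) (i : Fin 2) (s : ℝ) :
    ∫ u, f u * fInd i s u ∂C = ∫ u in {u : Fin 2 → ℝ | u i ∈ Ioo 0 s}, f u ∂C := by
  rw [mul_fInd, integral_indicator (measurableSet_coord_Ioo i s)]

theorem fInd_mul_fInd (i : Fin 2) (s t : ℝ) (u : Fin 2 → ℝ) :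
    fInd i s u * fInd i t u = fInd i (min s t) u := by
  simp only [fInd, indicator, mem_Ioo, lt_min_iff]
  split_ifs <;> first | (exfalso; tauto) | simp

theorem IsCopulaOf.integral_fInd (hC : IsCopulaOf C ρ) (i : Fin 2) {s : ℝ}
    (hs : s ∈ Icc (0 : ℝ) 1) : ∫ u, fInd i s u ∂C = s := by
  have h := (hC.hasLaw_eval i).integral_comp
    (f := (Ioo 0 s).indicator (fun _ => (1 : ℝ)))
    ((measurable_const.indicator measurableSet_Ioo).aestronglyMeasurable)
  refine h.trans ?_
  rw [integral_indicator measurableSet_Ioo, Measure.restrict_restrict measurableSet_Ioo,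
    inter_eq_left.2 (Ioo_subset_Ioo_right hs.2)]
  simp [hs.1]

theorem IsCopulaOf.gam_fInd (hC : IsCopulaOf C ρ) (i : Fin 2) {s : ℝ}
    (hs : s ∈ Icc (0 : ℝ) 1) {f : (Fin 2 → ℝ) → ℝ} (hf : MemLp f 2 C) :
    Gam C f (fInd i s)
      = ∫ u in {u : Fin 2 → ℝ | u i ∈ Ioo 0 s}, f u ∂C - (∫ u, f u ∂C) * s := by
  have := hC.isProbabilityMeasure
  rw [gam_eq_covariance, covariance_eq_sub hf (memLp_fInd i s), hC.integral_fInd i hs]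
  congr 1
  exact integral_mul_fInd f i s

theorem IsCopulaOf.gam_fInd_fInd_same (hC : IsCopulaOf C ρ) (i : Fin 2) {s t : ℝ}
    (hs : s ∈ Icc (0 : ℝ) 1) (ht : t ∈ Icc (0 : ℝ) 1) :
    Gam C (fInd i s) (fInd i t) = min s t - s * t := by
  have := hC.isProbabilityMeasure
  rw [gam_eq_covariance, covariance_eq_sub (memLp_fInd i s) (memLp_fInd i t),
    hC.integral_fInd i hs, hC.integral_fInd i ht]
  congr 1
  rw [← hC.integral_fInd i (s := min s t) ⟨le_min hs.1 ht.1, (min_le_left _ _).trans hs.2⟩]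
  exact integral_congr_ae (Eventually.of_forall fun u => fInd_mul_fInd i s t u)

theorem IsCopulaOf.ae_ne (hC : IsCopulaOf C ρ) (i : Fin 2) (s : ℝ) : ∀ᵐ u ∂C, u i ≠ s := by
  have h := (hC.hasLaw_eval i).ae_iff (p := fun t => t ≠ s)
    (measurableSet_setOfPred.1 (measurableSet_singleton s).compl)
  exact h.2 (ae_restrict_of_ae (by simp [ae_iff]))

theorem IsCopulaOf.gam_fInd_fInd_cross (hC : IsCopulaOf C ρ) {s t : ℝ}
    (hs : s ∈ Icc (0 : ℝ) 1) (ht : t ∈ Icc (0 : ℝ) 1) :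
    Gam C (fInd 0 s) (fInd 1 t) = copulaFun C s t - s * t := by
  have := hC.isProbabilityMeasure
  rw [gam_eq_covariance, covariance_eq_sub (memLp_fInd 0 s) (memLp_fInd 1 t),
    hC.integral_fInd 0 hs, hC.integral_fInd 1 ht]
  congr 1
  have hms : MeasurableSet {u : Fin 2 → ℝ | u 0 ≤ s ∧ u 1 ≤ t} :=
    (measurableSet_le (measurable_pi_apply 0) measurable_const).inter
      (measurableSet_le (measurable_pi_apply 1) measurable_const)
  rw [copulaFun, ← integral_indicator_one hms]
  refine integral_congr_ae ?_
  filter_upwards [hC.ae_mem_Ioo, hC.ae_ne 0 s, hC.ae_ne 1 t] with u hu h0 h1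
  simp only [Pi.mul_apply, fInd, indicator, mem_Ioo, mem_ofPred_eq, (hu 0).1, (hu 1).1, true_and,
    h0.le_iff_lt, h1.le_iff_lt, Pi.one_apply]
  split_ifs <;> first | (exfalso; tauto) | simp

theorem fInd_sub_aemeasurable (i : Fin 2) [IsProbabilityMeasure C] :
    AEMeasurable (fun a : ℝ × (Fin 2 → ℝ) => fInd i a.1 a.2 - a.1)
      (((volume : Measure ℝ).restrict (Ioo 0 1)).prod C) :=
  ((measurable_fInd_uncurry i).sub measurable_fst).aemeasurable

theorem abs_fInd_sub_le (i : Fin 2) {s : ℝ} (hs : s ∈ Icc (0 : ℝ) 1) (u : Fin 2 → ℝ) :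
    |fInd i s u - s| ≤ 1 := by
  have h0 := fInd_nonneg i s u
  have h1 := fInd_le_one i s u
  rw [abs_le]
  exact ⟨by linarith [hs.2], by linarith [hs.1]⟩

theorem lintegral_fInd_sub_sq_le (i : Fin 2) [IsProbabilityMeasure C] :
    ∀ᵐ s ∂((volume : Measure ℝ).restrict (Ioo 0 1)), ∫⁻ u, ‖fInd i s u - s‖ₑ ^ 2 ∂C ≤ 1 := by
  refine ae_restrict_Ioo_of_forall fun s hs => ?_
  calc ∫⁻ u, ‖fInd i s u - s‖ₑ ^ 2 ∂C ≤ ∫⁻ _, 1 ∂C := by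
        refine lintegral_mono fun u => pow_le_one' ?_ 2
        rw [Real.enorm_eq_ofReal_abs]
        exact ENNReal.ofReal_le_one.2 (abs_fInd_sub_le i ⟨hs.1.le, hs.2.le⟩ u)
    _ = 1 := by simp

variable {φ ψ : ℝ → ℝ}

theorem memLp_bridgeAvg [IsProbabilityMeasure C] (i : Fin 2)
    (hφ : Integrable φ ((volume : Measure ℝ).restrict (Ioo 0 1))) :
    MemLp (bridgeAvg i φ) 2 C :=
  memLp_average (fInd_sub_aemeasurable i) (lintegral_fInd_sub_sq_le i) hφ

theorem IsCopulaOf.integral_fInd_sub_mul (hC : IsCopulaOf C ρ) (i : Fin 2) {s : ℝ}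
    (hs : s ∈ Icc (0 : ℝ) 1) {f : (Fin 2 → ℝ) → ℝ} (hf : MemLp f 2 C) :
    ∫ u, (fInd i s u - s) * f u ∂C = Gam C f (fInd i s) := by
  have := hC.isProbabilityMeasure
  have h1 : Integrable (fun u => f u * fInd i s u) C := hf.integrable_mul (memLp_fInd i s)
  rw [hC.gam_fInd i hs hf, ← integral_mul_fInd, ← integral_mul_const,
    ← integral_sub h1 ((hf.integrable (by simp)).mul_const s)]
  exact integral_congr_ae (Eventually.of_forall fun u => by ring)

theorem IsCopulaOf.integral_bridgeAvg (hC : IsCopulaOf C ρ) (i : Fin 2)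
    (hφ : Integrable φ ((volume : Measure ℝ).restrict (Ioo 0 1))) :
    ∫ u, bridgeAvg i φ u ∂C = 0 := by
  have := hC.isProbabilityMeasure
  have h := integral_average_mul (fInd_sub_aemeasurable (C := C) i) (lintegral_fInd_sub_sq_le i) hφ
    (memLp_const (1 : ℝ))
  simp only [mul_one] at h
  refine h.trans (integral_eq_zero_of_ae (ae_restrict_Ioo_of_forall fun s hs => ?_))
  simp [integral_sub ((memLp_fInd (C := C) i s).integrable (by simp)) (integrable_const s),
    hC.integral_fInd i ⟨hs.1.le, hs.2.le⟩]

theorem IsCopulaOf.gam_bridgeAvg (hC : IsCopulaOf C ρ) (i : Fin 2)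
    (hφ : Integrable φ ((volume : Measure ℝ).restrict (Ioo 0 1)))
    {f : (Fin 2 → ℝ) → ℝ} (hf : MemLp f 2 C) :
    Gam C f (bridgeAvg i φ) = ∫ s in (0 : ℝ)..1, φ s * Gam C f (fInd i s) := by
  have := hC.isProbabilityMeasure
  rw [gam_eq_covariance, covariance_eq_sub hf (memLp_bridgeAvg i hφ), hC.integral_bridgeAvg i hφ,
    mul_zero, sub_zero, intervalIntegral_eq_restrict_Ioo]
  have h := integral_average_mul (fInd_sub_aemeasurable (C := C) i) (lintegral_fInd_sub_sq_le i) hφ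
    hf
  calc ∫ u, (f * bridgeAvg i φ) u ∂C = ∫ u, bridgeAvg i φ u * f u ∂C :=
        integral_congr_ae (Eventually.of_forall fun u => mul_comm _ _)
    _ = _ := h
    _ = _ := integral_congr_ae (ae_restrict_Ioo_of_forall fun s hs => by
        simp only [hC.integral_fInd_sub_mul i ⟨hs.1.le, hs.2.le⟩ hf])

theorem IsCopulaOf.gam_bridgeAvg_bridgeAvg (hC : IsCopulaOf C ρ) (i j : Fin 2)
    (hφ : Integrable φ ((volume : Measure ℝ).restrict (Ioo 0 1)))
    (hψ : Integrable ψ ((volume : Measure ℝ).restrict (Ioo 0 1))) :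
    Gam C (bridgeAvg i φ) (bridgeAvg j ψ)
      = ∫ s in (0 : ℝ)..1, ∫ t in (0 : ℝ)..1, φ s * ψ t * Gam C (fInd i s) (fInd j t) := by
  have := hC.isProbabilityMeasure
  rw [gam_comm, hC.gam_bridgeAvg i hφ (memLp_bridgeAvg j hψ)]
  refine intervalIntegral.integral_congr fun s _ => ?_
  rw [gam_comm, hC.gam_bridgeAvg j hψ (memLp_fInd i s), ← intervalIntegral.integral_const_mul]
  simp only [mul_assoc]

/-- Square integrable function `β_φ` representing `β*(φ)`. -/
def bridgeDiff (φ : Fin 2 → ℝ → ℝ) (u : Fin 2 → ℝ) : ℝ :=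
  bridgeAvg 1 (φ 1) u - bridgeAvg 0 (φ 0) u

variable {Φ Ψ : Fin 2 → ℝ → ℝ}

theorem memLp_bridgeDiff [IsProbabilityMeasure C]
    (hΦ : ∀ i, Integrable (Φ i) ((volume : Measure ℝ).restrict (Ioo 0 1))) :
    MemLp (bridgeDiff Φ) 2 C :=
  (memLp_bridgeAvg 1 (hΦ 1)).sub (memLp_bridgeAvg 0 (hΦ 0))

theorem abs_integral_coord_le [IsProbabilityMeasure C] {f : (Fin 2 → ℝ) → ℝ} (hf : Integrable f C)
    (i : Fin 2) (s : ℝ) :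
    |∫ u in {u : Fin 2 → ℝ | u i ∈ Ioo 0 s}, f u ∂C| ≤ ∫ u, |f u| ∂C := by
  refine (abs_integral_le_integral_abs).trans ?_
  exact setIntegral_le_integral hf.abs (Eventually.of_forall fun u => abs_nonneg _)

theorem aestronglyMeasurable_integral_coord [IsProbabilityMeasure C] {f : (Fin 2 → ℝ) → ℝ}
    (hf : Integrable f C) (i : Fin 2) :
    AEStronglyMeasurable (fun s => ∫ u in {u : Fin 2 → ℝ | u i ∈ Ioo 0 s}, f u ∂C)
      ((volume : Measure ℝ).restrict (Ioo 0 1)) := by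
  simp only [← integral_mul_fInd]
  refine AEStronglyMeasurable.integral_prod_right' (f := fun a : ℝ × (Fin 2 → ℝ) =>
    f a.2 * fInd i a.1 a.2) ?_
  exact (hf.aestronglyMeasurable.comp_snd).mul (measurable_fInd_uncurry i).aestronglyMeasurable

/-- The covariance of `f` with the representative of `β*(Φ)`. -/
theorem IsCopulaOf.gam_bridgeDiff (hC : IsCopulaOf C ρ)
    (hΦ : ∀ i, Integrable (Φ i) ((volume : Measure ℝ).restrict (Ioo 0 1)))
    {f : (Fin 2 → ℝ) → ℝ} (hf : MemLp f 2 C) :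
    Gam C f (bridgeDiff Φ) = GamBeta C f Φ := by
  have := hC.isProbabilityMeasure
  have hfi : Integrable f C := hf.integrable (by simp)
  have hcov : Gam C f (bridgeDiff Φ)
      = Gam C f (bridgeAvg 1 (Φ 1)) - Gam C f (bridgeAvg 0 (Φ 0)) :=
    covariance_sub_right hf (memLp_bridgeAvg 1 (hΦ 1)) (memLp_bridgeAvg 0 (hΦ 0))
  have hint : ∀ i, Integrable (fun s => Φ i s * ∫ u in {u : Fin 2 → ℝ | u i ∈ Ioo 0 s}, f u ∂C)
      ((volume : Measure ℝ).restrict (Ioo 0 1)) := fun i =>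
    (hΦ i).mul_bdd (aestronglyMeasurable_integral_coord hfi i)
      (Eventually.of_forall fun s => abs_integral_coord_le hfi i s)
  have hs : ∀ i, Integrable (fun s => s * Φ i s) ((volume : Measure ℝ).restrict (Ioo 0 1)) :=
    fun i => (hΦ i).bdd_mul aestronglyMeasurable_id
      (ae_restrict_Ioo_of_forall (p := fun s => ‖s‖ ≤ 1) fun s hs => by
        rw [Real.norm_of_nonneg hs.1.le]; exact hs.2.le)
  have hone : ∀ i, Gam C f (bridgeAvg i (Φ i))
      = (∫ s in (0 : ℝ)..1, Φ i s * ∫ u in {u : Fin 2 → ℝ | u i ∈ Ioo 0 s}, f u ∂C)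
        - (∫ u, f u ∂C) * ∫ s in (0 : ℝ)..1, s * Φ i s := fun i => by
    rw [hC.gam_bridgeAvg i (hΦ i) hf]
    simp only [intervalIntegral_eq_restrict_Ioo]
    rw [← integral_const_mul, ← integral_sub (hint i) ((hs i).const_mul _)]
    refine integral_congr_ae (ae_restrict_Ioo_of_forall fun s hs => ?_)
    beta_reduce
    rw [hC.gam_fInd i ⟨hs.1.le, hs.2.le⟩ hf]
    ring
  have hsub : ∫ s in (0 : ℝ)..1, s * (Φ 1 s - Φ 0 s)
      = (∫ s in (0 : ℝ)..1, s * Φ 1 s) - ∫ s in (0 : ℝ)..1, s * Φ 0 s := by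
    simp only [intervalIntegral_eq_restrict_Ioo]
    rw [← integral_sub (hs 1) (hs 0)]
    simp only [mul_sub]
  rw [hcov, hone 1, hone 0, GamBeta, hsub]
  ring

/-- The covariance of the representatives of `β*(Φ)` and `β*(Ψ)`. -/
theorem IsCopulaOf.gam_bridgeDiff_bridgeDiff (hC : IsCopulaOf C ρ)
    (hΦ : ∀ i, Integrable (Φ i) ((volume : Measure ℝ).restrict (Ioo 0 1)))
    (hΨ : ∀ i, Integrable (Ψ i) ((volume : Measure ℝ).restrict (Ioo 0 1))) :
    Gam C (bridgeDiff Φ) (bridgeDiff Ψ) = BetaBeta C Φ Ψ := by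
  have := hC.isProbabilityMeasure
  have m := fun i => memLp_bridgeAvg (C := C) i (hΦ i)
  have m' := fun i => memLp_bridgeAvg (C := C) i (hΨ i)
  have hcov : Gam C (bridgeDiff Φ) (bridgeDiff Ψ)
      = Gam C (bridgeAvg 1 (Φ 1)) (bridgeAvg 1 (Ψ 1)) - Gam C (bridgeAvg 1 (Φ 1)) (bridgeAvg 0 (Ψ 0))
        - (Gam C (bridgeAvg 0 (Φ 0)) (bridgeAvg 1 (Ψ 1))
          - Gam C (bridgeAvg 0 (Φ 0)) (bridgeAvg 0 (Ψ 0))) := by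
    have e1 : Gam C (bridgeDiff Φ) (bridgeDiff Ψ)
        = Gam C (bridgeAvg 1 (Φ 1)) (bridgeDiff Ψ) - Gam C (bridgeAvg 0 (Φ 0)) (bridgeDiff Ψ) :=
      covariance_sub_left (m 1) (m 0) (memLp_bridgeDiff hΨ)
    rw [e1]
    congr 1 <;> exact covariance_sub_right (m _) (m' 1) (m' 0)
  have hsame : ∀ (i : Fin 2) {φ ψ : ℝ → ℝ},
      Integrable φ ((volume : Measure ℝ).restrict (Ioo 0 1)) →
      Integrable ψ ((volume : Measure ℝ).restrict (Ioo 0 1)) →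
      Gam C (bridgeAvg i φ) (bridgeAvg i ψ) = gam₁ φ ψ := fun i φ ψ hφ hψ => by
    rw [hC.gam_bridgeAvg_bridgeAvg i i hφ hψ, gam₁]
    refine intervalIntegral.integral_congr fun s hs => intervalIntegral.integral_congr fun t ht => ?_
    rw [uIcc_of_le zero_le_one] at hs ht
    simp only [hC.gam_fInd_fInd_same i hs ht]
  have hcross : ∀ {φ ψ : ℝ → ℝ},
      Integrable φ ((volume : Measure ℝ).restrict (Ioo 0 1)) →
      Integrable ψ ((volume : Measure ℝ).restrict (Ioo 0 1)) →
      Gam C (bridgeAvg 0 φ) (bridgeAvg 1 ψ) = gam₂ C φ ψ := fun {φ ψ} hφ hψ => by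
    rw [hC.gam_bridgeAvg_bridgeAvg 0 1 hφ hψ, gam₂]
    refine intervalIntegral.integral_congr fun s hs => intervalIntegral.integral_congr fun t ht => ?_
    rw [uIcc_of_le zero_le_one] at hs ht
    simp only [hC.gam_fInd_fInd_cross hs ht]
  rw [hcov, hsame 1 (hΦ 1) (hΨ 1), hsame 0 (hΦ 0) (hΨ 0), hcross (hΦ 0) (hΨ 1),
    gam_comm (bridgeAvg 1 (Φ 1)), hcross (hΨ 0) (hΦ 1), BetaBeta]
  ring

end Copula

/-! ### Influence functions of the variations and the asymptotic covariance matrix -/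

section Influence

variable {ρ C : Measure (Fin 2 → ℝ)} {S : PovertySpec} {c : Fin 2 → ℝ → ℝ → ℝ} {Z : Fin 2 → ℝ}

/-- The function `F*_J + β_ν` on the unit square. -/
def copulaGpi (S : PovertySpec) (c : Fin 2 → ℝ → ℝ → ℝ) (Z : Fin 2 → ℝ) (ρ : Measure (Fin 2 → ℝ))
    (u : Fin 2 → ℝ) : ℝ :=
  FstarJ S c Z ρ u + bridgeDiff (nu S c Z ρ) u

/-- The function `F* + β_L - F̃*` on the unit square. -/
def copulaGini (ρ : Measure (Fin 2 → ℝ)) (u : Fin 2 → ℝ) : ℝ :=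
  Fstar ρ u + bridgeDiff (L ρ) u - Ftilde ρ u

theorem nu_eq (hcont : ∀ i, Continuous (F ρ i)) (i : Fin 2) {s : ℝ} (hs : s ∈ Ioo (0 : ℝ) 1) :
    nu S c Z ρ i s = nuIncome S c Z ρ i (quantile (margin ρ i) s) := by
  unfold nu nuIncome
  rw [show F ρ i (quantile (margin ρ i) s) = s from cdf_quantile (hcont i) hs]
  rfl

variable [IsProbabilityMeasure ρ]

theorem IsCopulaOf.hasLaw_ell_coord (hC : IsCopulaOf C ρ) (hcont : ∀ i, Continuous (F ρ i))
    (i : Fin 2) : HasLaw (fun u : Fin 2 → ℝ => ell ρ i (u i)) (margin ρ i) C :=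
  HasLaw.comp (X := fun u : Fin 2 → ℝ => u i) (Y := quantile (margin ρ i))
    (hasLaw_quantile (hcont i)) (hC.hasLaw_eval i)

theorem memLp_comp_hasLaw {α β : Type*} [MeasurableSpace α] [MeasurableSpace β] {μ : Measure α}
    {ν : Measure β} {X : α → β} (hX : HasLaw X ν μ) {f : β → ℝ} (hf : MemLp f 2 ν) :
    MemLp (fun a => f (X a)) 2 μ :=
  (hX.map_eq.symm ▸ hf : MemLp f 2 (μ.map X)).comp_of_map hX.aemeasurable

theorem integrable_L (hcont : ∀ i, Continuous (F ρ i))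
    (hmean : ∀ i, Integrable (fun x : ℝ => x) (margin ρ i)) (i : Fin 2) :
    Integrable (L ρ i) ((volume : Measure ℝ).restrict (Ioo 0 1)) :=
  (integrable_quantile (m := margin ρ i) (hcont i) (hmean i)).const_mul (2 / mean ρ i)

theorem integrable_nu (hcont : ∀ i, Continuous (F ρ i)) {i : Fin 2}
    (hν : Integrable (nuIncome S c Z ρ i) (margin ρ i)) :
    Integrable (nu S c Z ρ i) ((volume : Measure ℝ).restrict (Ioo 0 1)) :=
  (integrable_quantile (m := margin ρ i) (hcont i) hν).congr
    (ae_restrict_Ioo_of_forall fun _ hs => (nu_eq hcont i hs).symm)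

theorem projKernel_ell (hcont : ∀ i, Continuous (F ρ i)) (i : Fin 2) {h φ : ℝ → ℝ}
    (hm : Measurable h) (hφ : ∀ s ∈ Ioo (0 : ℝ) 1, φ s = h (ell ρ i s)) {u : Fin 2 → ℝ}
    (hu : u i ∈ Ioo (0 : ℝ) 1) :
    projKernel (margin ρ i) h (ell ρ i (u i)) = bridgeAvg i φ u := by
  refine (projKernel_quantile (m := margin ρ i) (hcont i) hm hu).trans ?_
  rw [intervalIntegral_eq_restrict_Ioo]
  refine integral_congr_ae (ae_restrict_Ioo_of_forall fun s hs => ?_)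
  beta_reduce
  rw [hφ s hs]
  rfl

theorem IsCopulaOf.inflGpi_sub_ae_eq (hC : IsCopulaOf C ρ) (hcont : ∀ i, Continuous (F ρ i))
    (hν : ∀ i, Measurable (nuIncome S c Z ρ i)) :
    ∀ᵐ u ∂C, inflGpi S c Z ρ 1 (ell ρ 1 (u 1)) - inflGpi S c Z ρ 0 (ell ρ 0 (u 0))
      = copulaGpi S c Z ρ u := by
  filter_upwards [hC.ae_mem_Ioo] with u hu
  have h : ∀ i, inflGpi S c Z ρ i (ell ρ i (u i))
      = g S c Z ρ i (ell ρ i (u i)) + bridgeAvg i (nu S c Z ρ i) u := fun i => by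
    rw [← projKernel_ell hcont i (hν i) (fun s hs => nu_eq hcont i hs) (hu i)]
    rfl
  rw [h, h, copulaGpi, FstarJ, bridgeDiff]
  ring

theorem IsCopulaOf.inflGini_sub_ae_eq (hC : IsCopulaOf C ρ) (hcont : ∀ i, Continuous (F ρ i)) :
    ∀ᵐ u ∂C, inflGini ρ 1 (ell ρ 1 (u 1)) - inflGini ρ 0 (ell ρ 0 (u 0)) = copulaGini ρ u := by
  filter_upwards [hC.ae_mem_Ioo] with u hu
  have h : ∀ i, inflGini ρ i (ell ρ i (u i))
      = FstarH ρ i u + bridgeAvg i (L ρ i) u - 2 * (giniA ρ i / mean ρ i ^ 2) * ell ρ i (u i) :=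
    fun i => by
      rw [← projKernel_ell hcont i (φ := L ρ i)
          (h := fun x => 2 / mean ρ i * x) (measurable_id.const_mul _) (fun s _ => rfl) (hu i),
        FstarH, inflGini,
        show F ρ i (ell ρ i (u i)) = u i from cdf_quantile (m := margin ρ i) (hcont i) (hu i),
        mul_comm (ell ρ i (u i)) (u i)]
  rw [h, h, copulaGini, Fstar, Ftilde, bridgeDiff]
  ring

theorem IsCopulaOf.memLp_FstarH (hC : IsCopulaOf C ρ) (hcont : ∀ i, Continuous (F ρ i))
    {i : Fin 2} (hb : ∃ M : ℝ, ∀ᵐ x ∂(margin ρ i), |x| ≤ M) : MemLp (FstarH ρ i) 2 C := by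
  have h := memLp_comp_hasLaw (hC.hasLaw_ell_coord hcont i)
    ((memLp_mul_F hb).const_mul (2 / mean ρ i))
  refine h.ae_eq ?_
  filter_upwards [hC.ae_mem_Ioo] with u hu
  rw [show F ρ i (ell ρ i (u i)) = u i from cdf_quantile (m := margin ρ i) (hcont i) (hu i), FstarH]
  ring

theorem IsCopulaOf.memLp_Fstar (hC : IsCopulaOf C ρ) (hcont : ∀ i, Continuous (F ρ i))
    (hb : ∀ i, ∃ M : ℝ, ∀ᵐ x ∂(margin ρ i), |x| ≤ M) : MemLp (Fstar ρ) 2 C :=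
  (hC.memLp_FstarH hcont (hb 1)).sub (hC.memLp_FstarH hcont (hb 0))

theorem IsCopulaOf.memLp_Ftilde (hC : IsCopulaOf C ρ) (hcont : ∀ i, Continuous (F ρ i))
    (hb : ∀ i, ∃ M : ℝ, ∀ᵐ x ∂(margin ρ i), |x| ≤ M) : MemLp (Ftilde ρ) 2 C :=
  have h := fun i => memLp_comp_hasLaw (hC.hasLaw_ell_coord hcont i) (memLp_id_margin (hb i))
  (((h 1).const_mul _).sub ((h 0).const_mul _)).const_mul _

end Influence

section Covariance

variable {ρ C : Measure (Fin 2 → ℝ)} {S : PovertySpec} {c : Fin 2 → ℝ → ℝ → ℝ} {Z : Fin 2 → ℝ}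

theorem varGpi_eq (hC : IsCopulaOf C ρ) (hFJ : MemLp (FstarJ S c Z ρ) 2 C)
    (hν : ∀ i, Integrable (nu S c Z ρ i) ((volume : Measure ℝ).restrict (Ioo 0 1))) :
    varGpi S c Z C ρ = Gam C (copulaGpi S c Z ρ) (copulaGpi S c Z ρ) := by
  have := hC.isProbabilityMeasure
  have hβ := memLp_bridgeDiff (C := C) hν
  have e1 : Gam C (copulaGpi S c Z ρ) (copulaGpi S c Z ρ)
      = Gam C (FstarJ S c Z ρ) (copulaGpi S c Z ρ)
        + Gam C (bridgeDiff (nu S c Z ρ)) (copulaGpi S c Z ρ) :=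
    covariance_add_left hFJ hβ (hFJ.add hβ)
  have e2 : ∀ f, MemLp f 2 C → Gam C f (copulaGpi S c Z ρ)
      = Gam C f (FstarJ S c Z ρ) + Gam C f (bridgeDiff (nu S c Z ρ)) :=
    fun f hf => covariance_add_right hf hFJ hβ
  rw [e1, e2 _ hFJ, e2 _ hβ, gam_comm (bridgeDiff _) (FstarJ _ _ _ _), hC.gam_bridgeDiff hν hFJ,
    hC.gam_bridgeDiff_bridgeDiff hν hν, varGpi]
  ring

theorem gam_copulaGini (hC : IsCopulaOf C ρ) (hF : MemLp (Fstar ρ) 2 C)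
    (hT : MemLp (Ftilde ρ) 2 C)
    (hL : ∀ i, Integrable (L ρ i) ((volume : Measure ℝ).restrict (Ioo 0 1)))
    {f : (Fin 2 → ℝ) → ℝ} (hf : MemLp f 2 C) :
    Gam C f (copulaGini ρ) = Gam C f (Fstar ρ) + Gam C f (bridgeDiff (L ρ)) - Gam C f (Ftilde ρ) := by
  have := hC.isProbabilityMeasure
  have hβ := memLp_bridgeDiff (C := C) hL
  have e1 : Gam C f (copulaGini ρ) = Gam C f (Fstar ρ + bridgeDiff (L ρ)) - Gam C f (Ftilde ρ) :=
    covariance_sub_right hf (hF.add hβ) hT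
  rw [e1]
  congr 1
  exact covariance_add_right hf hF hβ

theorem memLp_copulaGini (hC : IsCopulaOf C ρ) (hF : MemLp (Fstar ρ) 2 C)
    (hT : MemLp (Ftilde ρ) 2 C)
    (hL : ∀ i, Integrable (L ρ i) ((volume : Measure ℝ).restrict (Ioo 0 1))) :
    MemLp (copulaGini ρ) 2 C :=
  have := hC.isProbabilityMeasure
  (hF.add (memLp_bridgeDiff hL)).sub hT

theorem memLp_copulaGpi (hC : IsCopulaOf C ρ) (hFJ : MemLp (FstarJ S c Z ρ) 2 C)
    (hν : ∀ i, Integrable (nu S c Z ρ i) ((volume : Measure ℝ).restrict (Ioo 0 1))) :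
    MemLp (copulaGpi S c Z ρ) 2 C :=
  have := hC.isProbabilityMeasure
  hFJ.add (memLp_bridgeDiff hν)

theorem varGini_eq (hC : IsCopulaOf C ρ) (hF : MemLp (Fstar ρ) 2 C)
    (hT : MemLp (Ftilde ρ) 2 C)
    (hL : ∀ i, Integrable (L ρ i) ((volume : Measure ℝ).restrict (Ioo 0 1))) :
    varGini C ρ = Gam C (copulaGini ρ) (copulaGini ρ) := by
  have := hC.isProbabilityMeasure
  have hβ := memLp_bridgeDiff (C := C) hL
  have hG := memLp_copulaGini hC hF hT hL
  have e := fun (f : (Fin 2 → ℝ) → ℝ) (hf : MemLp f 2 C) => gam_copulaGini hC hF hT hL hf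
  rw [e _ hG, gam_comm _ (Fstar ρ), gam_comm _ (bridgeDiff _), gam_comm _ (Ftilde ρ), e _ hF,
    e _ hβ, e _ hT, gam_comm (bridgeDiff _) (Fstar ρ), gam_comm (bridgeDiff _) (Ftilde ρ),
    gam_comm (Ftilde ρ) (Fstar ρ), hC.gam_bridgeDiff hL hF, hC.gam_bridgeDiff hL hT,
    hC.gam_bridgeDiff_bridgeDiff hL hL, varGini]
  ring

theorem covGpiGini_eq (hC : IsCopulaOf C ρ) (hFJ : MemLp (FstarJ S c Z ρ) 2 C)
    (hν : ∀ i, Integrable (nu S c Z ρ i) ((volume : Measure ℝ).restrict (Ioo 0 1)))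
    (hF : MemLp (Fstar ρ) 2 C) (hT : MemLp (Ftilde ρ) 2 C)
    (hL : ∀ i, Integrable (L ρ i) ((volume : Measure ℝ).restrict (Ioo 0 1))) :
    covGpiGini S c Z C ρ = Gam C (copulaGpi S c Z ρ) (copulaGini ρ) := by
  have := hC.isProbabilityMeasure
  have hβ := memLp_bridgeDiff (C := C) hν
  have e1 : Gam C (copulaGpi S c Z ρ) (copulaGini ρ)
      = Gam C (FstarJ S c Z ρ) (copulaGini ρ)
        + Gam C (bridgeDiff (nu S c Z ρ)) (copulaGini ρ) :=
    covariance_add_left hFJ hβ (memLp_copulaGini hC hF hT hL)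
  rw [e1, gam_copulaGini hC hF hT hL hFJ, gam_copulaGini hC hF hT hL hβ,
    hC.gam_bridgeDiff hL hFJ, gam_comm (bridgeDiff _) (Fstar ρ), gam_comm (bridgeDiff _) (Ftilde ρ),
    gam_comm (bridgeDiff _) (bridgeDiff _),
    hC.gam_bridgeDiff_bridgeDiff hL hν, hC.gam_bridgeDiff hν hF, hC.gam_bridgeDiff hν hT, covGpiGini]
  ring

end Covariance

/-! ### Covariance matrices of pairs -/

section Pair

variable {α : Type*} [MeasurableSpace α] {μ : Measure α} [IsFiniteMeasure μ]

theorem variance_lin_comb {f g : α → ℝ} (hf : MemLp f 2 μ) (hg : MemLp g 2 μ) (a b : ℝ) :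
    Var[fun x => a * f x + b * g x; μ]
      = a ^ 2 * cov[f, f; μ] + 2 * a * b * cov[f, g; μ] + b ^ 2 * cov[g, g; μ] := by
  have h := variance_fun_add (hf.const_mul a) (hg.const_mul b)
  rw [h, variance_const_mul, variance_const_mul, covariance_const_mul_left,
    covariance_const_mul_right, covariance_self hf.aemeasurable, covariance_self hg.aemeasurable]
  ring

/-- Covariance matrix of a pair. -/
def covMatrix (μ : Measure α) (f g : α → ℝ) : Matrix (Fin 2) (Fin 2) ℝ :=
  !![cov[f, f; μ], cov[f, g; μ]; cov[f, g; μ], cov[g, g; μ]]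

theorem dotProduct_covMatrix {f g : α → ℝ} (hf : MemLp f 2 μ) (hg : MemLp g 2 μ) (t : Fin 2 → ℝ) :
    t ⬝ᵥ (covMatrix μ f g).mulVec t = Var[fun x => t 0 * f x + t 1 * g x; μ] := by
  rw [variance_lin_comb hf hg]
  simp [covMatrix, Matrix.mulVec, dotProduct, Fin.sum_univ_two]
  ring

theorem posSemidef_covMatrix {f g : α → ℝ} (hf : MemLp f 2 μ) (hg : MemLp g 2 μ) :
    (covMatrix μ f g).PosSemidef := by
  refine Matrix.PosSemidef.of_dotProduct_mulVec_nonneg ?_ fun t => ?_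
  · ext i j
    fin_cases i <;> fin_cases j <;> simp [covMatrix]
  · rw [star_trivial, dotProduct_covMatrix hf hg]
    exact variance_nonneg _ _

theorem charFun_gaussian_covMatrix {f g : α → ℝ} (hf : MemLp f 2 μ) (hg : MemLp g 2 μ)
    (t : EuclideanSpace ℝ (Fin 2)) :
    charFun (multivariateGaussian 0 (covMatrix μ f g)) t
      = Complex.exp (-(Var[fun x => t 0 * f x + t 1 * g x; μ] : ℝ) / 2) := by
  rw [charFun_multivariateGaussian (posSemidef_covMatrix hf hg), inner_zero_right,
    ← dotProduct_covMatrix hf hg]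
  congr 1
  push_cast
  ring

end Pair

/-! ### Gaussian pairs and the central limit theorem for pairs -/

section PairLimits

variable {Ω : Type*} [MeasurableSpace Ω] {P : Measure Ω}

theorem aemeasurable_pair {X Y : Ω → ℝ} (hX : AEMeasurable X P) (hY : AEMeasurable Y P) :
    AEMeasurable (fun ω => !₂[X ω, Y ω]) P := by
  have h : AEMeasurable (fun ω => ![X ω, Y ω]) P := by
    rw [aemeasurable_pi_iff]
    intro i
    fin_cases i
    · exact hX
    · exact hY
  exact (PiLp.continuous_toLp 2 _).measurable.comp_aemeasurable h

theorem charFun_pair {X Y : Ω → ℝ} (hX : AEMeasurable X P) (hY : AEMeasurable Y P)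
    (t : EuclideanSpace ℝ (Fin 2)) :
    charFun (P.map (fun ω => !₂[X ω, Y ω])) t
      = charFun (P.map (fun ω => t 0 * X ω + t 1 * Y ω)) 1 := by
  have hlin : AEMeasurable (fun ω => t 0 * X ω + t 1 * Y ω) P := by fun_prop
  rw [charFun_apply, charFun_apply, integral_map (aemeasurable_pair hX hY) (by fun_prop),
    integral_map hlin (by fun_prop)]
  refine integral_congr_ae (Eventually.of_forall fun ω => ?_)
  simp [PiLp.inner_apply, Fin.sum_univ_two]

variable [IsProbabilityMeasure P]

theorem hasLaw_gaussian_pair {α : Type*} [MeasurableSpace α] {μ : Measure α} [IsFiniteMeasure μ]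
    {f g : α → ℝ} (hf : MemLp f 2 μ) (hg : MemLp g 2 μ) {X Y : Ω → ℝ}
    (hXY : HasGaussianLaw (fun ω => (X ω, Y ω)) P) (hX0 : ∫ ω, X ω ∂P = 0) (hY0 : ∫ ω, Y ω ∂P = 0)
    (hXX : cov[X, X; P] = cov[f, f; μ]) (hXYc : cov[X, Y; P] = cov[f, g; μ])
    (hYY : cov[Y, Y; P] = cov[g, g; μ]) :
    HasLaw (fun ω => !₂[X ω, Y ω]) (multivariateGaussian 0 (covMatrix μ f g)) P := by
  have hX := hXY.fst.aemeasurable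
  have hY := hXY.snd.aemeasurable
  have hm := aemeasurable_pair hX hY
  have : IsProbabilityMeasure (P.map (fun ω => !₂[X ω, Y ω])) := Measure.isProbabilityMeasure_map hm
  refine ⟨hm, Measure.ext_of_charFun (funext fun t => ?_)⟩
  rw [charFun_pair hX hY, charFun_gaussian_covMatrix hf hg]
  have hlin : HasGaussianLaw (fun ω => t 0 * X ω + t 1 * Y ω) P :=
    hXY.map_fun (t 0 • ContinuousLinearMap.fst ℝ ℝ ℝ + t 1 • ContinuousLinearMap.snd ℝ ℝ ℝ)
  rw [hlin.map_eq_gaussianReal, charFun_gaussianReal,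
    variance_lin_comb hXY.fst.memLp_two hXY.snd.memLp_two, hXX, hXYc, hYY,
    ← variance_lin_comb hf hg,
    integral_add (hXY.fst.integrable.const_mul _) (hXY.snd.integrable.const_mul _),
    integral_const_mul, integral_const_mul, hX0, hY0,
    Real.coe_toNNReal _ (variance_nonneg _ _)]
  congr 1
  push_cast
  ring

/-- Central limit theorem for pairs. -/
theorem tendstoInDistribution_pair {E : Type*} [MeasurableSpace E] {ρ : Measure E}
    {Y : ℕ → Ω → E} (hlaw : ∀ n, HasLaw (Y n) ρ P) (hindep : iIndepFun Y P)
    [IsProbabilityMeasure ρ] {f g : E → ℝ} (hf : MemLp f 2 ρ) (hg : MemLp g 2 ρ) :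
    TendstoInDistribution
      (fun (n : ℕ) ω =>
        !₂[(√(n : ℝ))⁻¹ * ∑ j ∈ Finset.range n, (f (Y j ω) - ∫ y, f y ∂ρ),
          (√(n : ℝ))⁻¹ * ∑ j ∈ Finset.range n, (g (Y j ω) - ∫ y, g y ∂ρ)])
      atTop (fun x : EuclideanSpace ℝ (Fin 2) => x) (fun _ => P)
      (multivariateGaussian 0 (covMatrix ρ f g)) := by
  have hm : ∀ {h : E → ℝ}, MemLp h 2 ρ → ∀ n : ℕ, AEMeasurable
      (fun ω => (√(n : ℝ))⁻¹ * ∑ j ∈ Finset.range n, (h (Y j ω) - ∫ y, h y ∂ρ)) P :=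
    fun {h} hh n => by
      refine AEMeasurable.const_mul ?_ _
      refine Finset.aemeasurable_fun_sum _ fun j _ => AEMeasurable.sub_const ?_ _
      exact ((hlaw j).map_eq.symm ▸ hh.aemeasurable :
        AEMeasurable h (P.map (Y j))).comp_aemeasurable (hlaw j).aemeasurable
  refine ⟨fun n => aemeasurable_pair (hm hf n) (hm hg n), aemeasurable_id, ?_⟩
  refine ProbabilityMeasure.tendsto_iff_tendsto_charFun.2 fun t => ?_
  simp only [ProbabilityMeasure.coe_mk, Measure.map_id']
  simp only [charFun_pair (hm hf _) (hm hg _), charFun_gaussian_covMatrix hf hg]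
  set h : E → ℝ := fun y => t 0 * f y + t 1 * g y with hh
  have hhm : MemLp h 2 ρ := (hf.const_mul _).add (hg.const_mul _)
  have hhY : ∀ n, AEMeasurable h (P.map (Y n)) := fun n =>
    (hlaw n).map_eq.symm ▸ hhm.aemeasurable
  have hid : ∀ n, HasLaw (fun ω => h (Y n ω)) (ρ.map h) P := fun n =>
    HasLaw.comp ⟨hhm.aemeasurable, rfl⟩ (hlaw n)
  have hvar : Var[fun ω => h (Y 0 ω); P] = Var[h; ρ] := by
    have h1 := (hlaw 0).covariance_comp hhm.aemeasurable hhm.aemeasurable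
    rw [covariance_self hhm.aemeasurable,
      covariance_self ((hhY 0).comp_aemeasurable (hlaw 0).aemeasurable)] at h1
    exact h1
  have hmean : ∫ ω, h (Y 0 ω) ∂P = ∫ y, h y ∂ρ := (hlaw 0).integral_comp hhm.aestronglyMeasurable
  have hclt := tendstoInDistribution_inv_sqrt_mul_sum_sub (P := P)
    (X := fun n ω => h (Y n ω)) (Y := fun x : ℝ => x)
    (P' := gaussianReal 0 Var[fun ω => h (Y 0 ω); P].toNNReal)
    ⟨aemeasurable_id, by simp⟩
    (memLp_comp_hasLaw (hlaw 0) hhm)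
    (hindep.comp₀ (fun _ => h) (fun n => (hlaw n).aemeasurable) hhY)
    (fun n => (hid n).identDistrib (hid 0))
  have hch := ProbabilityMeasure.tendsto_iff_tendsto_charFun.1 hclt.tendsto 1
  simp only [ProbabilityMeasure.coe_mk, Measure.map_id', charFun_gaussianReal] at hch
  rw [hvar, hmean] at hch
  have hlim : Complex.exp (-((Var[h; ρ] : ℝ) : ℂ) / 2)
      = Complex.exp ((1 : ℝ) * (0 : ℝ) * Complex.I
        - ((Var[h; ρ].toNNReal : ℝ) : ℂ) * ((1 : ℝ) : ℂ) ^ 2 / 2) := by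
    rw [Real.coe_toNNReal _ (variance_nonneg _ _)]
    congr 1
    push_cast
    ring
  rw [hlim]
  refine hch.congr fun n => ?_
  congr 2
  ext ω
  have hint : ∫ y, h y ∂ρ = t 0 * ∫ y, f y ∂ρ + t 1 * ∫ y, g y ∂ρ := by
    rw [hh, integral_add ((hf.integrable (by simp)).const_mul _)
      ((hg.integrable (by simp)).const_mul _), integral_const_mul, integral_const_mul]
  rw [hint]
  simp only [hh, Finset.sum_add_distrib, Finset.sum_sub_distrib, ← Finset.mul_sum,
    Finset.sum_const, Finset.card_range, nsmul_eq_mul]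
  ring

end PairLimits

/-! ### Functionals of the Brownian bridge -/

section Bridge

variable {Ω' : Type*} [MeasurableSpace Ω'] {P' : Measure Ω'}
  {ρ C : Measure (Fin 2 → ℝ)} {T : ((Fin 2 → ℝ) → ℝ) → Ω' → ℝ} {f g : (Fin 2 → ℝ) → ℝ}

theorem IsBrownianBridge.memLp (hT : IsBrownianBridge P' C T) (hf : MemLp f 2 C) :
    MemLp (T f) 2 P' :=
  (hT.gaussian.hasGaussianLaw_eval ⟨f, hf⟩).memLp_two

/-- A square integrable variable with the covariances of `T f` is almost surely `T f`. -/
theorem IsBrownianBridge.ae_eq_of_integral (hT : IsBrownianBridge P' C T) (hf : MemLp f 2 C)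
    {X : Ω' → ℝ} (hX : MemLp X 2 P') (hXX : ∫ ω, X ω * X ω ∂P' = Gam C f f)
    (hXT : ∫ ω, X ω * T f ω ∂P' = Gam C f f) : X =ᵐ[P'] T f := by
  have hTf := hT.memLp hf
  have i1 : Integrable (fun ω => X ω * X ω) P' := hX.integrable_mul hX
  have i2 : Integrable (fun ω => 2 * (X ω * T f ω)) P' := (hX.integrable_mul hTf).const_mul 2
  have i3 : Integrable (fun ω => T f ω * T f ω) P' := hTf.integrable_mul hTf
  have i4 : Integrable (fun ω => X ω * X ω - 2 * (X ω * T f ω)) P' := i1.sub i2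
  have i5 : Integrable (fun ω => X ω * X ω - 2 * (X ω * T f ω) + T f ω * T f ω) P' := i4.add i3
  have h : ∫ ω, (X ω * X ω - 2 * (X ω * T f ω) + T f ω * T f ω) ∂P' = 0 := by
    rw [integral_add i4 i3, integral_sub i1 i2, integral_const_mul, hXX, hXT, hT.covariance_eq f f hf hf]
    ring
  have h0 := (integral_eq_zero_iff_of_nonneg (fun ω => by
    have := sq_nonneg (X ω - T f ω)
    simp only [Pi.zero_apply]
    linarith) i5).1 h
  filter_upwards [h0] with ω hω
  have : (X ω - T f ω) ^ 2 = 0 := by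
    simp only [Pi.zero_apply] at hω
    linarith [hω]
  exact sub_eq_zero.1 (pow_eq_zero_iff two_ne_zero |>.1 this)

theorem IsBrownianBridge.add_ae_eq (hT : IsBrownianBridge P' C T) [IsProbabilityMeasure C]
    (hf : MemLp f 2 C) (hg : MemLp g 2 C) :
    (fun ω => T f ω + T g ω) =ᵐ[P'] T (fun u => f u + g u) := by
  have hfg : MemLp (fun u => f u + g u) 2 C := hf.add hg
  have m : ∀ {h}, MemLp h 2 C → MemLp (T h) 2 P' := fun hh => hT.memLp hh
  have key : ∀ X : Ω' → ℝ, MemLp X 2 P' →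
      ∫ ω, (T f ω + T g ω) * X ω ∂P' = ∫ ω, T f ω * X ω ∂P' + ∫ ω, T g ω * X ω ∂P' :=
    fun X hX => by
      simp only [add_mul]
      exact integral_add ((m hf).integrable_mul hX) ((m hg).integrable_mul hX)
  have hG : ∀ h, MemLp h 2 C → Gam C (fun u => f u + g u) h = Gam C f h + Gam C g h :=
    fun h hh => covariance_add_left hf hg hh
  have hT1 : ∀ h, MemLp h 2 C → ∫ ω, (T f ω + T g ω) * T h ω ∂P' = Gam C (fun u => f u + g u) h :=
    fun h hh => by
      rw [key _ (m hh), hT.covariance_eq f h hf hh, hT.covariance_eq g h hg hh, hG h hh]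
  refine hT.ae_eq_of_integral hfg ((m hf).add (m hg)) ?_ (hT1 _ hfg)
  rw [key (fun ω => T f ω + T g ω) ((m hf).add (m hg)), hG _ hfg, gam_comm f, gam_comm g, ← hT1 f hf, ← hT1 g hg]
  congr 1 <;> exact integral_congr_ae (Eventually.of_forall fun ω => mul_comm _ _)

theorem IsBrownianBridge.const_mul_ae_eq (hT : IsBrownianBridge P' C T) [IsProbabilityMeasure C]
    (hf : MemLp f 2 C) (a : ℝ) :
    (fun ω => a * T f ω) =ᵐ[P'] T (fun u => a * f u) := by
  have haf : MemLp (fun u => a * f u) 2 C := hf.const_mul a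
  have hG : ∀ h, Gam C (fun u => a * f u) h = a * Gam C f h :=
    fun h => covariance_const_mul_left a
  refine hT.ae_eq_of_integral haf ((hT.memLp hf).const_mul a) ?_ ?_
  · rw [hG, gam_comm, hG, ← hT.covariance_eq f f hf hf, ← integral_const_mul, ← integral_const_mul]
    exact integral_congr_ae (Eventually.of_forall fun ω => by ring)
  · rw [hG, ← hT.covariance_eq f _ hf haf, ← integral_const_mul]
    exact integral_congr_ae (Eventually.of_forall fun ω => by ring)

theorem IsBrownianBridge.sub_ae_eq (hT : IsBrownianBridge P' C T) [IsProbabilityMeasure C]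
    (hf : MemLp f 2 C) (hg : MemLp g 2 C) :
    (fun ω => T f ω - T g ω) =ᵐ[P'] T (fun u => f u - g u) := by
  have h1 := hT.add_ae_eq hf (hg.const_mul (-1))
  have h2 := hT.const_mul_ae_eq hg (-1)
  rw [show (fun u => f u + -1 * g u) = fun u => f u - g u from funext fun u => by ring] at h1
  filter_upwards [h1, h2] with ω e1 e2
  rw [← e1, ← e2]
  ring

theorem IsBrownianBridge.lintegral_fInd_sq_le (hT : IsBrownianBridge P' C T)
    (hC : IsCopulaOf C ρ) (i : Fin 2) :
    ∀ᵐ s ∂((volume : Measure ℝ).restrict (Ioo 0 1)), ∫⁻ ω, ‖T (fInd i s) ω‖ₑ ^ 2 ∂P' ≤ 1 := by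
  have := hC.isProbabilityMeasure
  refine ae_restrict_Ioo_of_forall fun s hs => ?_
  have hm : MemLp (fun ω => T (fInd i s) ω) 2 P' := hT.memLp (memLp_fInd (C := C) i s)
  have hint : Integrable (fun ω => T (fInd i s) ω * T (fInd i s) ω) P' := hm.integrable_mul hm
  have h1 : ∀ ω, ‖T (fInd i s) ω‖ₑ ^ 2 = ENNReal.ofReal (T (fInd i s) ω * T (fInd i s) ω) :=
    fun ω => by
      rw [Real.enorm_eq_ofReal_abs, ← ENNReal.ofReal_pow (abs_nonneg _), sq_abs, sq]
  simp only [h1]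
  rw [← ofReal_integral_eq_lintegral_ofReal hint
    (Eventually.of_forall fun ω => mul_self_nonneg _)]
  have h2 := hT.covariance_eq _ _ (memLp_fInd (C := C) i s) (memLp_fInd i s)
  have hs' : s ∈ Icc (0 : ℝ) 1 := ⟨hs.1.le, hs.2.le⟩
  rw [hC.gam_fInd_fInd_same i hs' hs', min_self] at h2
  refine ENNReal.ofReal_le_one.2 (h2.le.trans ?_)
  nlinarith [hs.1, hs.2]

variable [IsProbabilityMeasure P']

theorem IsBrownianBridge.covariance (hT : IsBrownianBridge P' C T) (hf : MemLp f 2 C)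
    (hg : MemLp g 2 C) : cov[T f, T g; P'] = Gam C f g := by
  rw [covariance_eq_sub (hT.memLp hf) (hT.memLp hg), hT.centered f hf, zero_mul, sub_zero]
  exact hT.covariance_eq f g hf hg

/-- The average of the bridge against `φ` is the bridge evaluated at the averaged indicator. -/
theorem IsBrownianBridge.average_ae_eq (hT : IsBrownianBridge P' C T)
    (hC : IsCopulaOf C ρ) (i : Fin 2) {φ : ℝ → ℝ}
    (hφ : Integrable φ ((volume : Measure ℝ).restrict (Ioo 0 1))) :
    (fun ω => ∫ s, φ s * T (fInd i s) ω ∂((volume : Measure ℝ).restrict (Ioo 0 1)))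
      =ᵐ[P'] T (bridgeAvg i φ) := by
  have := hC.isProbabilityMeasure
  have hb := memLp_bridgeAvg (C := C) i hφ
  have hk := hT.measurable_path i
  have hk2 := hT.lintegral_fInd_sq_le hC i
  have hW := memLp_average hk hk2 hφ
  have hWT : ∀ h, MemLp h 2 C →
      ∫ ω, (∫ s, φ s * T (fInd i s) ω ∂((volume : Measure ℝ).restrict (Ioo 0 1))) * T h ω ∂P'
        = Gam C h (bridgeAvg i φ) := fun h hh => by
    rw [integral_average_mul hk hk2 hφ (hT.memLp hh), hC.gam_bridgeAvg i hφ hh,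
      intervalIntegral_eq_restrict_Ioo]
    refine integral_congr_ae (ae_restrict_Ioo_of_forall fun s _ => ?_)
    beta_reduce
    rw [hT.covariance_eq _ h (memLp_fInd i s) hh, gam_comm]
  refine hT.ae_eq_of_integral hb hW ?_ (hWT _ hb)
  rw [integral_average_mul hk hk2 hφ hW, hC.gam_bridgeAvg i hφ hb, intervalIntegral_eq_restrict_Ioo]
  refine integral_congr_ae (ae_restrict_Ioo_of_forall fun s _ => ?_)
  beta_reduce
  rw [gam_comm, ← hWT _ (memLp_fInd i s)]
  congr 1
  exact integral_congr_ae (Eventually.of_forall fun ω => mul_comm _ _)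

theorem IsBrownianBridge.betaStar_ae_eq (hT : IsBrownianBridge P' C T)
    (hC : IsCopulaOf C ρ) {φ : Fin 2 → ℝ → ℝ}
    (hφ : ∀ i, Integrable (φ i) ((volume : Measure ℝ).restrict (Ioo 0 1))) :
    betaStar T φ =ᵐ[P'] T (bridgeDiff φ) := by
  have := hC.isProbabilityMeasure
  have hint := fun i =>
    ae_integrable_average (hT.measurable_path i) (hT.lintegral_fInd_sq_le hC i) (hφ i)
  have hsub := hT.sub_ae_eq (memLp_bridgeAvg (C := C) 1 (hφ 1)) (memLp_bridgeAvg 0 (hφ 0))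
  filter_upwards [hint 0, hint 1, hT.average_ae_eq hC 0 (hφ 0), hT.average_ae_eq hC 1 (hφ 1), hsub]
    with ω i0 i1 e0 e1 es
  rw [betaStar, intervalIntegral_eq_restrict_Ioo]
  simp only [mul_comm (T _ ω)]
  rw [integral_sub i1 i0, e0, e1, es]
  rfl

variable {S : PovertySpec} {c : Fin 2 → ℝ → ℝ → ℝ} {Z : Fin 2 → ℝ}

theorem IsBrownianBridge.limGpi_ae_eq (hT : IsBrownianBridge P' C T) (hC : IsCopulaOf C ρ)
    (hFJ : MemLp (FstarJ S c Z ρ) 2 C)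
    (hν : ∀ i, Integrable (nu S c Z ρ i) ((volume : Measure ℝ).restrict (Ioo 0 1))) :
    limGpi S c Z ρ T =ᵐ[P'] T (copulaGpi S c Z ρ) := by
  have := hC.isProbabilityMeasure
  filter_upwards [hT.betaStar_ae_eq hC hν, hT.add_ae_eq hFJ (memLp_bridgeDiff hν)] with ω h1 h2
  rw [limGpi, h1, h2]
  rfl

theorem IsBrownianBridge.limGini_ae_eq (hT : IsBrownianBridge P' C T) (hC : IsCopulaOf C ρ)
    (hF : MemLp (Fstar ρ) 2 C) (hFt : MemLp (Ftilde ρ) 2 C)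
    (hL : ∀ i, Integrable (L ρ i) ((volume : Measure ℝ).restrict (Ioo 0 1))) :
    limGini ρ T =ᵐ[P'] T (copulaGini ρ) := by
  have := hC.isProbabilityMeasure
  have hb := memLp_bridgeDiff (C := C) hL
  filter_upwards [hT.betaStar_ae_eq hC hL, hT.add_ae_eq hF hb, hT.sub_ae_eq (hF.add hb) hFt]
    with ω h1 h2 h3
  rw [limGini, h1, h2]
  exact h3

theorem IsBrownianBridge.hasLaw_pair (hT : IsBrownianBridge P' C T) [IsProbabilityMeasure C]
    (hf : MemLp f 2 C) (hg : MemLp g 2 C) :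
    HasLaw (fun ω => !₂[T f ω, T g ω]) (multivariateGaussian 0 (covMatrix C f g)) P' :=
  hasLaw_gaussian_pair hf hg
    (hT.gaussian.hasGaussianLaw_prodMk (s := ⟨f, hf⟩) (t := ⟨g, hg⟩))
    (hT.centered f hf) (hT.centered g hg) (hT.covariance hf hf) (hT.covariance hf hg)
    (hT.covariance hg hg)

end Bridge

/-! ### Asymptotic normality of the variations and of their ratio -/

section Ratio

variable {Ω : Type*} [MeasurableSpace Ω] {P : Measure Ω}

theorem NegligibleInProb.of_eq_of_ne {R D V : ℕ → Ω → ℝ} {v : ℝ} (hD : NegligibleInProb P D)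
    (hV : NegligibleInProb P (fun n ω => V n ω - v)) (hv : v ≠ 0)
    (h : ∀ n ω, V n ω ≠ 0 → R n ω = D n ω) : NegligibleInProb P R := by
  intro ε hε
  have hsum := (hD ε hε).add (hV |v| (abs_pos.2 hv))
  rw [add_zero] at hsum
  refine tendsto_of_tendsto_of_tendsto_of_le_of_le tendsto_const_nhds hsum (fun _ => zero_le)
    fun n => le_trans (measure_mono fun ω hω => ?_) (measure_union_le _ _)
  by_cases h0 : V n ω = 0
  · right
    simp [h0]
  · left
    rw [mem_ofPred_eq, h n ω h0] at hω
    exact hω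

/-- First order expansion of a ratio of two `√n`-consistent estimators. -/
theorem negligibleInProb_ratio {U V : ℕ → Ω → ℝ} {u v : ℝ} (hv : v ≠ 0)
    (hU : BoundedInProb P (fun n ω => √(n : ℝ) * (U n ω - u)))
    (hV : BoundedInProb P (fun n ω => √(n : ℝ) * (V n ω - v))) :
    NegligibleInProb P (fun n ω => √(n : ℝ) * (U n ω / V n ω - u / v)
      - (1 / v * (√(n : ℝ) * (U n ω - u)) - u / v ^ 2 * (√(n : ℝ) * (V n ω - v)))) := by
  have hinv : Tendsto (fun n : ℕ => (√(n : ℝ))⁻¹) atTop (𝓝 0) :=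
    (Real.tendsto_sqrt_atTop.comp tendsto_natCast_atTop_atTop).inv_tendsto_atTop
  have hVn : NegligibleInProb P (fun n ω => V n ω - v) := by
    refine (hV.mul_negligible (negligibleInProb_of_tendsto hinv)).congr ?_
    filter_upwards [eventually_gt_atTop 0] with n hn
    refine Eventually.of_forall fun ω => ?_
    have : √(n : ℝ) ≠ 0 := (Real.sqrt_pos.2 (Nat.cast_pos.2 hn)).ne'
    field_simp
  have hι := hVn.inv_sub_const_inv hv
  refine NegligibleInProb.of_eq_of_ne ((hU.mul_negligible hι).sub
    ((hV.mul_negligible hι).const_mul (u / v))) hVn hv fun n ω h0 => ?_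
  field_simp
  ring

theorem map_gaussian_covMatrix {α : Type*} [MeasurableSpace α] {μ : Measure α} [IsFiniteMeasure μ]
    {f g : α → ℝ} (hf : MemLp f 2 μ) (hg : MemLp g 2 μ) (a b : ℝ) :
    (multivariateGaussian 0 (covMatrix μ f g)).map
        (fun x : EuclideanSpace ℝ (Fin 2) => a * x 0 - b * x 1)
      = gaussianReal 0 Var[fun x => a * f x + -b * g x; μ].toNNReal := by
  have hm : Measurable (fun x : EuclideanSpace ℝ (Fin 2) => a * x 0 - b * x 1) := by fun_prop
  have := Measure.isProbabilityMeasure_map (μ := multivariateGaussian 0 (covMatrix μ f g))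
    hm.aemeasurable
  refine Measure.ext_of_charFun (funext fun t => ?_)
  have h1 : charFun ((multivariateGaussian 0 (covMatrix μ f g)).map
        (fun x : EuclideanSpace ℝ (Fin 2) => a * x 0 - b * x 1)) t
      = charFun (multivariateGaussian 0 (covMatrix μ f g)) !₂[t * a, t * -b] := by
    rw [charFun_apply, charFun_apply, integral_map hm.aemeasurable (by fun_prop)]
    refine integral_congr_ae (Eventually.of_forall fun x => ?_)
    simp [PiLp.inner_apply, Fin.sum_univ_two]
    ring_nf
  rw [h1, charFun_gaussian_covMatrix hf hg, charFun_gaussianReal,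
    Real.coe_toNNReal _ (variance_nonneg _ _), variance_lin_comb hf hg, variance_lin_comb hf hg]
  congr 1
  simp
  ring

end Ratio

section Main

variable {Ω : Type*} [MeasurableSpace Ω] {P : Measure Ω}
  {ρ C : Measure (Fin 2 → ℝ)} {Y : ℕ → Ω → Fin 2 → ℝ}

theorem integral_coord_sub {h : Fin 2 → ℝ → ℝ} (hh : ∀ i, Integrable (h i) (margin ρ i)) :
    ∫ y, (h 1 (y 1) - h 0 (y 0)) ∂ρ = ∫ x, h 1 x ∂(margin ρ 1) - ∫ x, h 0 x ∂(margin ρ 0) := by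
  have hi : ∀ i, Integrable (fun y : Fin 2 → ℝ => h i (y i)) ρ := fun i =>
    (hh i).comp_aemeasurable (measurable_pi_apply i).aemeasurable
  rw [integral_sub (hi 1) (hi 0)]
  congr 1 <;>
    exact (integral_map (measurable_pi_apply _).aemeasurable (hh _).aestronglyMeasurable).symm

/-- The linear parts at the two periods combine into one normalized sum. -/
theorem negligibleInProb_variation {h : Fin 2 → ℝ → ℝ} (hh : ∀ i, Integrable (h i) (margin ρ i))
    {I : Fin 2 → ℕ → Ω → ℝ} {J : Fin 2 → ℝ}
    (hlin : ∀ i, NegligibleInProb P (fun n ω => √(n : ℝ) * (I i n ω - J i)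
      - (√(n : ℝ))⁻¹ * ∑ j ∈ Finset.range n, (h i (Y j ω i) - ∫ x, h i x ∂(margin ρ i)))) :
    NegligibleInProb P (fun n ω => √(n : ℝ) * ((I 1 n ω - I 0 n ω) - (J 1 - J 0))
      - (√(n : ℝ))⁻¹ * ∑ j ∈ Finset.range n, ((h 1 (Y j ω 1) - h 0 (Y j ω 0))
          - ∫ y, (h 1 (y 1) - h 0 (y 0)) ∂ρ)) := by
  refine ((hlin 1).sub (hlin 0)).congr
    (Eventually.of_forall fun n => Eventually.of_forall fun ω => ?_)
  rw [integral_coord_sub hh]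
  simp only [Finset.sum_sub_distrib]
  ring

theorem covariance_congr_ae {α : Type*} [MeasurableSpace α] {μ : Measure α} {f f' g g' : α → ℝ}
    (hf : f =ᵐ[μ] f') (hg : g =ᵐ[μ] g') : cov[f, g; μ] = cov[f', g'; μ] := by
  unfold covariance
  rw [integral_congr_ae hf, integral_congr_ae hg]
  refine integral_congr_ae ?_
  filter_upwards [hf, hg] with x h1 h2
  rw [h1, h2]

variable [IsProbabilityMeasure ρ]

/-- Functions of the incomes that become `f` and `g` under the quantile transform have the same
covariance matrix as `f` and `g`. -/
theorem IsCopulaOf.covMatrix_eq (hC : IsCopulaOf C ρ) (hcont : ∀ i, Continuous (F ρ i))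
    {f g h k : (Fin 2 → ℝ) → ℝ} (hh : AEStronglyMeasurable h ρ) (hk : AEStronglyMeasurable k ρ)
    (hf : (fun u : Fin 2 → ℝ => h fun i => ell ρ i (u i)) =ᵐ[C] f)
    (hg : (fun u : Fin 2 → ℝ => k fun i => ell ρ i (u i)) =ᵐ[C] g) :
    covMatrix ρ h k = covMatrix C f g := by
  have hX := hC.hasLaw_ell hcont
  unfold covMatrix
  rw [← hX.covariance_fun_comp hh.aemeasurable hh.aemeasurable,
    ← hX.covariance_fun_comp hh.aemeasurable hk.aemeasurable,
    ← hX.covariance_fun_comp hk.aemeasurable hk.aemeasurable,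
    covariance_congr_ae hf hf, covariance_congr_ae hf hg, covariance_congr_ae hg hg]

theorem IsCopulaOf.memLp_of_comp (hC : IsCopulaOf C ρ) (hcont : ∀ i, Continuous (F ρ i))
    {f h : (Fin 2 → ℝ) → ℝ} (hh : AEStronglyMeasurable h ρ)
    (hf : (fun u : Fin 2 → ℝ => h fun i => ell ρ i (u i)) =ᵐ[C] f) (hfm : MemLp f 2 C) :
    MemLp h 2 ρ := by
  have hX := hC.hasLaw_ell hcont
  rw [← hX.map_eq] at hh ⊢
  exact (memLp_map_measure_iff hh hX.aemeasurable).2 (hfm.ae_eq hf.symm)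

variable [IsProbabilityMeasure P]

theorem norm_pair_le (x y : ℝ) : ‖!₂[x, y]‖ ≤ |x| + |y| := by
  rw [EuclideanSpace.norm_eq, Fin.sum_univ_two]
  refine Real.sqrt_le_iff.2 ⟨by positivity, ?_⟩
  simp only [Matrix.cons_val_zero, Matrix.cons_val_one, Real.norm_eq_abs]
  nlinarith [abs_nonneg x, abs_nonneg y]

/-- A pair whose coordinates are asymptotically equivalent to those of a pair converging in
distribution converges to the same limit. -/
theorem TendstoInDistribution.pair_of_negligible {U V U' V' : ℕ → Ω → ℝ}
    {μ : Measure (EuclideanSpace ℝ (Fin 2))} [IsProbabilityMeasure μ]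
    (h : TendstoInDistribution (fun (n : ℕ) ω => !₂[U n ω, V n ω]) atTop
      (fun x : EuclideanSpace ℝ (Fin 2) => x) (fun _ => P) μ)
    (hU : NegligibleInProb P (fun n ω => U' n ω - U n ω))
    (hV : NegligibleInProb P (fun n ω => V' n ω - V n ω))
    (hUm : ∀ n, AEMeasurable (U' n) P) (hVm : ∀ n, AEMeasurable (V' n) P) :
    TendstoInDistribution (fun (n : ℕ) ω => !₂[U' n ω, V' n ω]) atTop
      (fun x : EuclideanSpace ℝ (Fin 2) => x) (fun _ => P) μ := by
  refine tendstoInDistribution_of_tendstoInMeasure_sub _ _ h ?_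
    fun n => aemeasurable_pair (hUm n) (hVm n)
  rw [tendstoInMeasure_iff_norm]
  intro ε hε
  have hsum := (hU (ε / 2) (by positivity)).add (hV (ε / 2) (by positivity))
  rw [add_zero] at hsum
  refine tendsto_of_tendsto_of_tendsto_of_le_of_le tendsto_const_nhds hsum (fun _ => zero_le)
    fun n => le_trans (measure_mono fun ω hω => ?_) (measure_union_le _ _)
  have heq : ((fun (n : ℕ) ω => !₂[U' n ω, V' n ω]) - fun (n : ℕ) ω => !₂[U n ω, V n ω]) n ω
      = !₂[U' n ω - U n ω, V' n ω - V n ω] := by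
    ext i
    fin_cases i <;> simp
  simp only [mem_ofPred_eq, heq, Pi.zero_apply, sub_zero] at hω
  have hle := hω.trans (norm_pair_le _ _)
  by_contra hcon
  simp only [mem_union, mem_ofPred_eq, not_or, not_le] at hcon
  linarith [hcon.1, hcon.2]

end Main

end

end GiniPoverty

theorem theorem6
    {Ω : Type*} [MeasurableSpace Ω] (P : Measure Ω) [IsProbabilityMeasure P]
    (ρ C : Measure (Fin 2 → ℝ)) (Y : ℕ → Ω → Fin 2 → ℝ)
    (hlaw : ∀ n, HasLaw (Y n) ρ P) (hindep : iIndepFun Y P)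
    (hpos : ∀ i, ∀ᵐ x ∂(GiniPoverty.margin ρ i), 0 < x)
    (hcont : ∀ i, Continuous (GiniPoverty.F ρ i))
    (hC : GiniPoverty.IsCopulaOf C ρ)
    (hmean : ∀ i, Integrable (fun x : ℝ => x) (GiniPoverty.margin ρ i))
    (hmean0 : ∀ i, GiniPoverty.mean ρ i ≠ 0)
    (hL : ∀ i, ∃ M : ℝ, ∀ s ∈ Set.Ioo (0 : ℝ) 1, |GiniPoverty.L ρ i s| ≤ M)
    (S : GiniPoverty.PovertySpec) (hd : Measurable S.d)
    (Z : Fin 2 → ℝ) (hZ : ∀ i, 0 < Z i)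
    (c : Fin 2 → ℝ → ℝ → ℝ)
    (hc : ∀ i, GiniPoverty.SmoothWeight (c i) (GiniPoverty.F ρ i (Z i)))
    (hw : ∀ i, TendstoInMeasure P
      (fun (n : ℕ) ω => √(n : ℝ) *
        GiniPoverty.weightGap S (c i) (Z i) n (GiniPoverty.poorN (Z i) (fun j => Y j ω) i n))
      atTop (fun _ => 0))
    (hq : ∀ i, Integrable (GiniPoverty.q S Z i) (GiniPoverty.margin ρ i))
    (hFJ : MemLp (GiniPoverty.FstarJ S c Z ρ) 2 C) :
    -- joint asymptotic normality
    (GiniPoverty.Sig S c Z C ρ).PosSemidef ∧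
    TendstoInDistribution
      (fun (n : ℕ) ω =>
        !₂[√(n : ℝ) * (GiniPoverty.deltaGpiN S Z (fun j => Y j ω) n - GiniPoverty.deltaGpi S c Z ρ),
          √(n : ℝ) * (GiniPoverty.deltaGiniN (fun j => Y j ω) n - GiniPoverty.deltaGini ρ)])
      atTop (fun x : EuclideanSpace ℝ (Fin 2) => x) (fun _ => P)
      (multivariateGaussian 0 (GiniPoverty.Sig S c Z C ρ)) ∧
    -- the limit is the law of the pair of limits built from the Gaussian field
    (∀ (Ω' : Type*) [MeasurableSpace Ω'] (P' : Measure Ω') [IsProbabilityMeasure P']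
      (T : ((Fin 2 → ℝ) → ℝ) → Ω' → ℝ), GiniPoverty.IsBrownianBridge P' C T →
      HasLaw (fun ω => !₂[GiniPoverty.limGpi S c Z ρ T ω, GiniPoverty.limGini ρ T ω])
        (multivariateGaussian 0 (GiniPoverty.Sig S c Z C ρ)) P') ∧
    -- asymptotic normality of the ratio
    (GiniPoverty.deltaGini ρ ≠ 0 →
      TendstoInDistribution
        (fun (n : ℕ) ω => √(n : ℝ) *
          (GiniPoverty.deltaGpiN S Z (fun j => Y j ω) n / GiniPoverty.deltaGiniN (fun j => Y j ω) n
            - GiniPoverty.deltaGpi S c Z ρ / GiniPoverty.deltaGini ρ))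
        atTop
        (fun x : EuclideanSpace ℝ (Fin 2) =>
          GiniPoverty.coefA ρ * x 0 - GiniPoverty.coefB S c Z ρ * x 1)
        (fun _ => P) (multivariateGaussian 0 (GiniPoverty.Sig S c Z C ρ)) ∧
      0 ≤ GiniPoverty.varR S c Z C ρ ∧
      (multivariateGaussian 0 (GiniPoverty.Sig S c Z C ρ)).map
          (fun x : EuclideanSpace ℝ (Fin 2) =>
            GiniPoverty.coefA ρ * x 0 - GiniPoverty.coefB S c Z ρ * x 1)
        = gaussianReal 0 (GiniPoverty.varR S c Z C ρ).toNNReal) := by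
  have hρ : IsProbabilityMeasure ρ := (hlaw 0).isProbabilityMeasure_iff.1 inferInstance
  have hCp := hC.isProbabilityMeasure
  have hW := fun i => (hc i).exists_expansion (cdf_nonneg (GiniPoverty.margin ρ i) (Z i))
  have hb := fun i => GiniPoverty.exists_ae_abs_le (hcont i) (hmean0 i) (hL i)
  have hνm : ∀ i, Measurable (GiniPoverty.nuIncome S c Z ρ i) := fun i => by
    obtain ⟨a₀, a₁, a₂, h⟩ := hW i
    exact h.measurable_nuIncome hd
  have hν : ∀ i, Integrable (GiniPoverty.nu S c Z ρ i)
      ((volume : Measure ℝ).restrict (Set.Ioo 0 1)) := fun i => by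
    obtain ⟨a₀, a₁, a₂, h⟩ := hW i
    exact GiniPoverty.integrable_nu hcont (h.integrable_nuIncome (hq i))
  have hLi := GiniPoverty.integrable_L hcont hmean
  have hJi : ∀ i, Integrable (GiniPoverty.inflGpi S c Z ρ i) (GiniPoverty.margin ρ i) := fun i => by
    obtain ⟨a₀, a₁, a₂, h⟩ := hW i
    exact h.integrable_inflGpi hd (hq i)
  have hGi : ∀ i, Integrable (GiniPoverty.inflGini ρ i) (GiniPoverty.margin ρ i) := fun i =>
    (GiniPoverty.memLp_inflGini (hb i)).integrable (by simp)
  have hFs := hC.memLp_Fstar hcont hb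
  have hFt := hC.memLp_Ftilde hcont hb
  have hf := GiniPoverty.memLp_copulaGpi hC hFJ hν
  have hg := GiniPoverty.memLp_copulaGini hC hFs hFt hLi
  -- the covariance matrix
  have hSig : GiniPoverty.Sig S c Z C ρ
      = GiniPoverty.covMatrix C (GiniPoverty.copulaGpi S c Z ρ) (GiniPoverty.copulaGini ρ) := by
    rw [GiniPoverty.Sig, GiniPoverty.varGpi_eq hC hFJ hν, GiniPoverty.varGini_eq hC hFs hFt hLi,
      GiniPoverty.covGpiGini_eq hC hFJ hν hFs hFt hLi]
    rfl
  -- influence functions on the space of incomes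
  have hsm : ∀ {h : Fin 2 → ℝ → ℝ}, (∀ i, Integrable (h i) (GiniPoverty.margin ρ i)) →
      AEStronglyMeasurable (fun y : Fin 2 → ℝ => h 1 (y 1) - h 0 (y 0)) ρ := fun {h} hh =>
    ((hh 1).aestronglyMeasurable.comp_aemeasurable (measurable_pi_apply 1).aemeasurable).sub
      ((hh 0).aestronglyMeasurable.comp_aemeasurable (measurable_pi_apply 0).aemeasurable)
  have hJe := hC.inflGpi_sub_ae_eq (c := c) (Z := Z) (S := S) hcont hνm
  have hGe := hC.inflGini_sub_ae_eq hcont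
  have hJL := hC.memLp_of_comp hcont (hsm hJi) hJe hf
  have hGL := hC.memLp_of_comp hcont (hsm hGi) hGe hg
  have hSigρ := hC.covMatrix_eq hcont (hsm hJi) (hsm hGi) hJe hGe
  have hclt := GiniPoverty.tendstoInDistribution_pair hlaw hindep hJL hGL
  rw [hSigρ, ← hSig] at hclt
  have hJn := GiniPoverty.negligibleInProb_variation hJi fun i =>
    GiniPoverty.negligibleInProb_gpiN hlaw hindep (hpos i) (hcont i) hd (hc i) (hw i) (hq i)
  have hGn := GiniPoverty.negligibleInProb_variation hGi fun i =>
    GiniPoverty.negligibleInProb_giniN hlaw hindep (hpos i) (hcont i) (hmean0 i) (hb i)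
  have hJm : ∀ n, AEMeasurable (fun ω => GiniPoverty.deltaGpiN S Z (fun j => Y j ω) n) P := fun n =>
    (GiniPoverty.aemeasurable_gpiN hlaw hindep (hcont 1) hd (Z 1) n).sub
      (GiniPoverty.aemeasurable_gpiN hlaw hindep (hcont 0) hd (Z 0) n)
  have hGm : ∀ n, AEMeasurable (fun ω => GiniPoverty.deltaGiniN (fun j => Y j ω) n) P := fun n =>
    (GiniPoverty.aemeasurable_giniN hlaw hindep (hcont 1) n).sub
      (GiniPoverty.aemeasurable_giniN hlaw hindep (hcont 0) n)
  have hjoint := GiniPoverty.TendstoInDistribution.pair_of_negligible hclt hJn hGn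
    (fun n => ((hJm n).sub_const (GiniPoverty.deltaGpi S c Z ρ)).const_mul √(n : ℝ))
    (fun n => ((hGm n).sub_const (GiniPoverty.deltaGini ρ)).const_mul √(n : ℝ))
  refine ⟨?_, hjoint, ?_, fun h0 => ?_⟩
  · rw [hSig]
    exact GiniPoverty.posSemidef_covMatrix hf hg
  · intro Ω' _ P' _ T hT
    rw [hSig]
    refine (hT.hasLaw_pair hf hg).congr ?_
    filter_upwards [hT.limGpi_ae_eq hC hFJ hν, hT.limGini_ae_eq hC hFs hFt hLi] with ω h1 h2
    rw [h1, h2]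
  · have hvar : GiniPoverty.varR S c Z C ρ
        = Var[fun u => GiniPoverty.coefA ρ * GiniPoverty.copulaGpi S c Z ρ u
          + -GiniPoverty.coefB S c Z ρ * GiniPoverty.copulaGini ρ u; C] := by
      rw [GiniPoverty.variance_lin_comb hf hg, GiniPoverty.varR, GiniPoverty.varGpi_eq hC hFJ hν,
        GiniPoverty.varGini_eq hC hFs hFt hLi, GiniPoverty.covGpiGini_eq hC hFJ hν hFs hFt hLi]
      simp only [GiniPoverty.gam_eq_covariance]
      ring
    have hbdd : ∀ {U V : ℕ → Ω → ℝ}, GiniPoverty.BoundedInProb P V →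
        GiniPoverty.NegligibleInProb P (fun n ω => U n ω - V n ω) →
        GiniPoverty.BoundedInProb P U := fun hV hUV =>
      (hUV.boundedInProb.add hV).congr (Eventually.of_forall fun n =>
        Eventually.of_forall fun ω => by ring)
    have hR := GiniPoverty.negligibleInProb_ratio h0
      (hbdd (GiniPoverty.boundedInProb_normalized_sum hlaw hindep hJL) hJn)
      (hbdd (GiniPoverty.boundedInProb_normalized_sum hlaw hindep hGL) hGn)
    refine ⟨?_, ?_, ?_⟩
    · have hcomp := hjoint.continuous_comp (g := fun x : EuclideanSpace ℝ (Fin 2) =>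
        GiniPoverty.coefA ρ * x 0 - GiniPoverty.coefB S c Z ρ * x 1) (by fun_prop)
      refine tendstoInDistribution_of_tendstoInMeasure_sub _ _ hcomp
        (GiniPoverty.negligibleInProb_iff_tendstoInMeasure.1 hR) fun n => ?_
      exact (((hJm n).div (hGm n)).sub_const _).const_mul _
    · rw [hvar]
      exact variance_nonneg _ _
    · rw [hSig, hvar]
      exact GiniPoverty.map_gaussian_covMatrix hf hg _ _
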